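/- **Setting.** Fix a non-integer $t_0\in\mathbb C$ and let $\mathbb C[[\vec t\,]]$ be the ring of formal power series in $\vec t=(t_1,t_2,\dots)$, with $x=t_1$, $\partial=\partial/\partial x$. *Fermions.* Let $\psi_n,\psi_n^*$ ($n\in\mathbb Z$) be free fermions, $\psi_i\psi_j^*+\psi_j^*\psi_i=\delta_{ij}$, all other anticommutators being $0$, acting on the Fock space with vacuum $|0\rangle$, $\psi_n|0\rangle=0$ for $n<0$ and $\psi^*_n|0\rangle=0$ for $n\ge 0$ (formal infinite linear combinations of basis states are allowed). For an infinite matrix $A$ with finitely many nonzero diagonals put $Q_A=\sum_{i,j}:\!\psi_iA_{ij}\psi_j^*\!:$, and let $H_k=Q_{\Lambda^k}$, where $\Lambda_{ik}=\delta_{i,k-1}$, $\Gamma_{ik}=(i+t_0)\,\delta_{i-1,k}$ are the matrices of multiplication by $\lambda$ and of $\partial_\lambda$, i.e. $\lambda\cdot\lambda^{i+t_0}=\sum_k\Lambda_{ik}\lambda^{k+t_0}$ and $\partial_\lambda\lambda^{i+t_0}=\sum_k\Gamma_{ik}\lambda^{k+t_0}$; both are invertible. For $m,n\in\mathbb Z$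 let $Q_{mn}$ be the operator $Q_A$ for the matrix $A=\Gamma^n\Lambda^m$ of $\lambda^m\partial_\lambda^n$, $\lambda^m\partial_\lambda^n\lambda^{i+t_0}=\sum_kA_{ik}\lambda^{k+t_0}$. Let $g=e^{X_1}\cdots e^{X_r}$ be a product of exponentials of elements $X_s=Q_{A_s}+c_s$ ($c_s\in\mathbb C$) such that $g|0\rangle$ is defined, in the sense that the exponential series, applied successively to $|0\rangle$, converge componentwise; assume $\langle 0|g|0\rangle\ne0$. Put $$\tau=\langle0|\exp\Big(\sum_{k>0}t_kH_k\Big)g|0\rangle,\qquad \widehat V_{mn}\tau=\langle0|\exp\Big(\sum_{k>0}t_kH_k\Big)Q_{mn}\,g|0\rangle\ \in\ \mathbb C[[\vec t\,]].$$ *Dressings.* A formal dressing is $K=1+\sum_{j\ge1}K_j\partial^{-j}$ with $K_j\in\mathbb C[[\vec t\,]]$. A power series $\tau$ with $\tau(0)\neq0$ determines the dressing $K[\tau]$ given by $$1+\sum_{j\ge1}K_j\lambda^{-j}=\frac{1}{\tau}\exp\Big(-\sum_{k\ge1}\frac{1}{k\lambda^k}\frac{\partial}{\partial t_k}\Big)\tau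 ,$$ so that its Baker–Akhiezer function is $\varphi=Ke^\zeta$ with $\zeta=\sum_{k\ge1}t_k\lambda^k+t_0\ln\lambda$. Let $\hat x=x+t_0\partial^{-1}+\sum_{k\ge2}kt_k\partial^{k-1}$. On the space of formal dressings let $$V_{mn}K=-\big(K\hat x^n\partial^mK^{-1}\big)_-K ,\qquad m,n\in\mathbb Z,$$ where $(\cdot)_-$ is the part with negative powers of $\partial$. For $n<0$ the operator $K\hat x^{n}$ is defined by convention (ii): $K\hat x^{n}e^\zeta=\partial_\lambda^{n}(Ke^\zeta)$, where $e^{\sum t_k\lambda^k}$ is expanded in nonnegative powers of $\lambda$ and $\partial_\lambda^{-1}$ acts termwise by $\partial_\lambda^{-1}\lambda^{s+t_0}=(s+t_0+1)^{-1}\lambda^{s+t_0+1}$, $s\in\mathbb Z$; in particular $\hat x^{-1}=(1+O(\partial))(t_0+1)^{-1}\partial$. **Theorem 7.** For all $m,n\in\mathbb Z$ the flow $\widehat V_{mn}\tau$ induces the $P_\infty$ flow $V_{mn}K$ on the space of formal dressings: if $z\mapsto T(z)\in\mathbb C[[\vec t\,]]$ ($z\in\mathbb C$) is a curve with $T(z_0)=\tau$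 whose coefficients are differentiable at $z_0$ with $\frac{dT}{dz}(z_0)=\widehat V_{mn}\tau$, then all coefficients of the series $K_j[T(z)]$ are differentiable at $z_0$, and $$\frac{d}{dz}K[T(z)]\Big|_{z=z_0}=V_{mn}K[\tau].$$ -/

import Mathlib

namespace KP

noncomputable section

/-! ## Free fermions -/

/-- The (completed) fermionic Fock space: all formal, possibly infinite, linear combinations of the
basis states `|D⟩`, where the finite set `D` of integers records the levels whose occupation differs
from the one in the vacuum (the vacuum has precisely the levels `n < 0` occupied). -/
abbrev Fock := Finset ℤ → ℂ

/-- The vacuum vector `|0⟩`. -/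
def vac : Fock := fun D => if D = ∅ then 1 else 0

/-- The pairing with the dual vacuum, `v ↦ ⟨0|v⟩`. -/
def vacPair (v : Fock) : ℂ := v ∅

/-- The fermionic sign. -/
def fsign (n : ℤ) (D : Finset ℤ) : ℂ := (-1) ^ (D.filter (· < n)).card

/-- The operator adding the excitation `n`: `|D⟩ ↦ ± |D ∪ {n}⟩` for `n ∉ D`, and `0` otherwise. -/
def create (n : ℤ) (v : Fock) : Fock :=
  fun D => if n ∈ D then fsign n D * v (D.erase n) else 0

/-- The operator removing the excitation `n`: `|D⟩ ↦ ± |D \ {n}⟩` for `n ∈ D`, and `0` otherwise. -/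
def annih (n : ℤ) (v : Fock) : Fock :=
  fun D => if n ∈ D then 0 else fsign n D * v (insert n D)

/-- The fermion `ψ_n`; it kills the vacuum for `n < 0`. -/
def psi (n : ℤ) (v : Fock) : Fock := if 0 ≤ n then create n v else annih n v

/-- The fermion `ψ_n^*`; it kills the vacuum for `n ≥ 0`. -/
def psiStar (n : ℤ) (v : Fock) : Fock := if 0 ≤ n then annih n v else create n v

/-- The normally ordered product `:ψ_i ψ_j^*: = ψ_i ψ_j^* - ⟨0|ψ_i ψ_j^*|0⟩`. -/
def normalPair (i j : ℤ) (v : Fock) : Fock :=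
  psi i (psiStar j v) - vacPair (psi i (psiStar j vac)) • v

/-- Generalized Jacobi matrices: infinite matrices with finitely many nonzero diagonals. -/
def IsJacobi (A : Matrix ℤ ℤ ℂ) : Prop := ∃ b : ℤ, ∀ i j, b < |i - j| → A i j = 0

/-- `Q_A = ∑_{i,j} :ψ_i A_{ij} ψ_j^*:`. If `A` is a generalized Jacobi matrix, then every component
of `Q_A v` is a finite sum. -/
def Q (A : Matrix ℤ ℤ ℂ) (v : Fock) : Fock :=
  fun D => ∑ᶠ p : ℤ × ℤ, A p.1 p.2 * normalPair p.1 p.2 v D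

/-- The element `Q_A + c` of the central extension of the algebra of generalized Jacobi matrices,
acting on the Fock space. -/
def glAct (A : Matrix ℤ ℤ ℂ) (c : ℂ) (v : Fock) : Fock := Q A v + c • v

/-- `IsGroupOrbit v` says that `v = g|0⟩` for a product `g = e^{X₁} ⋯ e^{Xᵣ}` of exponentials of
elements `Xᵢ = Q_{Aᵢ} + cᵢ` of the Lie algebra, where each exponential series, applied to the vector
obtained so far, converges in every component. -/
inductive IsGroupOrbit : Fock → Prop
  | vac : IsGroupOrbit vac
  | exp (v w : Fock) (A : Matrix ℤ ℤ ℂ) (c : ℂ) (hv : IsGroupOrbit v) (hA : IsJacobi A)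
      (hw : ∀ D, HasSum (fun r : ℕ => ((r.factorial : ℂ))⁻¹ * ((glAct A c)^[r] v) D) (w D)) :
      IsGroupOrbit w

/-! ## Infinite matrices -/

/-- The product of two generalized Jacobi matrices. -/
def jmul (A B : Matrix ℤ ℤ ℂ) : Matrix ℤ ℤ ℂ := fun i k => ∑ᶠ j, A i j * B j k

/-- Natural powers of a generalized Jacobi matrix. -/
def jpow (A : Matrix ℤ ℤ ℂ) : ℕ → Matrix ℤ ℤ ℂ
  | 0 => 1
  | r + 1 => jmul (jpow A r) A

/-- The matrix `Λ`, of the multiplication by `λ`: `λ · λ^{i+t₀} = ∑_k Λ_{ik} λ^{k+t₀}`. -/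
def Lam : Matrix ℤ ℤ ℂ := fun i k => if k = i + 1 then 1 else 0

/-- The matrix `Λ⁻¹`. -/
def LamInv : Matrix ℤ ℤ ℂ := fun i k => if k = i - 1 then 1 else 0

/-- The matrix `Γ`, of the derivation `∂_λ`: `∂_λ λ^{i+t₀} = ∑_k Γ_{ik} λ^{k+t₀}`. -/
def Gam (t₀ : ℂ) : Matrix ℤ ℤ ℂ := fun i k => if k = i - 1 then (i : ℂ) + t₀ else 0

/-- The matrix `Γ⁻¹` (for `t₀` not an integer). -/
def GamInv (t₀ : ℂ) : Matrix ℤ ℤ ℂ := fun i k => if k = i + 1 then ((k : ℂ) + t₀)⁻¹ else 0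

/-- `Λ^m` for an integer `m`. -/
def LamPow : ℤ → Matrix ℤ ℤ ℂ
  | Int.ofNat r => jpow Lam r
  | Int.negSucc r => jpow LamInv (r + 1)

/-- `Γ^n` for an integer `n`. -/
def GamPow (t₀ : ℂ) : ℤ → Matrix ℤ ℤ ℂ
  | Int.ofNat r => jpow (Gam t₀) r
  | Int.negSucc r => jpow (GamInv t₀) (r + 1)

/-- The matrix `Γ^n Λ^m` representing `λ^m ∂_λ^n`, that is
`λ^m ∂_λ^n λ^{i+t₀} = ∑_k (Γ^n Λ^m)_{ik} λ^{k+t₀}`: as the matrix acts through its rows, products of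
operators turn into products of matrices in the opposite order. Hence, with
`ψ(λ) = ∑ λ^{i+t₀} ψ_i` and `ψ^*(λ) = ∑ λ^{-i-t₀-1} ψ_i^*`, the operator `Q` of this matrix is
`res_λ :(λ^m ∂_λ^n ψ(λ)) ψ^*(λ):`. -/
def flowMatrix (t₀ : ℂ) (m n : ℤ) : Matrix ℤ ℤ ℂ := jmul (GamPow t₀ n) (LamPow m)

/-! ## Formal power series in the times -/

/-- Formal power series in the times `t₁ = x, t₂, t₃, …`. -/
abbrev TimeSeries := MvPowerSeries ℕ+ ℂ

/-- The weight of a monomial, where `t_k` has weight `k`. -/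
def weight (d : ℕ+ →₀ ℕ) : ℕ := d.sum fun k a => (k : ℕ) * a

/-- `∏_k d_k!`. -/
def dfact (d : ℕ+ →₀ ℕ) : ℂ := d.prod fun _ a => (a.factorial : ℂ)

/-- Coefficientwise sum of a family of power series in which every monomial occurs finitely often. -/
def fsum {ι : Type*} (f : ι → TimeSeries) : TimeSeries :=
  fun d => ∑ᶠ i, MvPowerSeries.coeff d (f i)

/-- The derivation `∂ = ∂/∂x`, `x = t₁`. -/
def dx (f : TimeSeries) : TimeSeries := MvPowerSeries.pderiv ℂ (1 : ℕ+) f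

/-- The elementary Schur polynomials `h_N`: `exp (∑_k t_k λ^k) = ∑_N h_N λ^N`. -/
def schur (N : ℤ) : TimeSeries :=
  fun d => if (weight d : ℤ) = N then (dfact d)⁻¹ else 0

/-- The same for the opposite sign: `exp (- ∑_k t_k λ^k) = ∑_N schurNeg N λ^N`. -/
def schurNeg (N : ℤ) : TimeSeries :=
  fun d => if (weight d : ℤ) = N then (-1) ^ (d.sum fun _ a => a) * (dfact d)⁻¹ else 0

/-! ## The tau function -/

/-- `H_k = Q_{Λ^k}`. -/
def H (k : ℕ+) : Fock → Fock := Q (jpow Lam k)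

/-- `⟨0| exp (∑_{k>0} t_k H_k) |v⟩`. As the `H_k`, `k > 0`, commute, the coefficient of `∏ t_k^{d_k}`
is `⟨0| ∏_k H_k^{d_k} / d_k! |v⟩`. -/
def tau (v : Fock) : TimeSeries :=
  fun d => (dfact d)⁻¹ *
    vacPair ((d.support.sort (· ≤ ·)).foldr (fun k u => (H k)^[d k] u) v)

/-- The fermionic flow of the tau function, `⟨0| exp (∑_{k>0} t_k H_k) Q |v⟩`, where `v = g|0⟩` and
`Q` is the quadratic operator of `λ^m ∂_λ^n`. -/
def tauFlow (t₀ : ℂ) (m n : ℤ) (v : Fock) : TimeSeries := tau (Q (flowMatrix t₀ m n) v)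

/-! ## Formal dressing operators and the dressing of a tau function -/

/-- Formal Zakharov-Shabat dressing operators `K = 1 + ∑_{j ≥ 1} K_j ∂^{-j}`, given by their
coefficients `K_j`. -/
abbrev Dressing := ℕ+ → TimeSeries

/-- The coefficient of `∂^{-j}` in `K`, for `j ≥ 0`. -/
def Dressing.coeff (K : Dressing) : ℕ → TimeSeries
  | 0 => 1
  | j + 1 => K j.succPNat

/-- The coefficient of `λ^{-j}` in the expansion of
`τ(t - [λ⁻¹]) = exp (- ∑_{k ≥ 1} λ^{-k} k⁻¹ ∂/∂t_k) τ(t)`, that is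
`∑_d ∏_k (-1/k)^{d_k} (∂/∂t_k)^{d_k} / d_k! τ`, summed over all `d` of weight `j`. -/
def miwaShift (j : ℕ) (f : TimeSeries) : TimeSeries :=
  fun e => ∑ᶠ d : {d : ℕ+ →₀ ℕ // weight d = j},
    (d.1.prod fun k a => (-((k : ℕ) : ℂ)⁻¹) ^ a * ((e k + a).choose a : ℂ)) *
      MvPowerSeries.coeff (e + d.1) f

/-- The dressing `K` of a tau function with nonzero constant term, through the Baker-Akhiezer
function `φ = λ^{t₀} exp (∑ t_k λ^k) τ(t - [λ⁻¹]) / τ(t) = K exp (∑ t_k λ^k + t₀ log λ)`. -/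
def dressing (f : TimeSeries) : Dressing := fun j => miwaShift j f * f⁻¹

/-! ## Pseudodifferential operators -/

/-- Formal pseudodifferential operators `∑_{N ∈ ℤ} a_N ∂^N`, as families of coefficients; they may
be of infinite order in both directions. -/
abbrev PDO := ℤ → TimeSeries

/-- The product of pseudodifferential operators, by the Leibniz rule
`∂^N b = ∑_{k ≥ 0} (N choose k) b^{(k)} ∂^{N-k}`. -/
def comp (A B : PDO) : PDO :=
  fun P => fsum fun p : ℤ × ℕ =>
    Ring.choose p.1 p.2 • (A p.1 * dx^[p.2] (B (P - p.1 + p.2)))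

/-- The purely integral part `A_-`. -/
def minusPart (A : PDO) : PDO := fun N => if N < 0 then A N else 0

/-- `K` as a pseudodifferential operator. -/
def Dressing.op (K : Dressing) : PDO := fun N => if N ≤ 0 then K.coeff (-N).toNat else 0

/-- The coefficients of `K⁻¹ = 1 + ∑_{j ≥ 1} K̃_j ∂^{-j}`; the recursion says that the coefficient of
`∂^{-(q+1)}` in `K⁻¹ K` vanishes. -/
def Dressing.invCoeff (K : Dressing) : ℕ → TimeSeries
  | 0 => 1
  | q + 1 => -∑ i : Fin (q + 1), ∑ k ∈ Finset.range (q + 2 - i),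
      Ring.choose (-((i : ℕ) : ℤ)) k • (Dressing.invCoeff K i * dx^[k] (K.coeff (q + 1 - i - k)))

/-- `K⁻¹` as a pseudodifferential operator. -/
def Dressing.opInv (K : Dressing) : PDO := fun N => if N ≤ 0 then K.invCoeff (-N).toNat else 0

/-- The operator `x̂ = x + t₀ ∂⁻¹ + ∑_{k ≥ 2} k t_k ∂^{k-1}`. -/
def xhat (t₀ : ℂ) : PDO := fun N =>
  if N = -1 then MvPowerSeries.C t₀
  else if 0 ≤ N then ((N + 1 : ℤ) : ℂ) • MvPowerSeries.X (N.toNat.succPNat)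
  else 0

/-! ### Negative powers of `x̂`

A formal series `∑_{N ∈ ℤ} f_N λ^{N+t₀}` is given by its coefficients `f_N`. Applied to the
exponential `e^ζ`, `ζ = ∑ t_k λ^k + t₀ log λ`, one has `P x̂ e^ζ = ∂_λ (P e^ζ)` for every operator
`P`, and `P x̂⁻¹` is determined by `P x̂⁻¹ e^ζ = ∂_λ⁻¹ (P e^ζ)`, where the exponential is expanded
into nonnegative powers of `λ` and `∂_λ⁻¹` acts termwise,
`∂_λ⁻¹ λ^{s+t₀} = (s + t₀ + 1)⁻¹ λ^{s+t₀+1}`. For `P = 1` one obtains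
`x̂⁻¹ = (1 + O(∂)) (t₀ + 1)⁻¹ ∂`, a differential operator of infinite order. -/

/-- The expansion of `P e^ζ`. -/
def act (P : PDO) : ℤ → TimeSeries := fun N => fsum fun M : ℤ => P M * schur (N - M)

/-- The operator with `P e^ζ = f`: multiplication of `f` by `e^{-ζ}`. -/
def unact (f : ℤ → TimeSeries) : PDO := fun N => fsum fun M : ℤ => schurNeg (N - M) * f M

/-- Termwise `∂_λ⁻¹`. -/
def lamInt (t₀ : ℂ) (f : ℤ → TimeSeries) : ℤ → TimeSeries :=
  fun N => ((N : ℂ) + t₀)⁻¹ • f (N - 1)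

/-- `P ↦ P x̂`. -/
def mulXhat (t₀ : ℂ) (P : PDO) : PDO := comp P (xhat t₀)

/-- `P ↦ P x̂⁻¹`. -/
def divXhat (t₀ : ℂ) (P : PDO) : PDO := unact (lamInt t₀ (act P))

/-- `P ↦ P x̂^n`, for an integer `n`. -/
def mulXhatPow (t₀ : ℂ) : ℤ → PDO → PDO
  | Int.ofNat r => (mulXhat t₀)^[r]
  | Int.negSucc r => (divXhat t₀)^[r + 1]

/-- `P ↦ P ∂^m`. -/
def mulPartial (m : ℤ) (P : PDO) : PDO := fun N => P (N - m)

/-! ## The flows on the space of dressings -/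

/-- The operator `K x̂^n ∂^m K⁻¹`. -/
def conjOp (t₀ : ℂ) (m n : ℤ) (K : Dressing) : PDO :=
  comp (mulPartial m (mulXhatPow t₀ n K.op)) K.opInv

/-- The vector field `V_{mn} K = -(K x̂^n ∂^m K⁻¹)_- K` on the space of dressings; the coefficient of
`∂^{-j}`, `j ≥ 1`. -/
def V (t₀ : ℂ) (m n : ℤ) (K : Dressing) : ℕ+ → TimeSeries :=
  fun j => -comp (minusPart (conjOp t₀ m n K)) K.op (-((j : ℕ) : ℤ))

end

end KP

namespace KP

noncomputable section

open Finset.HasAntidiagonal (antidiagonal mem_antidiagonal)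

/-! ### Canonical anticommutation relations -/

/-! Write `S_j` for the coefficient of `λ^{-j}` in the Miwa shift, so that `K_j = S_j τ / τ`. The
quotient rule gives the velocity of `K_j` as `S_j(V̂τ)/τ - (V̂τ/τ) K_j`. What remains is to compute
`V_{mn} K` and find the same expression (`IsGroupOrbit.V_dressing_tau`).

On the group orbit, `∑ ψ_i v ⊗ ψ_i^* v = 0`, because `∑ ψ_i ⊗ ψ_i^*` commutes with `X ⊗ 1 + 1 ⊗ X`
and kills `|0⟩ ⊗ |0⟩`. Letting `Q_A` act on the first factor gives `∑ ψ_i Q_A v ⊗ ψ_i^* v + ∑ A_{ij}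
ψ_i v ⊗ ψ_j^* v = 0`. Bosonization (`hamSeries_psi`, `hamSeries_psiStar`, `miwaShift_tau`)
translates these into residues in `λ`. Fields between charged vacua become shifted tau functions
times `e^{±ζ}`, and the matrix of `λ^m ∂_λ^n` becomes right multiplication by `x̂^n ∂^m`
(`exists_flowMatrix_eq`). With `p = ∑ (S_j(V̂τ)/τ) ∂^{-j}` and the adjoint function `φ^*`, the
residue of `((p + K x̂^n ∂^m) e^ζ) · ∂_x^k φ^*` vanishes for all `k ≥ 0`.

Such residues are, up to sign, the coefficients of `∂^{-k-1}` in the product with the operator whose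
adjoint symbol gives `φ^*` (`comp_neg`). The undeformed bilinear identity shows that this operator
is `K⁻¹`. Hence `(K x̂^n ∂^m K⁻¹)_- = -(p K⁻¹)_-`. As `p K⁻¹` has nonpositive order and leading
coefficient `V̂τ/τ`, it follows that `V_{mn} K = (p K⁻¹)_- K = p - (V̂τ/τ) K`.

Operators infinite in both directions are controlled by rescaling `t_k` to `λ^{-k} t_k` (`twist`).
The exponential then becomes one invertible power series, and all relevant symbols have bounded
order in `λ`. -/

lemma fsign_insert {m : ℤ} {D : Finset ℤ} (n : ℤ) (h : m ∉ D) :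
    fsign n (insert m D) = fsign n D * (if m < n then -1 else 1) := by
  unfold fsign
  rw [Finset.filter_insert]
  split_ifs with hm
  · rw [Finset.card_insert_of_notMem (by simp [h]), pow_succ]
  · simp

lemma fsign_erase {m : ℤ} {D : Finset ℤ} (n : ℤ) (h : m ∈ D) :
    fsign n (D.erase m) = fsign n D * (if m < n then -1 else 1) := by
  have := fsign_insert n (Finset.notMem_erase m D)
  rw [Finset.insert_erase h] at this
  rw [this]
  split_ifs <;> simp

lemma fsign_mul_self (n : ℤ) (D : Finset ℤ) : fsign n D * fsign n D = 1 := by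
  unfold fsign
  rw [← mul_pow]
  simp

/-- Jordan–Wigner signs: changing the occupation of the smaller of two levels flips the sign
attached to the larger one, so exchanging the two operations costs exactly one sign. -/
lemma create_create (n m : ℤ) (v : Fock) :
    create n (create m v) = -create m (create n v) := by
  funext D
  simp only [create, Pi.neg_apply]
  by_cases hn : n ∈ D <;> by_cases hm : m ∈ D <;> simp only [hn, hm, Finset.mem_erase, if_true,
    if_false, and_true, and_false, mul_zero, neg_zero]
  by_cases h : n = m
  · simp [h]
  · have h' : m ≠ n := fun e => h e.symm
    simp only [h, h', ne_eq, not_false_eq_true, if_true]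
    rw [fsign_erase m hn, fsign_erase n hm, Finset.erase_right_comm]
    rcases lt_or_gt_of_ne h with hl | hl
    · simp only [hl, hl.not_gt, if_true, if_false]; ring
    · simp only [hl, hl.not_gt, if_true, if_false]; ring

lemma annih_annih (n m : ℤ) (v : Fock) :
    annih n (annih m v) = -annih m (annih n v) := by
  funext D
  simp only [annih, Pi.neg_apply]
  by_cases hn : n ∈ D <;> by_cases hm : m ∈ D <;> simp only [hn, hm, Finset.mem_insert, if_true,
    if_false, or_true, or_false, mul_zero, neg_zero]
  by_cases h : n = m
  · simp [h]
  · have h' : m ≠ n := fun e => h e.symm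
    simp only [h, h', if_false]
    rw [fsign_insert m hn, fsign_insert n hm, Finset.insert_comm]
    rcases lt_or_gt_of_ne h with hl | hl
    · simp only [hl, hl.not_gt, if_true, if_false]; ring
    · simp only [hl, hl.not_gt, if_true, if_false]; ring

lemma annih_create (n m : ℤ) (v : Fock) :
    annih n (create m v) = (if n = m then v else 0) - create m (annih n v) := by
  funext D
  by_cases h : n = m
  · subst h
    simp only [annih, create, if_true, Pi.sub_apply]
    by_cases hn : n ∈ D
    · rw [if_pos hn, if_pos hn, if_neg (Finset.notMem_erase n D), fsign_erase n hn]
      simp [Finset.insert_erase hn, ← mul_assoc, fsign_mul_self]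
    · rw [if_neg hn, if_neg hn, if_pos (Finset.mem_insert_self n D), fsign_insert n hn]
      simp [Finset.erase_insert hn, ← mul_assoc, fsign_mul_self]
  · have h' : m ≠ n := fun e => h e.symm
    simp only [annih, create, if_neg h, Pi.sub_apply, Pi.zero_apply, zero_sub]
    by_cases hn : n ∈ D <;> by_cases hm : m ∈ D <;> simp only [hn, hm, h, h', Finset.mem_insert,
      Finset.mem_erase, ne_eq, not_false_eq_true, and_true, and_false, or_true, or_false, if_true,
      if_false, mul_zero, neg_zero]
    rw [fsign_insert m hn, fsign_erase n hm, Finset.erase_insert_of_ne h]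
    rcases lt_or_gt_of_ne h with hl | hl
    · simp only [hl, hl.not_gt, if_true, if_false]; ring
    · simp only [hl, hl.not_gt, if_true, if_false]; ring

lemma create_annih (n m : ℤ) (v : Fock) :
    create n (annih m v) = (if n = m then v else 0) - annih m (create n v) := by
  rw [annih_create]
  by_cases h : n = m
  · simp [h]
  · simp [h, Ne.symm h]

lemma psi_psi (i j : ℤ) (v : Fock) : psi i (psi j v) = -psi j (psi i v) := by
  unfold psi
  split_ifs with hi hj hj
  · exact create_create i j v
  · rw [create_annih, if_neg (by omega)]; simp
  · rw [annih_create, if_neg (by omega)]; simp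
  · exact annih_annih i j v

lemma psiStar_psiStar (i j : ℤ) (v : Fock) :
    psiStar i (psiStar j v) = -psiStar j (psiStar i v) := by
  unfold psiStar
  split_ifs with hi hj hj
  · exact annih_annih i j v
  · rw [annih_create, if_neg (by omega)]; simp
  · rw [create_annih, if_neg (by omega)]; simp
  · exact create_create i j v

lemma psiStar_psi (i j : ℤ) (v : Fock) :
    psiStar i (psi j v) = (if i = j then v else 0) - psi j (psiStar i v) := by
  unfold psi psiStar
  split_ifs with hi hj hij hj hij hij hij
  all_goals first
    | omega
    | (rw [annih_create, if_pos hij])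
    | (rw [annih_create, if_neg hij])
    | (rw [create_annih, if_pos hij])
    | (rw [create_annih, if_neg hij])
    | (rw [create_create]; simp)
    | (rw [annih_annih]; simp)

lemma psi_psiStar (i j : ℤ) (v : Fock) :
    psi i (psiStar j v) = (if i = j then v else 0) - psiStar j (psi i v) := by
  rw [psiStar_psi]
  by_cases h : i = j
  · simp [h]
  · simp [h, Ne.symm h]

/-! ### Fermions as evaluations at one component -/

/-- A fermion has at most one nonzero entry per row. Linearity and passage to componentwise limits
follow from this for arbitrary infinite combinations. -/
lemma create_eval (i : ℤ) (D : Finset ℤ) :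
    ∃ (c : ℂ) (E : Finset ℤ), ∀ v, create i v D = c * v E := by
  by_cases h : i ∈ D
  · exact ⟨fsign i D, D.erase i, fun v => by simp [create, h]⟩
  · exact ⟨0, ∅, fun v => by simp [create, h]⟩

lemma annih_eval (i : ℤ) (D : Finset ℤ) :
    ∃ (c : ℂ) (E : Finset ℤ), ∀ v, annih i v D = c * v E := by
  by_cases h : i ∈ D
  · exact ⟨0, ∅, fun v => by simp [annih, h]⟩
  · exact ⟨fsign i D, insert i D, fun v => by simp [annih, h]⟩

lemma psi_eval (i : ℤ) (D : Finset ℤ) : ∃ (c : ℂ) (E : Finset ℤ), ∀ v, psi i v D = c * v E := by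
  unfold psi
  split_ifs
  · exact create_eval i D
  · exact annih_eval i D

lemma psiStar_eval (i : ℤ) (D : Finset ℤ) :
    ∃ (c : ℂ) (E : Finset ℤ), ∀ v, psiStar i v D = c * v E := by
  unfold psiStar
  split_ifs
  · exact annih_eval i D
  · exact create_eval i D

lemma psi_add (i : ℤ) (u v : Fock) : psi i (u + v) = psi i u + psi i v := by
  funext D
  obtain ⟨c, E, h⟩ := psi_eval i D
  simp [h, mul_add]

lemma psi_smul (i : ℤ) (a : ℂ) (v : Fock) : psi i (a • v) = a • psi i v := by
  funext D
  obtain ⟨c, E, h⟩ := psi_eval i D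
  simp [h]; ring

lemma psiStar_add (i : ℤ) (u v : Fock) : psiStar i (u + v) = psiStar i u + psiStar i v := by
  funext D
  obtain ⟨c, E, h⟩ := psiStar_eval i D
  simp [h, mul_add]

lemma psiStar_smul (i : ℤ) (a : ℂ) (v : Fock) : psiStar i (a • v) = a • psiStar i v := by
  funext D
  obtain ⟨c, E, h⟩ := psiStar_eval i D
  simp [h]; ring

lemma psi_neg (i : ℤ) (v : Fock) : psi i (-v) = -psi i v := by
  simpa using psi_smul i (-1) v

lemma psi_zero (i : ℤ) : psi i 0 = 0 := by
  simpa using psi_smul i 0 0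

lemma psi_sub (i : ℤ) (u v : Fock) : psi i (u - v) = psi i u - psi i v := by
  rw [sub_eq_add_neg, psi_add, psi_neg, ← sub_eq_add_neg]

lemma psiStar_neg (i : ℤ) (v : Fock) : psiStar i (-v) = -psiStar i v := by
  simpa using psiStar_smul i (-1) v

lemma psiStar_zero (i : ℤ) : psiStar i 0 = 0 := by
  simpa using psiStar_smul i 0 0

lemma psiStar_sub (i : ℤ) (u v : Fock) : psiStar i (u - v) = psiStar i u - psiStar i v := by
  rw [sub_eq_add_neg, psiStar_add, psiStar_neg, ← sub_eq_add_neg]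

lemma psi_apply_of_notMem {i : ℤ} {D : Finset ℤ} (hi : 0 ≤ i) (h : i ∉ D) (v : Fock) :
    psi i v D = 0 := by simp [psi, hi, create, h]

lemma psiStar_apply_of_mem {i : ℤ} {D : Finset ℤ} (hi : 0 ≤ i) (h : i ∈ D) (v : Fock) :
    psiStar i v D = 0 := by simp [psiStar, hi, annih, h]

lemma psiStar_apply_of_notMem {i : ℤ} {D : Finset ℤ} (hi : i < 0) (h : i ∉ D) (v : Fock) :
    psiStar i v D = 0 := by simp [psiStar, hi.not_ge, create, h]

lemma psi_vac {i : ℤ} (hi : i < 0) : psi i vac = 0 := by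
  funext D
  simp only [psi, hi.not_ge, if_false, annih, vac, Pi.zero_apply]
  split_ifs with h1 h2
  · rfl
  · simp at h2
  · simp

lemma psiStar_vac {i : ℤ} (hi : 0 ≤ i) : psiStar i vac = 0 := by
  funext D
  simp only [psiStar, hi, if_true, annih, vac, Pi.zero_apply]
  split_ifs with h1 h2
  · rfl
  · simp at h2
  · simp

/-! ### Quadratic operators -/

/-- The vacuum expectation is nonzero only for the diagonal pairs of levels filled in the vacuum. -/
lemma normalPair_eq (i j : ℤ) (v : Fock) :
    normalPair i j v = psi i (psiStar j v) - (if i = j ∧ i < 0 then (1 : ℂ) else 0) • v := by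
  unfold normalPair
  congr 2
  by_cases hj : 0 ≤ j
  · rw [psiStar_vac hj, psi_zero, if_neg (by omega)]; rfl
  · by_cases hi : 0 ≤ i
    · rw [psi_psiStar, if_neg (by omega), if_neg (by omega), zero_sub]
      simp [vacPair, psiStar_apply_of_notMem (not_le.mp hj)]
    · rw [psi_psiStar, psi_vac (by omega), psiStar_zero]
      by_cases h : i = j
      · simp [h, vacPair, vac, not_le.mp hj]
      · simp [h, vacPair]

/-- The functional given by a finite linear combination of components. -/
def evalAt (a : Finset ℤ →₀ ℂ) (v : Fock) : ℂ := Finsupp.linearCombination ℂ v a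

lemma evalAt_single (D : Finset ℤ) (c : ℂ) (v : Fock) :
    evalAt (Finsupp.single D c) v = c * v D := by
  simp [evalAt]

lemma evalAt_finset_sum {ι : Type*} (s : Finset ι) (a : ι → Finset ℤ →₀ ℂ) (v : Fock) :
    evalAt (∑ i ∈ s, a i) v = ∑ i ∈ s, evalAt (a i) v := by
  simp [evalAt]

lemma evalAt_smul (c : ℂ) (a : Finset ℤ →₀ ℂ) (v : Fock) :
    evalAt (c • a) v = c * evalAt a v := by
  simp [evalAt]

lemma evalAt_add_left (a b : Finset ℤ →₀ ℂ) (v : Fock) :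
    evalAt (a + b) v = evalAt a v + evalAt b v := by
  simp [evalAt]

lemma evalAt_eq_sum (a : Finset ℤ →₀ ℂ) (v : Fock) :
    evalAt a v = ∑ D ∈ a.support, a D * v D := by
  simp [evalAt, Finsupp.linearCombination_apply, Finsupp.sum]

lemma evalAt_add (a : Finset ℤ →₀ ℂ) (u v : Fock) :
    evalAt a (u + v) = evalAt a u + evalAt a v := by
  simp [evalAt_eq_sum, mul_add, Finset.sum_add_distrib]

lemma evalAt_smul_right (a : Finset ℤ →₀ ℂ) (c : ℂ) (v : Fock) :
    evalAt a (c • v) = c * evalAt a v := by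
  simp [evalAt_eq_sum, Finset.mul_sum, mul_left_comm]

lemma normalPair_eval (i j : ℤ) (D : Finset ℤ) :
    ∃ a : Finset ℤ →₀ ℂ, ∀ v, normalPair i j v D = evalAt a v := by
  obtain ⟨c, E, h⟩ := psi_eval i D
  obtain ⟨c', E', h'⟩ := psiStar_eval j E
  refine ⟨Finsupp.single E' (c * c') + Finsupp.single D (-(if i = j ∧ i < 0 then (1 : ℂ) else 0)),
    fun v => ?_⟩
  rw [normalPair_eq, evalAt_add_left, evalAt_single, evalAt_single, Pi.sub_apply, h, h',
    Pi.smul_apply, smul_eq_mul]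
  ring

/-- A bound on the absolute values of the levels in `D`. -/
lemma exists_level_bound (D : Finset ℤ) : ∃ B : ℤ, 0 ≤ B ∧ ∀ i ∈ D, |i| ≤ B := by
  refine ⟨D.sum fun i => |i|, Finset.sum_nonneg fun i _ => abs_nonneg i, fun i hi => ?_⟩
  exact Finset.single_le_sum (f := fun i : ℤ => |i|) (fun i _ => abs_nonneg i) hi

/-- The band condition keeps `i` close to `j`. When both are far from the levels in `D`, either the
outer fermion kills the component or, for negative levels, the pair can be anticommuted so that it
does. -/
lemma exists_finset_normalPair {A : Matrix ℤ ℤ ℂ} (hA : IsJacobi A) (D : Finset ℤ) :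
    ∃ s : Finset (ℤ × ℤ), ∀ p ∉ s, ∀ v, A p.1 p.2 * normalPair p.1 p.2 v D = 0 := by
  obtain ⟨b, hb⟩ := hA
  obtain ⟨B, hB0, hB⟩ := exists_level_bound D
  set C := B + |b| + 1 with hC
  refine ⟨Finset.Icc (-C) C ×ˢ Finset.Icc (-C) C, fun p hp v => ?_⟩
  obtain ⟨i, j⟩ := p
  simp only [Finset.mem_product, Finset.mem_Icc] at hp
  by_cases hij : b < |i - j|
  · simp [hb i j hij]
  have hij' : |i - j| ≤ |b| := (not_lt.mp hij).trans (le_abs_self b)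
  have h1 := abs_le.mp hij'
  have hbn := abs_nonneg b
  have hD : ∀ k : ℤ, (k < -B ∨ B < k) → k ∉ D := fun k hk hkD => by
    have := abs_le.mp (hB k hkD); omega
  rw [mul_eq_zero]; right
  rw [normalPair_eq]
  simp only [Pi.sub_apply, Pi.smul_apply, smul_eq_mul]
  rcases le_or_gt 0 i with hi | hi
  · rw [if_neg (by omega)]
    by_cases hiD : i ∈ D
    · have h2 := abs_le.mp (hB i hiD); omega
    · simp [psi_apply_of_notMem hi hiD]
  · by_cases hij2 : i = j
    · subst hij2
      -- Anticommuting a filled diagonal pair produces the constant 1, exactly what normal ordering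
      -- subtracts.
      rw [psi_psiStar]
      simp only [Pi.sub_apply, hi, and_self, if_true, one_mul]
      rw [psiStar_apply_of_notMem hi (hD i (by omega))]; ring
    · rw [if_neg (by omega), psi_psiStar, if_neg hij2]
      rcases le_or_gt 0 j with hj | hj
      · by_cases hiC : i < -B ∨ B < i
        · omega
        · omega
      · by_cases hjD : j ∈ D
        · have h2 := abs_le.mp (hB j hjD); omega
        · simp [psiStar_apply_of_notMem hj hjD]

lemma Q_support_finite {A : Matrix ℤ ℤ ℂ} (hA : IsJacobi A) (v : Fock) (D : Finset ℤ) :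
    (Function.support fun p : ℤ × ℤ => A p.1 p.2 * normalPair p.1 p.2 v D).Finite := by
  obtain ⟨s, hs⟩ := exists_finset_normalPair hA D
  refine s.finite_toSet.subset fun p hp => ?_
  by_contra h
  exact hp (hs p h v)

/-- Row-finiteness of `Q_A`: it allows operators on infinite combinations of basis states to be
replaced by finite functionals. -/
lemma Q_eval {A : Matrix ℤ ℤ ℂ} (hA : IsJacobi A) (D : Finset ℤ) :
    ∃ a : Finset ℤ →₀ ℂ, ∀ v, Q A v D = evalAt a v := by
  obtain ⟨s, hs⟩ := exists_finset_normalPair hA D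
  choose a ha using fun p : ℤ × ℤ => normalPair_eval p.1 p.2 D
  refine ⟨∑ p ∈ s, A p.1 p.2 • a p, fun v => ?_⟩
  rw [evalAt_finset_sum, Q, finsum_eq_sum_of_support_subset (s := s)]
  · refine Finset.sum_congr rfl fun p _ => ?_
    rw [evalAt_smul, ha]
  · intro p hp
    by_contra h
    exact hp (hs p h v)

lemma glAct_eval {A : Matrix ℤ ℤ ℂ} (hA : IsJacobi A) (c : ℂ) (D : Finset ℤ) :
    ∃ a : Finset ℤ →₀ ℂ, ∀ v, glAct A c v D = evalAt a v := by
  obtain ⟨a, ha⟩ := Q_eval hA D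
  refine ⟨a + Finsupp.single D c, fun v => ?_⟩
  rw [evalAt_add_left, evalAt_single, glAct, Pi.add_apply, ha, Pi.smul_apply, smul_eq_mul]

lemma psi_Q {A : Matrix ℤ ℤ ℂ} (hA : IsJacobi A) (i : ℤ) (v : Fock) (D : Finset ℤ) :
    (Function.support fun p : ℤ × ℤ => A p.1 p.2 * psi i (normalPair p.1 p.2 v) D).Finite ∧
    psi i (Q A v) D = ∑ᶠ p : ℤ × ℤ, A p.1 p.2 * psi i (normalPair p.1 p.2 v) D := by
  obtain ⟨c, E, h⟩ := psi_eval i D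
  simp only [h, Q, mul_left_comm _ c]
  exact ⟨(Q_support_finite hA v E).subset fun p hp => right_ne_zero_of_mul hp,
    mul_finsum' _ _ (Q_support_finite hA v E)⟩

lemma psiStar_Q {A : Matrix ℤ ℤ ℂ} (hA : IsJacobi A) (i : ℤ) (v : Fock) (D : Finset ℤ) :
    (Function.support fun p : ℤ × ℤ => A p.1 p.2 * psiStar i (normalPair p.1 p.2 v) D).Finite ∧
    psiStar i (Q A v) D = ∑ᶠ p : ℤ × ℤ, A p.1 p.2 * psiStar i (normalPair p.1 p.2 v) D := by
  obtain ⟨c, E, h⟩ := psiStar_eval i D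
  simp only [h, Q, mul_left_comm _ c]
  exact ⟨(Q_support_finite hA v E).subset fun p hp => right_ne_zero_of_mul hp,
    mul_finsum' _ _ (Q_support_finite hA v E)⟩

lemma normalPair_psi (a b i : ℤ) (v : Fock) :
    normalPair a b (psi i v) = psi i (normalPair a b v) + if b = i then psi a v else 0 := by
  rw [normalPair_eq, normalPair_eq, psiStar_psi, psi_sub, psi_sub, psi_smul, psi_psi a i]
  split_ifs
  · module
  · module
  · rw [psi_zero]; module
  · rw [psi_zero]; module

lemma normalPair_psiStar (a b i : ℤ) (v : Fock) :
    normalPair a b (psiStar i v) =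
      psiStar i (normalPair a b v) - if a = i then psiStar b v else 0 := by
  rw [normalPair_eq, normalPair_eq, psiStar_psiStar b i, psi_neg, psi_psiStar, psiStar_sub,
    psiStar_smul]
  abel

/-- The commutation relation of `Q_A` with `ψ_i`. -/
lemma Q_psi {A : Matrix ℤ ℤ ℂ} (hA : IsJacobi A) (i : ℤ) (v : Fock) (D : Finset ℤ) :
    Q A (psi i v) D = psi i (Q A v) D + ∑ᶠ j, A j i * psi j v D := by
  obtain ⟨hf, h⟩ := psi_Q hA i v D
  have key : ∀ p : ℤ × ℤ, A p.1 p.2 * normalPair p.1 p.2 (psi i v) D =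
      A p.1 p.2 * psi i (normalPair p.1 p.2 v) D +
        (if p.2 = i then A p.1 p.2 * psi p.1 v D else 0) := fun p => by
    rw [normalPair_psi, Pi.add_apply, mul_add]
    split_ifs <;> simp
  -- By `key` the commutator terms are a difference of two finitely supported families, hence
  -- finitely supported.
  have hf2 : (Function.support fun p : ℤ × ℤ =>
      if p.2 = i then A p.1 p.2 * psi p.1 v D else 0).Finite := by
    refine ((Q_support_finite hA (psi i v) D).union hf).subset fun p hp => ?_
    by_contra hc
    simp only [Set.mem_union, Function.mem_support, not_or, not_not] at hc
    have := key p
    rw [hc.1, hc.2, zero_add] at this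
    exact hp this.symm
  rw [Q, finsum_congr key, finsum_add_distrib hf hf2, h, finsum_curry _ hf2]
  congr 1
  refine finsum_congr fun j => ?_
  rw [finsum_eq_single _ i fun x hx => by simp [hx]]
  simp

/-- The commutation relation of `Q_A` with `ψ_i^*`. -/
lemma Q_psiStar {A : Matrix ℤ ℤ ℂ} (hA : IsJacobi A) (i : ℤ) (v : Fock) (D : Finset ℤ) :
    Q A (psiStar i v) D = psiStar i (Q A v) D - ∑ᶠ j, A i j * psiStar j v D := by
  obtain ⟨hf, h⟩ := psiStar_Q hA i v D
  have key : ∀ p : ℤ × ℤ, A p.1 p.2 * normalPair p.1 p.2 (psiStar i v) D =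
      A p.1 p.2 * psiStar i (normalPair p.1 p.2 v) D -
        (if p.1 = i then A p.1 p.2 * psiStar p.2 v D else 0) := fun p => by
    rw [normalPair_psiStar, Pi.sub_apply, mul_sub]
    split_ifs <;> simp
  have hf2 : (Function.support fun p : ℤ × ℤ =>
      if p.1 = i then A p.1 p.2 * psiStar p.2 v D else 0).Finite := by
    refine ((Q_support_finite hA (psiStar i v) D).union hf).subset fun p hp => ?_
    by_contra hc
    simp only [Set.mem_union, Function.mem_support, not_or, not_not] at hc
    have := key p
    rw [hc.1, hc.2, zero_sub] at this
    exact hp (neg_eq_zero.mp this.symm)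
  rw [Q, finsum_congr key, finsum_sub_distrib hf hf2, h, finsum_curry _ hf2]
  congr 1
  rw [finsum_eq_single _ i fun x hx => by simp [hx]]
  simp

lemma Q_add {A : Matrix ℤ ℤ ℂ} (hA : IsJacobi A) (u v : Fock) : Q A (u + v) = Q A u + Q A v := by
  funext D
  obtain ⟨a, ha⟩ := Q_eval hA D
  simp [ha, evalAt_add]

lemma Q_smul {A : Matrix ℤ ℤ ℂ} (hA : IsJacobi A) (c : ℂ) (v : Fock) : Q A (c • v) = c • Q A v := by
  funext D
  obtain ⟨a, ha⟩ := Q_eval hA D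
  simp [ha, evalAt_smul_right]

/-! ### The bilinear identity -/

/-- For `i ≥ 0` the fermion `ψ_i` creates an excitation, which must lie in `D`; for `i < 0` the same
holds for `ψ_i^*` and `E`. This makes the bilinear sum finite. -/
lemma psi_mul_psiStar_eq_zero {i : ℤ} {D E : Finset ℤ} (h : i ∉ D ∪ E) (u w : Fock) :
    psi i u D * psiStar i w E = 0 := by
  rw [Finset.mem_union, not_or] at h
  rcases le_or_gt 0 i with hi | hi
  · rw [psi_apply_of_notMem hi h.1, zero_mul]
  · rw [psiStar_apply_of_notMem hi h.2, mul_zero]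

lemma psi_mul_psiStar_support_finite (u w : Fock) (D E : Finset ℤ) :
    (Function.support fun i => psi i u D * psiStar i w E).Finite :=
  (D ∪ E).finite_toSet.subset fun i hi => by
    by_contra h
    exact hi (psi_mul_psiStar_eq_zero h u w)

/-- The components of `∑ᵢ ψ_i u ⊗ ψ_i^* w`. -/
def bilin (u w : Fock) (D E : Finset ℤ) : ℂ := ∑ᶠ i, psi i u D * psiStar i w E

lemma bilin_eq_sum (u w : Fock) (D E : Finset ℤ) :
    bilin u w D E = ∑ i ∈ D ∪ E, psi i u D * psiStar i w E :=
  finsum_eq_sum_of_support_subset _ fun i hi => by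
    by_contra h
    exact hi (psi_mul_psiStar_eq_zero h u w)

/-- The component at `D` bounds `i` from above, the component at `E` bounds `j` from below, and the
band width does the rest. -/
lemma jacobi_psi_psiStar_support_finite {A : Matrix ℤ ℤ ℂ} (hA : IsJacobi A) (u w : Fock)
    (D E : Finset ℤ) :
    (Function.support fun p : ℤ × ℤ => A p.1 p.2 * psi p.1 u D * psiStar p.2 w E).Finite := by
  obtain ⟨b, hb⟩ := hA
  obtain ⟨B, hB0, hB⟩ := exists_level_bound (D ∪ E)
  set C := B + |b| + 1 with hC
  refine (Finset.Icc (-C) C ×ˢ Finset.Icc (-C) C).finite_toSet.subset fun p hp => ?_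
  obtain ⟨i, j⟩ := p
  simp only [Function.mem_support] at hp
  have hAij : ¬ b < |i - j| := fun h => hp (by simp [hb i j h])
  have h1 := abs_le.mp ((not_lt.mp hAij).trans (le_abs_self b))
  have hbn := abs_nonneg b
  have hi : i ≤ B := by
    by_contra hc
    refine hp ?_
    rw [psi_apply_of_notMem (by omega), mul_zero, zero_mul]
    intro hD
    have := abs_le.mp (hB i (Finset.mem_union_left _ hD)); omega
  have hj : -B ≤ j := by
    by_contra hc
    refine hp ?_
    rw [psiStar_apply_of_notMem (by omega), mul_zero]
    intro hE
    have := abs_le.mp (hB j (Finset.mem_union_right _ hE)); omega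
  simp only [Finset.coe_product, Finset.coe_Icc, Set.mem_prod, Set.mem_Icc]
  omega

/-- If `f` and `g` are families of vectors for which `∑ᵢ f_i ⊗ g_i` has finite components, then
functionals that depend on finitely many components may be applied termwise. -/
lemma evalAt_pair {f g : ℤ → Fock}
    (h : ∀ D E, (Function.support fun i => f i D * g i E).Finite) (a b : Finset ℤ →₀ ℂ) :
    (Function.support fun i => evalAt a (f i) * evalAt b (g i)).Finite ∧
    ∑ᶠ i, evalAt a (f i) * evalAt b (g i) =
      ∑ D ∈ a.support, ∑ E ∈ b.support, a D * b E * ∑ᶠ i, f i D * g i E := by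
  have hs : ∀ D E, (Function.support fun i => a D * b E * (f i D * g i E)).Finite := fun D E =>
    (h D E).subset fun i hi => right_ne_zero_of_mul hi
  have key : ∀ i, evalAt a (f i) * evalAt b (g i) =
      ∑ p ∈ a.support ×ˢ b.support, a p.1 * b p.2 * (f i p.1 * g i p.2) := fun i => by
    rw [evalAt_eq_sum, evalAt_eq_sum, Finset.sum_mul_sum, Finset.sum_product]
    refine Finset.sum_congr rfl fun D _ => Finset.sum_congr rfl fun E _ => by ring
  constructor
  · refine (Set.Finite.biUnion (a.support ×ˢ b.support).finite_toSet
      fun p _ => hs p.1 p.2).subset fun i hi => ?_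
    simp only [Function.mem_support, key] at hi
    obtain ⟨p, hp, hne⟩ := Finset.exists_ne_zero_of_sum_ne_zero hi
    exact Set.mem_biUnion hp hne
  · rw [finsum_congr key, finsum_sum_comm _ (fun i (p : Finset ℤ × Finset ℤ) =>
      a p.1 * b p.2 * (f i p.1 * g i p.2)) fun p _ => hs p.1 p.2, Finset.sum_product]
    refine Finset.sum_congr rfl fun D _ => Finset.sum_congr rfl fun E _ => ?_
    rw [mul_finsum' _ _ (h D E)]

lemma evalAt_bilin_left (a : Finset ℤ →₀ ℂ) (u w : Fock) (E : Finset ℤ) :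
    (Function.support fun i => evalAt a (psi i u) * psiStar i w E).Finite ∧
    ∑ᶠ i, evalAt a (psi i u) * psiStar i w E = evalAt a fun D => bilin u w D E := by
  have h := evalAt_pair (psi_mul_psiStar_support_finite u w) a (Finsupp.single E 1)
  simp only [evalAt_single, one_mul] at h
  refine ⟨h.1, h.2.trans ?_⟩
  rw [evalAt_eq_sum]
  refine Finset.sum_congr rfl fun D _ => ?_
  rw [Finsupp.support_single _ one_ne_zero]
  simp [bilin]

lemma evalAt_bilin_right (b : Finset ℤ →₀ ℂ) (u w : Fock) (D : Finset ℤ) :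
    (Function.support fun i => psi i u D * evalAt b (psiStar i w)).Finite ∧
    ∑ᶠ i, psi i u D * evalAt b (psiStar i w) = evalAt b fun E => bilin u w D E := by
  have h := evalAt_pair (psi_mul_psiStar_support_finite u w) (Finsupp.single D 1) b
  simp only [evalAt_single, one_mul] at h
  refine ⟨h.1, h.2.trans ?_⟩
  rw [evalAt_eq_sum, Finsupp.support_single _ one_ne_zero]
  simp [bilin]

lemma finite_support_finsum {α β : Type*} {f : α → β → ℂ}
    (h : (Function.support fun p : α × β => f p.1 p.2).Finite) :
    (Function.support fun a => ∑ᶠ b, f a b).Finite := by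
  refine (h.image Prod.fst).subset fun a ha => ?_
  by_contra hc
  refine ha (finsum_eq_zero_of_forall_eq_zero fun b => ?_)
  by_contra hb
  exact hc ⟨(a, b), hb, rfl⟩

/-- The correction comes from moving `Q_A` past `ψ_i`. It is opposite to the one in `bilin_Q_right`,
which is why the two cancel in `bilin_glAct`. -/
lemma bilin_Q_left {A : Matrix ℤ ℤ ℂ} (hA : IsJacobi A) (u w : Fock) (D E : Finset ℤ) :
    bilin (Q A u) w D E = Q A (fun D' => bilin u w D' E) D -
      ∑ᶠ p : ℤ × ℤ, A p.1 p.2 * psi p.1 u D * psiStar p.2 w E := by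
  obtain ⟨a, ha⟩ := Q_eval hA D
  have hfin := jacobi_psi_psiStar_support_finite hA u w D E
  have hfin' : (Function.support fun p : ℤ × ℤ => A p.2 p.1 * psi p.2 u D * psiStar p.1 w E).Finite :=
    hfin.preimage (Equiv.prodComm ℤ ℤ).injective.injOn
  have h3 := finite_support_finsum (f := fun i j => A j i * psi j u D * psiStar i w E) hfin'
  have h1 := psi_mul_psiStar_support_finite (Q A u) w D E
  have key : ∀ i, evalAt a (psi i u) * psiStar i w E =
      psi i (Q A u) D * psiStar i w E + ∑ᶠ j, A j i * psi j u D * psiStar i w E := fun i => by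
    rw [← ha, Q_psi hA, add_mul, finsum_mul]
  rw [ha, ← (evalAt_bilin_left a u w E).2, finsum_congr key, finsum_add_distrib h1 h3,
    ← finsum_comp_equiv (Equiv.prodComm ℤ ℤ)]
  simp only [Equiv.prodComm_apply, Prod.fst_swap, Prod.snd_swap]
  rw [finsum_curry _ hfin']
  simp [bilin]

lemma bilin_Q_right {A : Matrix ℤ ℤ ℂ} (hA : IsJacobi A) (u w : Fock) (D E : Finset ℤ) :
    bilin u (Q A w) D E = Q A (fun E' => bilin u w D E') E +
      ∑ᶠ p : ℤ × ℤ, A p.1 p.2 * psi p.1 u D * psiStar p.2 w E := by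
  obtain ⟨a, ha⟩ := Q_eval hA E
  have hfin := jacobi_psi_psiStar_support_finite hA u w D E
  have h3 := finite_support_finsum (f := fun i j => A i j * psi i u D * psiStar j w E) hfin
  have h1 := psi_mul_psiStar_support_finite u (Q A w) D E
  have key : ∀ i, psi i u D * evalAt a (psiStar i w) =
      psi i u D * psiStar i (Q A w) E - ∑ᶠ j, A i j * psi i u D * psiStar j w E := fun i => by
    rw [← ha, Q_psiStar hA, mul_sub, mul_finsum]
    simp only [mul_left_comm (psi i u D), mul_assoc]
  rw [ha, ← (evalAt_bilin_right a u w D).2, finsum_congr key, finsum_sub_distrib h1 h3,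
    finsum_curry _ hfin]
  simp [bilin]

lemma bilin_add_left (u u' w : Fock) (D E : Finset ℤ) :
    bilin (u + u') w D E = bilin u w D E + bilin u' w D E := by
  simp [bilin_eq_sum, psi_add, add_mul, Finset.sum_add_distrib]

lemma bilin_add_right (u w w' : Fock) (D E : Finset ℤ) :
    bilin u (w + w') D E = bilin u w D E + bilin u w' D E := by
  simp [bilin_eq_sum, psiStar_add, mul_add, Finset.sum_add_distrib]

lemma bilin_smul_left (c : ℂ) (u w : Fock) (D E : Finset ℤ) :
    bilin (c • u) w D E = c * bilin u w D E := by
  simp [bilin_eq_sum, psi_smul, Finset.mul_sum, mul_assoc]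

lemma bilin_smul_right (c : ℂ) (u w : Fock) (D E : Finset ℤ) :
    bilin u (c • w) D E = c * bilin u w D E := by
  simp [bilin_eq_sum, psiStar_smul, Finset.mul_sum, mul_left_comm]

/-- `∑ᵢ ψ_i ⊗ ψ_i^*` commutes with `X ⊗ 1 + 1 ⊗ X`. -/
lemma bilin_glAct {A : Matrix ℤ ℤ ℂ} (hA : IsJacobi A) (c : ℂ) (u w : Fock) (D E : Finset ℤ) :
    bilin u (glAct A c w) D E + bilin (glAct A c u) w D E =
      glAct A c (fun D' => bilin u w D' E) D + glAct A c (fun E' => bilin u w D E') E := by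
  simp only [glAct, bilin_add_left, bilin_add_right, bilin_smul_left, bilin_smul_right,
    bilin_Q_left hA, bilin_Q_right hA, Pi.add_apply, Pi.smul_apply, smul_eq_mul]
  ring

/-- This is the binomial expansion of `(X ⊗ 1 + 1 ⊗ X)^N` inside the bilinear form. Each power can
be moved outside, where it acts on the zero tensor. -/
lemma sum_choose_bilin_iterate {A : Matrix ℤ ℤ ℂ} (hA : IsJacobi A) (c : ℂ) {v : Fock}
    (hv : ∀ D E, bilin v v D E = 0) (N : ℕ) (D E : Finset ℤ) :
    ∑ p ∈ antidiagonal N,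
      N.choose p.1 • bilin ((glAct A c)^[p.1] v) ((glAct A c)^[p.2] v) D E = 0 := by
  induction N generalizing D E with
  | zero => simp [hv]
  | succ N ih =>
    obtain ⟨a, ha⟩ := glAct_eval hA c D
    obtain ⟨b, hb⟩ := glAct_eval hA c E
    rw [Finset.sum_antidiagonal_choose_succ_nsmul
      (fun i j => bilin ((glAct A c)^[i] v) ((glAct A c)^[j] v) D E), ← Finset.sum_add_distrib]
    have key : ∀ p ∈ antidiagonal N,
        N.choose p.1 • bilin ((glAct A c)^[p.1] v) ((glAct A c)^[p.2 + 1] v) D E +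
        N.choose p.2 • bilin ((glAct A c)^[p.1 + 1] v) ((glAct A c)^[p.2] v) D E =
        (∑ F ∈ a.support, a F *
          N.choose p.1 • bilin ((glAct A c)^[p.1] v) ((glAct A c)^[p.2] v) F E) +
        ∑ F ∈ b.support, b F *
          N.choose p.1 • bilin ((glAct A c)^[p.1] v) ((glAct A c)^[p.2] v) D F := by
      intro p hp
      rw [mem_antidiagonal] at hp
      have hch : N.choose p.2 = N.choose p.1 := by
        rw [← hp]; exact (Nat.choose_symm_add).symm
      rw [hch, ← nsmul_add, Function.iterate_succ_apply', Function.iterate_succ_apply',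
        bilin_glAct hA, ha, hb, evalAt_eq_sum, evalAt_eq_sum, nsmul_add, Finset.smul_sum,
        Finset.smul_sum]
      simp only [mul_smul_comm]
    rw [Finset.sum_congr rfl key, Finset.sum_add_distrib, Finset.sum_comm,
      Finset.sum_comm (s := antidiagonal N)]
    simp only [← Finset.mul_sum, ih, mul_zero, Finset.sum_const_zero, add_zero]

lemma hasSum_psi {f : ℕ → Fock} {w : Fock} {c : ℕ → ℂ} (h : ∀ D, HasSum (fun r => c r * f r D) (w D))
    (i : ℤ) (D : Finset ℤ) : HasSum (fun r => c r * psi i (f r) D) (psi i w D) := by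
  obtain ⟨a, E, hE⟩ := psi_eval i D
  simp only [hE, mul_left_comm _ a]
  exact (h E).mul_left a

lemma hasSum_psiStar {f : ℕ → Fock} {w : Fock} {c : ℕ → ℂ}
    (h : ∀ D, HasSum (fun r => c r * f r D) (w D)) (i : ℤ) (D : Finset ℤ) :
    HasSum (fun r => c r * psiStar i (f r) D) (psiStar i w D) := by
  obtain ⟨a, E, hE⟩ := psiStar_eval i D
  simp only [hE, mul_left_comm _ a]
  exact (h E).mul_left a

/-- The bilinear identity `∑ᵢ ψ_i v ⊗ ψ_i^* v = 0` on the group orbit of the vacuum. -/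
lemma IsGroupOrbit.bilin_eq_zero {v : Fock} (hv : IsGroupOrbit v) (D E : Finset ℤ) :
    bilin v v D E = 0 := by
  induction hv generalizing D E with
  | vac =>
    rw [bilin_eq_sum]
    refine Finset.sum_eq_zero fun i _ => ?_
    rcases le_or_gt 0 i with hi | hi
    · simp [psiStar_vac hi]
    · simp [psi_vac hi]
  | exp v w A c _ hA hw ih =>
    -- Componentwise convergence in `ℂ` is absolute, so the product of two exponential series may be
    -- regrouped by total degree.
    have h1 : ∀ i, HasSum (fun N : ℕ => ∑ p ∈ antidiagonal N,
        ((p.1.factorial : ℂ)⁻¹ * psi i ((glAct A c)^[p.1] v) D) *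
        ((p.2.factorial : ℂ)⁻¹ * psiStar i ((glAct A c)^[p.2] v) E))
        (psi i w D * psiStar i w E) := fun i => by
      have ha := hasSum_psi hw i D
      have hb := hasSum_psiStar hw i E
      rw [← ha.tsum_eq, ← hb.tsum_eq,
        tsum_mul_tsum_eq_tsum_sum_antidiagonal_of_summable_norm ha.summable.norm hb.summable.norm]
      exact (summable_norm_sum_mul_antidiagonal_of_summable_norm ha.summable.norm
        hb.summable.norm).of_norm.hasSum
    have h2 := hasSum_sum fun i (_ : i ∈ D ∪ E) => h1 i
    rw [← bilin_eq_sum] at h2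
    refine h2.unique ?_
    convert hasSum_zero with N
    rw [Finset.sum_comm]
    have key : ∀ p ∈ antidiagonal N,
        ∑ i ∈ D ∪ E, ((p.1.factorial : ℂ)⁻¹ * psi i ((glAct A c)^[p.1] v) D) *
          ((p.2.factorial : ℂ)⁻¹ * psiStar i ((glAct A c)^[p.2] v) E) =
        (N.factorial : ℂ)⁻¹ *
          N.choose p.1 • bilin ((glAct A c)^[p.1] v) ((glAct A c)^[p.2] v) D E := by
      intro p hp
      rw [mem_antidiagonal] at hp
      have hN := Nat.add_choose_mul_factorial_mul_factorial p.1 p.2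
      rw [← Nat.choose_symm_add, hp] at hN
      have hN' : (N.choose p.1 : ℂ) * p.1.factorial * p.2.factorial = N.factorial := by
        exact_mod_cast hN
      have e1 : (p.1.factorial : ℂ) ≠ 0 := by exact_mod_cast p.1.factorial_ne_zero
      have e2 : (p.2.factorial : ℂ) ≠ 0 := by exact_mod_cast p.2.factorial_ne_zero
      have e3 : (N.factorial : ℂ) ≠ 0 := by exact_mod_cast N.factorial_ne_zero
      rw [bilin_eq_sum, nsmul_eq_mul, Finset.mul_sum, Finset.mul_sum]
      refine Finset.sum_congr rfl fun i _ => ?_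
      field_simp
      rw [← hN']
      ring
    rw [Finset.sum_congr rfl key, ← Finset.mul_sum, sum_choose_bilin_iterate hA c ih, mul_zero]

/-- The variation of the bilinear identity. -/
lemma IsGroupOrbit.bilin_Q {v : Fock} (hv : IsGroupOrbit v) {A : Matrix ℤ ℤ ℂ} (hA : IsJacobi A)
    (D E : Finset ℤ) :
    bilin (Q A v) v D E = -∑ᶠ p : ℤ × ℤ, A p.1 p.2 * psi p.1 v D * psiStar p.2 v E := by
  have h0 : (fun D' => bilin v v D' E) = (0 : ℂ) • (0 : Fock) := by
    funext D'; simp [hv.bilin_eq_zero]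
  rw [bilin_Q_left hA, h0, Q_smul hA]
  simp

/-! ### The Hamiltonians -/

lemma jpow_Lam (r : ℕ) : jpow Lam r = fun i j : ℤ => if j = i + (r : ℤ) then (1 : ℂ) else 0 := by
  induction r with
  | zero =>
    funext i j
    simp [jpow, Matrix.one_apply, eq_comm]
  | succ r ih =>
    funext i k
    rw [jpow, ih]
    unfold jmul
    rw [finsum_eq_single _ (i + r) fun x hx => by simp [hx]]
    simp [Lam, add_assoc]

lemma isJacobi_of_diagonal (c : ℤ → ℂ) (s : ℤ) :
    IsJacobi fun i j => if j = i + s then c i else 0 := by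
  refine ⟨|s|, fun i j h => if_neg fun e => ?_⟩
  rw [e, sub_add_cancel_left, abs_neg] at h
  exact lt_irrefl _ h

lemma isJacobi_jpow_Lam (r : ℕ) : IsJacobi (jpow Lam r) := by
  rw [jpow_Lam]
  exact isJacobi_of_diagonal (fun _ => 1) r

lemma H_psi (k : ℕ+) (i : ℤ) (v : Fock) : H k (psi i v) = psi i (H k v) + psi (i - k) v := by
  funext D
  rw [H, Q_psi (isJacobi_jpow_Lam k), jpow_Lam, Pi.add_apply,
    finsum_eq_single _ (i - (k : ℕ)) fun x hx => ?_]
  · simp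
  · simp only; rw [if_neg (by omega), zero_mul]

lemma H_psiStar (k : ℕ+) (i : ℤ) (v : Fock) :
    H k (psiStar i v) = psiStar i (H k v) - psiStar (i + k) v := by
  funext D
  rw [H, Q_psiStar (isJacobi_jpow_Lam k), jpow_Lam, Pi.sub_apply,
    finsum_eq_single _ (i + (k : ℕ)) fun x hx => ?_]
  · simp
  · simp [hx]

lemma H_add (k : ℕ+) (u v : Fock) : H k (u + v) = H k u + H k v :=
  Q_add (isJacobi_jpow_Lam k) u v

lemma H_smul (k : ℕ+) (c : ℂ) (v : Fock) : H k (c • v) = c • H k v :=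
  Q_smul (isJacobi_jpow_Lam k) c v

lemma H_sub (k : ℕ+) (u v : Fock) : H k (u - v) = H k u - H k v := by
  have := H_smul k (-1) v
  rw [sub_eq_add_neg, H_add, ← neg_one_smul ℂ v, this]
  module

/-- Since `k > 0` no diagonal pairs occur, and normal ordering subtracts nothing. -/
lemma H_apply (k : ℕ+) (v : Fock) (D : Finset ℤ) :
    H k v D = ∑ᶠ i, psi i (psiStar (i + k) v) D := by
  have hA := isJacobi_jpow_Lam k
  rw [H, Q, finsum_curry _ (Q_support_finite hA v D), jpow_Lam]
  refine finsum_congr fun i => ?_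
  have hk := k.pos
  rw [finsum_eq_single _ (i + (k : ℕ)) fun x hx => by simp [hx], normalPair_eq,
    if_neg (by omega)]
  simp

lemma H_apply_empty (k : ℕ+) (v : Fock) :
    H k v ∅ = ∑ i ∈ Finset.Ico (-(k : ℤ)) 0, psi i (psiStar (i + k) v) ∅ := by
  rw [H_apply]
  refine finsum_eq_sum_of_support_subset _ fun i hi => ?_
  by_contra h
  refine hi ?_
  have hk := k.pos
  simp only [Finset.coe_Ico, Set.mem_Ico, not_and_or, not_le, not_lt] at h
  rcases le_or_gt 0 i with h0 | h0
  · exact psi_apply_of_notMem h0 (by simp) _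
  · have h1 : i + (k : ℕ) < 0 := by omega
    simp only [psi, h0.not_ge, if_false, annih]
    rw [psiStar_apply_of_notMem h1]
    · simp
    · simp

/-- Compared with the vacuum component the range moves up by one: level 0 is now occupied, so `ψ_0`
may contribute, while `i = -k` would need `ψ_0^*` to end on an occupied level. -/
lemma H_apply_singleton (k : ℕ+) (v : Fock) :
    H k v {0} = ∑ i ∈ Finset.Ioc (-(k : ℤ)) 0, psi i (psiStar (i + k) v) {0} := by
  rw [H_apply]
  refine finsum_eq_sum_of_support_subset _ fun i hi => ?_
  by_contra h
  refine hi ?_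
  have hk := k.pos
  simp only [Finset.coe_Ioc, Set.mem_Ioc, not_and_or, not_le, not_lt] at h
  rcases le_or_gt 0 i with h0 | h0
  · exact psi_apply_of_notMem h0 (by simp; omega) _
  · simp only [psi, h0.not_ge, if_false, annih]
    rcases eq_or_ne (i + (k : ℕ)) 0 with h1 | h1
    · rw [psiStar_apply_of_mem h1.ge (by simp [h1])]
      simp
    · rw [psiStar_apply_of_notMem (by omega)]
      · simp
      · simpa using h1

/-- Commuting with a Hamiltonian shifts the index of a fermion, and shifts commute, so `[H_k, H_l]`
commutes with every fermion. Only its vacuum component then has to be computed. -/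
lemma H_H_psi (k l : ℕ+) (i : ℤ) (v : Fock) :
    H k (H l (psi i v)) - H l (H k (psi i v)) = psi i (H k (H l v) - H l (H k v)) := by
  simp only [H_psi, H_add, psi_sub]
  rw [show i - (l : ℤ) - (k : ℤ) = i - k - l by ring]
  abel

lemma H_H_psiStar (k l : ℕ+) (i : ℤ) (v : Fock) :
    H k (H l (psiStar i v)) - H l (H k (psiStar i v)) = psiStar i (H k (H l v) - H l (H k v)) := by
  simp only [H_psiStar, H_sub, psiStar_sub]
  rw [show i + (l : ℤ) + (k : ℤ) = i + k + l by ring]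
  abel

lemma psi_psiStar_comm {i j i' j' : ℤ} (h1 : i ≠ j') (h2 : i' ≠ j) (v : Fock) :
    psi i (psiStar j (psi i' (psiStar j' v))) = psi i' (psiStar j' (psi i (psiStar j v))) := by
  rw [psiStar_psi j i', if_neg h2.symm, psiStar_psi j' i, if_neg h1.symm, psiStar_psiStar j' j]
  simp only [psi_neg, neg_neg, zero_sub]
  rw [psi_psi, neg_neg]

lemma sum_Ico_add_sum_Ico (f : ℤ → ℂ) {a b c : ℤ} (hab : a ≤ b) (hbc : b ≤ c) :
    ∑ i ∈ Finset.Ico a b, f i + ∑ i ∈ Finset.Ico b c, f i = ∑ i ∈ Finset.Ico a c, f i := by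
  rw [← Finset.Ico_union_Ico_eq_Ico hab hbc,
    Finset.sum_union (Finset.Ico_disjoint_Ico_consecutive a b c)]

lemma sum_Ico_shift (f : ℤ → ℂ) (a b s : ℤ) :
    ∑ i ∈ Finset.Ico a b, f (i - s) = ∑ i ∈ Finset.Ico (a - s) (b - s), f i := by
  refine Finset.sum_nbij' (fun i => i - s) (fun i => i + s) ?_ ?_ ?_ ?_ ?_ <;> intros <;>
    simp_all
  omega

/-- `H_l` is pulled to the left through the pairs of `H_k`, so that both Hamiltonians act as finite
sums on the vacuum component. -/
lemma H_H_empty (k l : ℕ+) (v : Fock) :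
    H k (H l v) ∅ = (∑ i ∈ Finset.Ico (-(k : ℤ)) 0, ∑ j ∈ Finset.Ico (-(l : ℤ)) 0,
        psi j (psiStar (j + l) (psi i (psiStar (i + k) v))) ∅) +
      ((∑ i ∈ Finset.Ico (-(k : ℤ)) 0, psi i (psiStar (i + k + l) v) ∅) -
      ∑ i ∈ Finset.Ico (-(k : ℤ) - l) (-l), psi i (psiStar (i + k + l) v) ∅) := by
  rw [H_apply_empty]
  have key : ∀ i : ℤ, psi i (psiStar (i + k) (H l v)) ∅ =
      H l (psi i (psiStar (i + k) v)) ∅ + (psi i (psiStar (i + k + l) v) ∅ -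
        psi (i - l) (psiStar ((i - l) + k + l) v) ∅) := fun i => by
    rw [H_psi, H_psiStar, psi_sub, show (i - (l : ℤ)) + k + l = i + k by ring]
    simp only [Pi.add_apply, Pi.sub_apply]
    ring
  simp only [key, Finset.sum_add_distrib, Finset.sum_sub_distrib, H_apply_empty]
  rw [sum_Ico_shift (fun i => psi i (psiStar (i + k + l) v) ∅), zero_sub]

/-- The quartic terms agree because unstarred indices are negative and starred ones nonnegative. The
quadratic remainders agree because both sides complete to the same interval from `-k-l` to 0; no
central term appears for positive `k` and `l`. -/
lemma H_H_comm_empty (k l : ℕ+) (v : Fock) : H k (H l v) ∅ = H l (H k v) ∅ := by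
  have hk := k.pos
  have hl := l.pos
  rw [H_H_empty, H_H_empty, Finset.sum_comm]
  congr 1
  · refine Finset.sum_congr rfl fun j hj => Finset.sum_congr rfl fun i hi => ?_
    rw [Finset.mem_Ico] at hi hj
    rw [psi_psiStar_comm (by omega) (by omega)]
  · simp only [show ∀ i : ℤ, i + (l : ℤ) + k = i + k + l by intros; ring]
    rw [show -(l : ℤ) - k = -(k : ℤ) - l by ring, sub_eq_sub_iff_add_eq_add]
    have h1 := sum_Ico_add_sum_Ico (fun i => psi i (psiStar (i + k + l) v) ∅)
      (show -(k : ℤ) - l ≤ -k by omega) (show -(k : ℤ) ≤ 0 by omega)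
    have h2 := sum_Ico_add_sum_Ico (fun i => psi i (psiStar (i + k + l) v) ∅)
      (show -(k : ℤ) - l ≤ -l by omega) (show -(l : ℤ) ≤ 0 by omega)
    rw [add_comm, h1, add_comm, h2]

/-- The Hamiltonians `H_k`, `k > 0`, commute. -/
lemma H_comm (k l : ℕ+) (v : Fock) : H k (H l v) = H l (H k v) := by
  rw [← sub_eq_zero]
  funext D
  induction D using Finset.induction_on generalizing v with
  | empty => simp [H_H_comm_empty k l]
  | insert n D hn ih =>
    -- Up to sign, the component at `D ∪ {n}` is the component at `D` after removing `n`. The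
    -- removing operator is a fermion, so the commutator passes through it and the induction
    -- hypothesis applies.
    suffices h : annih n (H k (H l v) - H l (H k v)) D = 0 by
      simp only [annih, hn, if_false] at h
      have hs : fsign n D ≠ 0 := fun h0 => by
        have := fsign_mul_self n D
        simp [h0] at this
      exact (mul_eq_zero.mp h).resolve_left hs
    rcases le_or_gt 0 n with h0 | h0
    · have := H_H_psiStar k l n v
      simp only [psiStar, h0, if_true] at this
      rw [← this, ih]
      rfl
    · have := H_H_psi k l n v
      simp only [psi, h0.not_ge, if_false] at this
      rw [← this, ih]
      rfl

/-- The operator `∏_k H_k^{d_k}`. -/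
def hamMonomial (d : ℕ+ →₀ ℕ) (v : Fock) : Fock :=
  (d.support.sort (· ≤ ·)).foldr (fun k u => (H k)^[d k] u) v

/-- The commutative monoid generated by the Hamiltonians. -/
abbrev hamMonoid : Submonoid (Function.End Fock) := Submonoid.closure (Set.range H)

/-- Commutativity makes `Finsupp.prod` available, so the ordered product over the sorted support
becomes independent of order and multiplicative in the exponent. -/
instance : CommMonoid hamMonoid :=
  { (inferInstance : Monoid hamMonoid) with
    mul_comm := (Submonoid.isMulCommutative_closure (Function.End Fock) (by
      rintro _ ⟨k, rfl⟩ _ ⟨l, rfl⟩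
      funext v
      exact H_comm k l v)).is_comm.comm }

/-- `H_k`, as an element of `hamMonoid`. -/
def hamGen (k : ℕ+) : hamMonoid := ⟨H k, Submonoid.subset_closure ⟨k, rfl⟩⟩

lemma hamMonomial_eq_prod (d : ℕ+ →₀ ℕ) (v : Fock) :
    hamMonomial d v = (d.prod fun k a => hamGen k ^ a : hamMonoid).1 v := by
  have key : ∀ l : List ℕ+, l.foldr (fun k u => (H k)^[d k] u) v =
      ((l.map fun k => hamGen k ^ d k).prod : hamMonoid).1 v := fun l => by
    induction l with
    | nil => rfl
    | cons k l ih =>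
      rw [List.foldr_cons, ih, List.map_cons, List.prod_cons]
      change _ = ((hamGen k ^ d k : hamMonoid) : Function.End Fock) _
      rw [SubmonoidClass.coe_pow]
      rfl
  have hperm : ((d.support.sort (· ≤ ·)).map fun k => hamGen k ^ d k).Perm
      (d.support.toList.map fun k => hamGen k ^ d k) :=
    List.Perm.map _ (Finset.sort_perm_toList d.support (· ≤ ·))
  rw [hamMonomial, key, Finsupp.prod, ← Finset.prod_map_toList, hperm.prod_eq]

lemma hamMonomial_zero (v : Fock) : hamMonomial 0 v = v := by
  rw [hamMonomial_eq_prod]; rfl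

lemma hamMonomial_add (d e : ℕ+ →₀ ℕ) (v : Fock) :
    hamMonomial (d + e) v = hamMonomial d (hamMonomial e v) := by
  rw [hamMonomial_eq_prod, hamMonomial_eq_prod, hamMonomial_eq_prod,
    Finsupp.prod_add_index' (h := fun (k : ℕ+) (a : ℕ) => (hamGen k ^ a : hamMonoid)) (by simp)
      (by simp [pow_add])]
  rfl

lemma hamMonomial_single (k : ℕ+) (v : Fock) : hamMonomial (Finsupp.single k 1) v = H k v := by
  rw [hamMonomial_eq_prod, Finsupp.prod_single_index
    (h := fun (k : ℕ+) (a : ℕ) => (hamGen k ^ a : hamMonoid)) (by simp), pow_one]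
  rfl

lemma hamMonomial_add_single (d : ℕ+ →₀ ℕ) (k : ℕ+) (v : Fock) :
    hamMonomial (d + Finsupp.single k 1) v = hamMonomial d (H k v) := by
  rw [hamMonomial_add, hamMonomial_single]

/-- The Hamiltonians act from the right on functionals of finitely many components. -/
lemma evalAt_H (k : ℕ+) (a : Finset ℤ →₀ ℂ) :
    ∃ b : Finset ℤ →₀ ℂ, ∀ v, evalAt a (H k v) = evalAt b v := by
  choose c hc using fun D => Q_eval (isJacobi_jpow_Lam k) D
  refine ⟨∑ D ∈ a.support, a D • c D, fun v => ?_⟩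
  rw [evalAt_finset_sum, evalAt_eq_sum]
  refine Finset.sum_congr rfl fun D _ => ?_
  rw [evalAt_smul, ← hc]
  rfl

lemma evalAt_hamMonomial (d : ℕ+ →₀ ℕ) (a : Finset ℤ →₀ ℂ) :
    ∃ b : Finset ℤ →₀ ℂ, ∀ v, evalAt a (hamMonomial d v) = evalAt b v := by
  induction d using Finsupp.induction_linear generalizing a with
  | zero => exact ⟨a, fun v => by rw [hamMonomial_zero]⟩
  | add d e hd he =>
    obtain ⟨b, hb⟩ := hd a
    obtain ⟨c, hc⟩ := he b
    exact ⟨c, fun v => by rw [hamMonomial_add, hb, hc]⟩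
  | single k n =>
    induction n with
    | zero => exact ⟨a, fun v => by rw [Finsupp.single_zero, hamMonomial_zero]⟩
    | succ n ih =>
      obtain ⟨b, hb⟩ := ih
      obtain ⟨c, hc⟩ := evalAt_H k b
      exact ⟨c, fun v => by rw [Finsupp.single_add, hamMonomial_add_single, hb, hc]⟩

/-! ### Monomials in the times -/

lemma series_add_apply (f g : TimeSeries) (d : ℕ+ →₀ ℕ) : (f + g) d = f d + g d := rfl

lemma series_sub_apply (f g : TimeSeries) (d : ℕ+ →₀ ℕ) : (f - g) d = f d - g d := rfl

lemma series_zero_apply (d : ℕ+ →₀ ℕ) : (0 : TimeSeries) d = 0 := rfl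

lemma series_smul_apply (c : ℂ) (f : TimeSeries) (d : ℕ+ →₀ ℕ) : (c • f) d = c * f d := rfl

lemma coeff_apply (f : TimeSeries) (d : ℕ+ →₀ ℕ) : MvPowerSeries.coeff d f = f d := rfl

lemma series_mul_apply (f g : TimeSeries) (d : ℕ+ →₀ ℕ) :
    (f * g) d = ∑ p ∈ antidiagonal d, f p.1 * g p.2 := by
  classical
  exact MvPowerSeries.coeff_mul (φ := f) (ψ := g) (n := d)

lemma series_mul_apply_zero (f g : TimeSeries) : (f * g) 0 = f 0 * g 0 := by
  have := map_mul MvPowerSeries.constantCoeff f g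
  exact this

lemma exponent_induction {p : (ℕ+ →₀ ℕ) → Prop} (d : ℕ+ →₀ ℕ) (zero : p 0)
    (add_single : ∀ d k, p d → p (d + Finsupp.single k 1)) : p d := by
  induction d using Finsupp.induction with
  | zero => exact zero
  | single_add k b d _ _ ih =>
    clear * - ih add_single
    induction b with
    | zero => simpa using ih
    | succ b hb =>
      rw [Finsupp.single_add, add_right_comm]
      exact add_single _ _ hb

lemma weight_zero : weight 0 = 0 := by simp [weight]

lemma weight_add (d e : ℕ+ →₀ ℕ) : weight (d + e) = weight d + weight e :=
  Finsupp.sum_add_index' (by simp) (by simp [mul_add])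

lemma weight_single (k : ℕ+) (a : ℕ) : weight (Finsupp.single k a) = k * a := by
  simp [weight]

lemma dfact_eq_prod {s : Finset ℕ+} {d : ℕ+ →₀ ℕ} (h : d.support ⊆ s) :
    dfact d = ∏ k ∈ s, ((d k).factorial : ℂ) :=
  Finsupp.prod_of_support_subset _ h _ (by simp)

lemma dfact_ne_zero (d : ℕ+ →₀ ℕ) : dfact d ≠ 0 := by
  rw [dfact_eq_prod (subset_refl _)]
  exact Finset.prod_ne_zero_iff.mpr fun k _ => by exact_mod_cast (d k).factorial_ne_zero

lemma dfact_zero : dfact 0 = 1 := by simp [dfact]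

lemma dfact_add_single (d : ℕ+ →₀ ℕ) (k : ℕ+) :
    dfact (d + Finsupp.single k 1) = (d k + 1) * dfact d := by
  classical
  have h1 : d.support ⊆ insert k d.support := Finset.subset_insert _ _
  have h2 : (d + Finsupp.single k 1).support ⊆ insert k d.support := fun i hi => by
    by_contra h
    simp only [Finset.mem_insert, not_or, Finsupp.mem_support_iff, not_not] at h
    simp [h.2, Ne.symm h.1] at hi
  rw [dfact_eq_prod h1, dfact_eq_prod h2, ← Finset.mul_prod_erase _ _ (Finset.mem_insert_self k _),
    ← Finset.mul_prod_erase (insert k d.support) (fun k => ((d k).factorial : ℂ))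
      (Finset.mem_insert_self k _), ← mul_assoc]
  congr 1
  · simp [Nat.factorial_succ]
  · refine Finset.prod_congr rfl fun i hi => ?_
    rw [Finset.mem_erase] at hi
    simp [Ne.symm hi.1]

lemma pderiv_apply (k : ℕ+) (f : TimeSeries) (d : ℕ+ →₀ ℕ) :
    MvPowerSeries.pderiv ℂ k f d = (d k + 1) * f (d + Finsupp.single k 1) := by
  have := MvPowerSeries.coeff_pderiv (i := k) f d
  rw [mul_comm] at this
  exact_mod_cast this

/-- Families of power series are determined by their constant terms and a system of first order
differential equations. -/
lemma eq_of_pderiv {ι : Type*} {F G : ι → TimeSeries} (c : ℂ) (ρ : ℕ+ → ι → ι)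
    (h0 : ∀ i, F i 0 = G i 0)
    (hF : ∀ k i, MvPowerSeries.pderiv ℂ k (F i) = c • F i + F (ρ k i))
    (hG : ∀ k i, MvPowerSeries.pderiv ℂ k (G i) = c • G i + G (ρ k i)) (i : ι) : F i = G i := by
  funext d
  induction d using exponent_induction generalizing i with
  | zero => exact h0 i
  | add_single d k ih =>
    have h1 := congrFun (hF k i) d
    have h2 := congrFun (hG k i) d
    rw [pderiv_apply] at h1 h2
    rw [series_add_apply, series_smul_apply] at h1 h2
    rw [ih, ih, ← h2] at h1
    exact mul_left_cancel₀ (by exact_mod_cast Nat.succ_ne_zero (d k)) h1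

lemma eq_C_of_pderiv {f : TimeSeries} (h : ∀ k, MvPowerSeries.pderiv ℂ k f = 0) :
    f = MvPowerSeries.C (f 0) := by
  refine eq_of_pderiv (ι := Unit) (F := fun _ => f) (G := fun _ => MvPowerSeries.C (f 0)) (-1)
    (fun _ => id) (fun _ => ?_) (fun k _ => ?_) (fun k _ => ?_) ()
  · rw [← coeff_apply (MvPowerSeries.C (f 0)), MvPowerSeries.coeff_zero_C]
  · simp [h]
  · simp

/-! ### Exponentials -/

/-- The power series `exp (ε ∑_k t_k)`. -/
def expSum (ε : ℂ) : TimeSeries := fun d => ε ^ (d.sum fun _ a => a) * (dfact d)⁻¹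

lemma expSum_apply_zero (ε : ℂ) : expSum ε 0 = 1 := by simp [expSum, dfact_zero]

lemma pderiv_expSum (ε : ℂ) (k : ℕ+) :
    MvPowerSeries.pderiv ℂ k (expSum ε) = ε • expSum ε := by
  funext d
  rw [pderiv_apply, series_smul_apply, expSum, expSum, dfact_add_single,
    Finsupp.sum_add_index' (by simp) (by simp), Finsupp.sum_single_index rfl, pow_succ]
  have h1 : ((d k : ℂ) + 1) ≠ 0 := by exact_mod_cast Nat.succ_ne_zero (d k)
  have h2 := dfact_ne_zero d
  field_simp

lemma expSum_mul_expSum : expSum 1 * expSum (-1) = 1 := by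
  have h := eq_C_of_pderiv (f := expSum 1 * expSum (-1)) fun k => by
    rw [Derivation.leibniz, pderiv_expSum, pderiv_expSum]
    simp [mul_comm]
  rw [h]
  rw [series_mul_apply_zero, expSum_apply_zero, expSum_apply_zero, mul_one, map_one]

/-! ### Homogeneous rescaling of the times

Replacing `t_k` by `λ^{-k} t_k` in a formal series `∑_N f_N λ^N` turns multiplication by
`exp (ε ∑ t_k λ^k)` into multiplication by the single power series `exp (ε ∑ t_k)`. -/

/-- The coefficients of `∑_N f_N λ^N` after replacing `t_k` by `λ^{-k} t_k`. -/
def twist (f : ℤ → TimeSeries) (N : ℤ) : TimeSeries := fun d => f (N + weight d) d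

lemma twist_injective : Function.Injective twist := fun f g h => by
  funext N d
  have := congrFun (congrFun h (N - weight d)) d
  simpa [twist] using this

/-- The coefficient of `λ^N` in `exp (ε ∑ t_k λ^k)`. -/
def gradedExp (ε : ℂ) (N : ℤ) : TimeSeries := fun d => if (weight d : ℤ) = N then expSum ε d else 0

/-- Multiplication of `∑_N f_N λ^N` by `exp (ε ∑ t_k λ^k)`. -/
def expMul (ε : ℂ) (f : ℤ → TimeSeries) : ℤ → TimeSeries := fun N =>
  fsum fun M : ℤ => f M * gradedExp ε (N - M)

lemma schur_eq_gradedExp : schur = gradedExp 1 := by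
  funext N d
  simp only [gradedExp, expSum, schur, one_pow, one_mul]

lemma act_eq_expMul (P : PDO) : act P = expMul 1 P := by
  funext N
  rw [act, expMul, schur_eq_gradedExp]

lemma unact_eq_expMul (f : ℤ → TimeSeries) : unact f = expMul (-1) f := by
  funext N
  rw [unact, expMul]
  congr 1
  funext M
  rw [mul_comm]
  rfl

/-- The weight of a monomial fixes its power of `λ`, so the sum over `M` collapses to a finite
convolution. -/
lemma fsum_expSum_apply (ε : ℂ) (f : ℤ → TimeSeries) (N : ℤ) (d : ℕ+ →₀ ℕ) :
    expMul ε f N d = ∑ p ∈ antidiagonal d, f (N - weight p.2) p.1 * expSum ε p.2 := by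
  change ∑ᶠ M, (f M * gradedExp ε (N - M)) d = _
  simp only [series_mul_apply, gradedExp]
  rw [finsum_sum_comm]
  · refine Finset.sum_congr rfl fun p _ => ?_
    rw [finsum_eq_single _ (N - (weight p.2 : ℤ)) fun M hM => ?_]
    · simp
    · rw [if_neg (by omega), mul_zero]
  · intro p _
    refine (Set.finite_singleton (N - (weight p.2 : ℤ))).subset fun M hM => ?_
    by_contra h
    rw [Set.mem_singleton_iff] at h
    refine hM ?_
    simp only
    rw [if_neg (by omega), mul_zero]

/-- Additivity of the weight lets the rescaling absorb every power of `λ` in the exponential.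
Inverting `act` thus reduces to inverting one power series. -/
lemma twist_expMul (ε : ℂ) (f : ℤ → TimeSeries) (N : ℤ) :
    twist (expMul ε f) N = twist f N * expSum ε := by
  funext d
  rw [twist, fsum_expSum_apply, series_mul_apply]
  refine Finset.sum_congr rfl fun p hp => ?_
  rw [mem_antidiagonal] at hp
  rw [twist, ← hp, weight_add]
  congr 2
  push_cast
  ring

/-! ### Vacuum expectation values of the Hamiltonian evolution -/

/-- The generating function `∑_d t^d ℓ(∏_k H_k^{d_k} u) / d!`, for a functional `ℓ`. -/
def hamSeries (ℓ : Fock → ℂ) (u : Fock) : TimeSeries := fun d => (dfact d)⁻¹ * ℓ (hamMonomial d u)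

lemma tau_eq_hamSeries (u : Fock) : tau u = hamSeries vacPair u := rfl

lemma hamSeries_apply_zero (ℓ : Fock → ℂ) (u : Fock) : hamSeries ℓ u 0 = ℓ u := by
  rw [hamSeries, dfact_zero, hamMonomial_zero, inv_one, one_mul]

lemma pderiv_hamSeries (ℓ : Fock → ℂ) (u : Fock) (k : ℕ+) :
    MvPowerSeries.pderiv ℂ k (hamSeries ℓ u) = hamSeries ℓ (H k u) := by
  funext d
  have h1 : ((d k : ℂ) + 1) ≠ 0 := by exact_mod_cast Nat.succ_ne_zero (d k)
  have h2 := dfact_ne_zero d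
  rw [pderiv_apply, hamSeries, hamSeries, dfact_add_single, hamMonomial_add_single]
  field_simp

lemma hamSeries_add_smul (a : Finset ℤ →₀ ℂ) (u w : Fock) (c : ℂ) :
    hamSeries (evalAt a) (u + c • w) = hamSeries (evalAt a) u + c • hamSeries (evalAt a) w := by
  funext d
  obtain ⟨b, hb⟩ := evalAt_hamMonomial d a
  simp only [hamSeries, series_add_apply, series_smul_apply, hb, evalAt_add, evalAt_smul_right]
  ring

/-- Differentiating by `t_k` lowers the weight by `k`, whence the shift in `λ`. -/
lemma pderiv_twist (k : ℕ+) (f : ℤ → TimeSeries) (N : ℤ) :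
    MvPowerSeries.pderiv ℂ k (twist f N) =
      twist (fun M => MvPowerSeries.pderiv ℂ k (f M)) (N + k) := by
  funext d
  rw [pderiv_apply, twist, twist, pderiv_apply, weight_add, weight_single]
  congr 2
  push_cast
  ring

/-- A field `∑_N X_N λ^N` with `[H_k, X_N] = ε X_{N-k}` evolves by multiplication by
`exp (ε ∑ t_k λ^k)`. -/
lemma hamSeries_eq_expMul (a : Finset ℤ →₀ ℂ) (ε : ℂ) (X : ℤ → Fock → Fock)
    (hX : ∀ (k : ℕ+) N u, H k (X N u) = X N (H k u) + ε • X (N - k) u) (u : Fock) :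
    (fun N => hamSeries (evalAt a) (X N u)) =
      expMul ε fun N => hamSeries (fun w => evalAt a (X N w)) u := by
  apply twist_injective
  funext N
  rw [twist_expMul]
  -- The vector is part of the index because differentiation sends `(N, u)` to `(N + k, H_k u)`.
  -- Both sides obey this same first order system.
  refine eq_of_pderiv (ι := ℤ × Fock)
    (F := fun p => twist (fun N => hamSeries (evalAt a) (X N p.2)) p.1)
    (G := fun p => twist (fun N => hamSeries (fun w => evalAt a (X N w)) p.2) p.1 * expSum ε)
    ε (fun k p => (p.1 + k, H k p.2)) (fun p => ?_) (fun k p => ?_) (fun k p => ?_) (N, u)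
  · rw [series_mul_apply_zero, expSum_apply_zero, mul_one, twist, twist, hamSeries_apply_zero,
      hamSeries_apply_zero]
  · simp only [pderiv_twist, pderiv_hamSeries, hX, hamSeries_add_smul]
    funext d
    simp only [twist, series_add_apply, series_smul_apply]
    rw [add_comm, show p.1 + (k : ℤ) + weight d - k = p.1 + weight d by ring]
  · rw [Derivation.leibniz, pderiv_expSum, pderiv_twist]
    simp only [pderiv_hamSeries, smul_eq_mul, mul_smul_comm]
    rw [mul_comm (expSum ε)]

/-- The right action of `⟨1|`. -/
def chargeOne : Finset ℤ →₀ ℂ := Finsupp.single {0} 1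

/-- The right action of `⟨-1|`. -/
def chargeNegOne : Finset ℤ →₀ ℂ := Finsupp.single {-1} 1

/-- Conjugation by the Hamiltonian evolution multiplies `ψ(λ) = ∑ ψ_N λ^N` by `exp(∑ t_k λ^k)`,
which is what `act` implements. -/
lemma hamSeries_psi (u : Fock) :
    (fun N => hamSeries (evalAt chargeOne) (psi N u)) =
      act fun N => hamSeries (fun w => psi N w {0}) u := by
  rw [act_eq_expMul, hamSeries_eq_expMul chargeOne 1 psi fun k N u => by rw [H_psi, one_smul]]
  simp [chargeOne, evalAt_single]

/-- The dual field `∑ ψ_i^* λ^{-i-1}` picks up the inverse exponential; the index `-N - 1` makes `N`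
its power of `λ`. -/
lemma hamSeries_psiStar (u : Fock) :
    (fun N => hamSeries (evalAt chargeNegOne) (psiStar (-N - 1) u)) =
      unact fun N => hamSeries (fun w => psiStar (-N - 1) w {-1}) u := by
  rw [unact_eq_expMul, hamSeries_eq_expMul chargeNegOne (-1) (fun N => psiStar (-N - 1))
    fun k N u => by
      rw [H_psiStar, neg_one_smul, ← sub_eq_add_neg, show -N - 1 + (k : ℤ) = -(N - k) - 1 by ring]]
  simp [chargeNegOne, evalAt_single]

lemma psi_singleton_pos {N : ℤ} (h : 0 < N) (w : Fock) : psi N w {0} = 0 :=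
  psi_apply_of_notMem h.le (by simp; omega) w

lemma psi_singleton_zero (w : Fock) : psi 0 w {0} = vacPair w := by
  simp [psi, create, fsign, vacPair, Finset.filter_singleton]

lemma psiStar_singleton_pos {N : ℤ} (h : 0 < N) (w : Fock) : psiStar (-N - 1) w {-1} = 0 :=
  psiStar_apply_of_notMem (by omega) (by simp; omega) w

lemma psiStar_singleton_zero (w : Fock) : psiStar (-0 - 1) w {-1} = vacPair w := by
  simp [psiStar, create, fsign, vacPair, Finset.filter_singleton]

/-! ### The shift of the times by `[λ⁻¹]` -/

/-- Reflecting the outer index gives a sum over the triangle `a + b < j`, which is symmetric under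
exchange of `a` and `b`. -/
lemma sum_antisymm_eq_zero (j : ℕ) (t : ℕ → ℕ → ℂ) (h : ∀ a b, t a b = -t b a) :
    ∑ k ∈ Finset.range j, ∑ a ∈ Finset.range (k + 1), t a (j - 1 - k) = 0 := by
  have h1 : ∑ k ∈ Finset.range j, ∑ a ∈ Finset.range (k + 1), t a (j - 1 - k) =
      ∑ b ∈ Finset.range j, ∑ a ∈ Finset.range j, if a + b < j then t a b else 0 := by
    rw [← Finset.sum_range_reflect]
    refine Finset.sum_congr rfl fun b hb => ?_
    rw [Finset.mem_range] at hb
    rw [← Finset.sum_filter, show j - 1 - (j - 1 - b) = b by omega]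
    refine Finset.sum_congr ?_ fun _ _ => rfl
    ext a
    simp only [Finset.mem_range, Finset.mem_filter]
    omega
  have h2 : ∑ b ∈ Finset.range j, ∑ a ∈ Finset.range j, (if a + b < j then t a b else 0) =
      -∑ b ∈ Finset.range j, ∑ a ∈ Finset.range j, if a + b < j then t a b else 0 := by
    conv_lhs => rw [Finset.sum_comm]
    rw [← Finset.sum_neg_distrib]
    refine Finset.sum_congr rfl fun a _ => ?_
    rw [← Finset.sum_neg_distrib]
    refine Finset.sum_congr rfl fun b _ => ?_
    rw [add_comm b a, h]
    split_ifs <;> simp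
  rw [h1]
  linear_combination h2 / 2

lemma H_succPNat_psi_singleton (j k : ℕ) (hk : k < j) (u : Fock) :
    H k.succPNat (psi (-((j - 1 - k : ℕ) : ℤ)) u) {0} = -∑ a ∈ Finset.range (k + 1),
      psi (-(a : ℤ)) (psi (-((j - 1 - k : ℕ) : ℤ))
        (psiStar ((j : ℤ) - a - (j - 1 - k : ℕ)) u)) {0} := by
  rw [H_apply_singleton, ← Finset.sum_neg_distrib, Nat.succPNat_coe]
  refine Finset.sum_nbij' (fun i => (-i).toNat) (fun a => -(a : ℤ)) ?_ ?_ ?_ ?_ ?_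
  · intro i hi
    simp only [Finset.mem_Ioc, Finset.mem_range] at hi ⊢
    omega
  · intro a ha
    simp only [Finset.mem_Ioc, Finset.mem_range] at ha ⊢
    omega
  · intro i hi
    simp only [Finset.mem_Ioc] at hi
    omega
  · intro a ha
    simp
  · intro i hi
    simp only [Finset.mem_Ioc] at hi
    rw [psiStar_psi, if_neg (by omega), zero_sub, psi_neg, Pi.neg_apply]
    rw [show -(((-i).toNat : ℕ) : ℤ) = i by omega, show (j : ℤ) - ((-i).toNat : ℕ) -
      ((j - 1 - k : ℕ) : ℤ) = i + (k.succ : ℕ) by omega]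

/-- This is Newton's recurrence between power sums and complete symmetric functions. Commuting each
`H_{k+1}` to the left yields `j` copies of `ψ_{-j}` and cubic terms, which cancel by antisymmetry of
`ψ_{-a} ψ_{-b}`. -/
lemma psi_singleton_recurrence (j : ℕ) (u : Fock) :
    (j : ℂ) * psi (-(j : ℤ)) u {0} =
      -∑ k ∈ Finset.range j, psi (-((j - 1 - k : ℕ) : ℤ)) (H k.succPNat u) {0} := by
  have key : ∀ k ∈ Finset.range j, psi (-((j - 1 - k : ℕ) : ℤ)) (H k.succPNat u) {0} =
      -(∑ a ∈ Finset.range (k + 1), psi (-(a : ℤ)) (psi (-((j - 1 - k : ℕ) : ℤ))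
        (psiStar ((j : ℤ) - a - (j - 1 - k : ℕ)) u)) {0}) - psi (-(j : ℤ)) u {0} := by
    intro k hk
    rw [Finset.mem_range] at hk
    have h := congrFun (H_psi k.succPNat (-((j - 1 - k : ℕ) : ℤ)) u) {0}
    rw [H_succPNat_psi_singleton j k hk, Pi.add_apply, Nat.succPNat_coe,
      show -((j - 1 - k : ℕ) : ℤ) - (k.succ : ℕ) = -(j : ℤ) by omega] at h
    rw [h]
    ring
  rw [Finset.sum_congr rfl key, Finset.sum_sub_distrib, Finset.sum_neg_distrib,
    sum_antisymm_eq_zero j (fun a b => psi (-(a : ℤ)) (psi (-(b : ℤ))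
      (psiStar ((j : ℤ) - a - b) u)) {0}) fun a b => by
        rw [psi_psi, Pi.neg_apply, show (j : ℤ) - a - b = j - b - a by ring]]
  simp

/-! ### Monomials of fixed weight and the coefficients of the Miwa shift -/

lemma le_weight (d : ℕ+ →₀ ℕ) (k : ℕ+) : k * d k ≤ weight d := by
  by_cases h : k ∈ d.support
  · exact Finset.single_le_sum (f := fun k : ℕ+ => (k : ℕ) * d k) (fun _ _ => Nat.zero_le _) h
  · simp [Finsupp.notMem_support_iff.mp h]

lemma finite_weight_eq (j : ℕ) : {d : ℕ+ →₀ ℕ | weight d = j}.Finite := by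
  classical
  refine (Set.finite_Icc (0 : ℕ+ →₀ ℕ)
    (∑ k ∈ Finset.range j, Finsupp.single k.succPNat j)).subset fun d hd => ?_
  refine ⟨fun k => Nat.zero_le _, fun k => ?_⟩
  have h := le_weight d k
  rw [Set.mem_ofPred_eq] at hd
  rw [hd] at h
  have hk := k.pos
  rcases Nat.eq_zero_or_pos (d k) with h0 | h0
  · rw [h0]; exact Nat.zero_le _
  · have h1 : (k : ℕ) ≤ j := (Nat.le_mul_of_pos_right _ h0).trans h
    have h2 : d k ≤ j := (Nat.le_mul_of_pos_left _ hk).trans h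
    have h3 : (k : ℕ) - 1 ∈ Finset.range j := by rw [Finset.mem_range]; omega
    rw [Finsupp.finsetSum_apply]
    refine h2.trans (le_trans ?_ (Finset.single_le_sum (fun _ _ => Nat.zero_le _) h3))
    rw [show ((k : ℕ) - 1).succPNat = k from PNat.eq (by rw [Nat.succPNat_coe]; omega)]
    simp

/-- The finite set of monomials of weight `j`. -/
def weightFinset (j : ℕ) : Finset (ℕ+ →₀ ℕ) := (finite_weight_eq j).toFinset

lemma mem_weightFinset {j : ℕ} {d : ℕ+ →₀ ℕ} : d ∈ weightFinset j ↔ weight d = j := by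
  simp [weightFinset]

lemma finsum_weight_eq (j : ℕ) (f : (ℕ+ →₀ ℕ) → ℂ) :
    ∑ᶠ d : {d : ℕ+ →₀ ℕ // weight d = j}, f d.1 = ∑ d ∈ weightFinset j, f d := by
  rw [weightFinset, ← finsum_mem_eq_finite_toFinset_sum]
  exact finsum_set_coe_eq_finsum_mem {d : ℕ+ →₀ ℕ | weight d = j}

/-- The coefficient of `∏ x_k^{d_k}` in `exp (-∑ x_k / k)`. -/
def miwaCoeff (d : ℕ+ →₀ ℕ) : ℂ := d.prod fun k a => (-((k : ℕ) : ℂ)⁻¹) ^ a / (a.factorial : ℂ)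

lemma miwaCoeff_eq_prod {s : Finset ℕ+} {d : ℕ+ →₀ ℕ} (h : d.support ⊆ s) :
    miwaCoeff d = ∏ k ∈ s, (-((k : ℕ) : ℂ)⁻¹) ^ d k / ((d k).factorial : ℂ) :=
  Finsupp.prod_of_support_subset _ h _ (by simp)

/-- The equation `k ∂F/∂x_k = -F` for `F = exp(-∑ x_k / k)`, read on coefficients. -/
lemma miwaCoeff_add_single (d : ℕ+ →₀ ℕ) (k : ℕ+) :
    ((k : ℕ) : ℂ) * (d k + 1) * miwaCoeff (d + Finsupp.single k 1) = -miwaCoeff d := by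
  classical
  have h1 : d.support ⊆ insert k d.support := Finset.subset_insert _ _
  have h2 : (d + Finsupp.single k 1).support ⊆ insert k d.support := fun i hi => by
    by_contra h
    simp only [Finset.mem_insert, not_or, Finsupp.mem_support_iff, not_not] at h
    simp [h.2, Ne.symm h.1] at hi
  rw [miwaCoeff_eq_prod h1, miwaCoeff_eq_prod h2,
    ← Finset.mul_prod_erase _ _ (Finset.mem_insert_self k _),
    ← Finset.mul_prod_erase (insert k d.support) _ (Finset.mem_insert_self k _)]
  have h3 : ∀ i ∈ (insert k d.support).erase k,
      (-((i : ℕ) : ℂ)⁻¹) ^ (d + Finsupp.single k 1 : ℕ+ →₀ ℕ) i /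
        (((d + Finsupp.single k 1 : ℕ+ →₀ ℕ) i).factorial : ℂ) =
      (-((i : ℕ) : ℂ)⁻¹) ^ d i / ((d i).factorial : ℂ) := fun i hi => by
    simp [Ne.symm (Finset.ne_of_mem_erase hi)]
  rw [Finset.prod_congr rfl h3, ← mul_assoc, ← neg_mul]
  congr 1
  have hk : ((k : ℕ) : ℂ) ≠ 0 := by exact_mod_cast k.ne_zero
  have h3 : ((d k : ℂ) + 1) ≠ 0 := by exact_mod_cast Nat.succ_ne_zero (d k)
  have h4 : ((d k).factorial : ℂ) ≠ 0 := by exact_mod_cast (d k).factorial_ne_zero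
  simp only [Finsupp.add_apply, Finsupp.single_eq_same, Nat.factorial_succ, pow_succ]
  push_cast
  field_simp

lemma sum_range_weight {j : ℕ} {d : ℕ+ →₀ ℕ} (h : weight d = j) :
    ∑ k ∈ Finset.range j, (k.succPNat : ℕ) * d k.succPNat = j := by
  conv_rhs => rw [← h]
  rw [weight, Finsupp.sum]
  symm
  refine Finset.sum_of_injOn (fun k : ℕ+ => (k : ℕ) - 1) ?_ ?_ ?_ ?_
  · intro a _ b _ hab
    have ha := a.pos
    have hb := b.pos
    simp only at hab
    exact PNat.eq (by omega)
  · intro k hk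
    have h1 := le_weight d k
    rw [Finset.mem_coe, Finsupp.mem_support_iff] at hk
    have h2 := (Nat.le_mul_of_pos_right (k : ℕ) (Nat.pos_of_ne_zero hk)).trans h1
    have hk := k.pos
    simp only [Finset.coe_range, Set.mem_Iio]
    omega
  · intro i hi hn
    by_contra hc
    refine hn ⟨i.succPNat, ?_, by simp⟩
    rw [Finset.mem_coe, Finsupp.mem_support_iff]
    exact right_ne_zero_of_mul hc
  · intro k hk
    have hk := k.pos
    rw [show ((k : ℕ) - 1).succPNat = k from PNat.eq (by rw [Nat.succPNat_coe]; omega)]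

/-- `⟨0| h_j(-H_1, -H_2 / 2, …) |u⟩ = ⟨1| ψ_{-j} |u⟩`. -/
lemma sum_miwaCoeff (j : ℕ) (u : Fock) :
    ∑ d ∈ weightFinset j, miwaCoeff d * vacPair (hamMonomial d u) = psi (-(j : ℤ)) u {0} := by
  classical
  induction j using Nat.strong_induction_on generalizing u with
  | _ j ih =>
  rcases Nat.eq_zero_or_pos j with rfl | hj
  · have h0 : weightFinset 0 = {0} := by
      ext d
      rw [mem_weightFinset, Finset.mem_singleton]
      constructor
      · intro h
        ext k
        have := le_weight d k
        rw [h] at this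
        have hk := k.pos
        simpa [hk.ne'] using this
      · rintro rfl
        exact weight_zero
    rw [h0, Finset.sum_singleton, hamMonomial_zero, Nat.cast_zero, neg_zero, psi_singleton_zero]
    simp [miwaCoeff]
  · have hj0 : (j : ℂ) ≠ 0 := by exact_mod_cast hj.ne'
    apply mul_left_cancel₀ hj0
    rw [psi_singleton_recurrence, Finset.mul_sum, ← Finset.sum_neg_distrib]
    -- Splitting `j = ∑ k d_k` lets one factor `H_k` be removed from each monomial. This matches the
    -- Newton recurrence and lowers the weight for the induction.
    have h1 : ∀ d ∈ weightFinset j, (j : ℂ) * (miwaCoeff d * vacPair (hamMonomial d u)) =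
        ∑ k ∈ Finset.range j, ((k.succPNat : ℕ) : ℂ) * (d k.succPNat : ℂ) * miwaCoeff d *
          vacPair (hamMonomial d u) := fun d hd => by
      have := sum_range_weight (mem_weightFinset.mp hd)
      rw [← Finset.sum_mul, ← Finset.sum_mul, mul_assoc]
      congr 1
      exact_mod_cast this.symm
    rw [Finset.sum_congr rfl h1, Finset.sum_comm]
    refine Finset.sum_congr rfl fun k hk => ?_
    rw [Finset.mem_range] at hk
    rw [← ih (j - 1 - k) (by omega), ← Finset.sum_neg_distrib]
    symm
    refine Finset.sum_of_injOn (fun d => d + Finsupp.single k.succPNat 1) ?_ ?_ ?_ ?_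
    · intro a _ b _ hab
      exact add_right_cancel hab
    · intro d hd
      rw [Finset.mem_coe, mem_weightFinset] at hd ⊢
      rw [weight_add, weight_single, hd, Nat.succPNat_coe]
      omega
    · intro d hd hn
      by_cases hdk : d k.succPNat = 0
      · simp [hdk]
      · exfalso
        have hle : Finsupp.single k.succPNat 1 ≤ d := by
          rw [Finsupp.single_le_iff]; omega
        refine hn ⟨d - Finsupp.single k.succPNat 1, ?_, tsub_add_cancel_of_le hle⟩
        have h2 : weight (d - Finsupp.single k.succPNat 1) + (k + 1) = j := by
          have := weight_add (d - Finsupp.single k.succPNat 1) (Finsupp.single k.succPNat 1)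
          rw [tsub_add_cancel_of_le hle, mem_weightFinset.mp hd, weight_single,
            Nat.succPNat_coe] at this
          omega
        rw [Finset.mem_coe, mem_weightFinset]
        omega
    · intro d _
      have := miwaCoeff_add_single d k.succPNat
      simp only [hamMonomial_add_single, Finsupp.add_apply, Finsupp.single_eq_same, Nat.cast_add,
        Nat.cast_one]
      rw [this]
      ring

lemma miwa_prod (d e : ℕ+ →₀ ℕ) :
    (d.prod fun k a => (-((k : ℕ) : ℂ)⁻¹) ^ a * ((e k + a).choose a : ℂ)) * (dfact (e + d))⁻¹ =
      (dfact e)⁻¹ * miwaCoeff d := by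
  classical
  have h1 : d.support ⊆ e.support ∪ d.support := Finset.subset_union_right
  have h2 : e.support ⊆ e.support ∪ d.support := Finset.subset_union_left
  rw [miwaCoeff_eq_prod h1, dfact_eq_prod h2, dfact_eq_prod Finsupp.support_add,
    Finsupp.prod_of_support_subset _ h1 _ (by simp), ← Finset.prod_inv_distrib,
    ← Finset.prod_inv_distrib, ← Finset.prod_mul_distrib, ← Finset.prod_mul_distrib]
  refine Finset.prod_congr rfl fun k _ => ?_
  have h := Nat.add_choose_mul_factorial_mul_factorial (e k) (d k)
  have h' : ((e k + d k).choose (d k) : ℂ) * (e k).factorial * (d k).factorial =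
      (e k + d k).factorial := by exact_mod_cast h
  have e1 : ((e k).factorial : ℂ) ≠ 0 := by exact_mod_cast (e k).factorial_ne_zero
  have e2 : ((d k).factorial : ℂ) ≠ 0 := by exact_mod_cast (d k).factorial_ne_zero
  have e3 : ((e k + d k).factorial : ℂ) ≠ 0 := by exact_mod_cast (e k + d k).factorial_ne_zero
  rw [Finsupp.add_apply]
  field_simp
  rw [← h']

/-- The coefficients of `exp (-∑ λ^{-k} k⁻¹ ∂/∂t_k) τ` are the vacuum expectation values
`⟨1| ψ_{-j} exp (∑ t_k H_k) |u⟩`. -/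
lemma miwaShift_tau (j : ℕ) (u : Fock) :
    miwaShift j (tau u) = hamSeries (fun w => psi (-(j : ℤ)) w {0}) u := by
  funext e
  rw [miwaShift, finsum_weight_eq j (fun d => (d.prod fun k a => (-((k : ℕ) : ℂ)⁻¹) ^ a *
    ((e k + a).choose a : ℂ)) * MvPowerSeries.coeff (e + d) (tau u)), hamSeries, ← sum_miwaCoeff,
    Finset.mul_sum]
  refine Finset.sum_congr rfl fun d _ => ?_
  rw [coeff_apply, tau_eq_hamSeries, hamSeries, ← mul_assoc, miwa_prod, mul_assoc, add_comm e,
    hamMonomial_add]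

/-! ### Products of formal series in `λ` -/

/-- `∑_N f_N λ^N`, with rescaled times, has order at most `c` in `λ`. -/
def TwistBounded (c : ℤ) (f : ℤ → TimeSeries) : Prop := ∀ N, c < N → twist f N = 0

lemma apply_eq_twist (f : ℤ → TimeSeries) (N : ℤ) (d : ℕ+ →₀ ℕ) :
    f N d = twist f (N - weight d) d := by
  rw [twist, sub_add_cancel]

lemma TwistBounded.expMul {c : ℤ} {f : ℤ → TimeSeries} (h : TwistBounded c f) (ε : ℂ) :
    TwistBounded c (expMul ε f) := fun N hN => by
  rw [twist_expMul, h N hN, zero_mul]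

/-- The product of `∑_N f_N λ^N` and `∑_N g_N λ^N`. -/
def laurentMul (f g : ℤ → TimeSeries) : ℤ → TimeSeries := fun M => fsum fun i : ℤ => f i * g (M - i)

/-- The untwisted product involves a range of `i` that depends on the monomial. After rescaling, the
order bounds leave one finite range for all monomials. -/
lemma twist_laurentMul {a b : ℤ} {f g : ℤ → TimeSeries} (hf : TwistBounded a f)
    (hg : TwistBounded b g) (M : ℤ) :
    twist (laurentMul f g) M = ∑ N ∈ Finset.Icc (M - b) a, twist f N * twist g (M - N) := by
  funext d
  change ∑ᶠ i : ℤ, (f i * g (M + weight d - i)) d =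
    MvPowerSeries.coeff d (∑ N ∈ Finset.Icc (M - b) a, twist f N * twist g (M - N))
  rw [map_sum]
  simp only [coeff_apply, series_mul_apply]
  have key : ∀ p ∈ antidiagonal d, ∀ i : ℤ, f i p.1 * g (M + weight d - i) p.2 =
      twist f (i - weight p.1) p.1 * twist g (M - (i - weight p.1)) p.2 := fun p hp i => by
    rw [mem_antidiagonal] at hp
    rw [apply_eq_twist f, apply_eq_twist g, ← hp, weight_add,
      show M + ((weight p.1 + weight p.2 : ℕ) : ℤ) - i - weight p.2 = M - (i - weight p.1) by
        push_cast; ring]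
  have hsupp : ∀ p : (ℕ+ →₀ ℕ) × (ℕ+ →₀ ℕ), Function.support
      (fun i : ℤ => twist f i p.1 * twist g (M - i) p.2) ⊆ Finset.Icc (M - b) a := fun p i hi => by
    rw [Finset.coe_Icc, Set.mem_Icc]
    by_contra hc
    rw [not_and_or, not_le, not_le] at hc
    refine hi ?_
    rcases hc with hc | hc
    · simp only
      rw [hg _ (by omega), series_zero_apply, mul_zero]
    · simp only
      rw [hf _ hc, series_zero_apply, zero_mul]
  rw [finsum_sum_comm, Finset.sum_comm]
  · refine Finset.sum_congr rfl fun p hp => ?_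
    rw [finsum_congr (key p hp), ← finsum_eq_sum_of_support_subset _ (hsupp p)]
    exact finsum_comp_equiv (Equiv.subRight (weight p.1 : ℤ))
      (f := fun i : ℤ => twist f i p.1 * twist g (M - i) p.2)
  · intro p hp
    change (Function.support _).Finite
    rw [show (fun i : ℤ => f i p.1 * g (M + weight d - i) p.2) = _ from funext (key p hp)]
    exact (((Finset.Icc (M - b) a).finite_toSet.subset (hsupp p)).preimage
      (Equiv.subRight (weight p.1 : ℤ)).injective.injOn)

/-- The factors `e^ζ` and `e^{-ζ}` cancel inside the product; the order bounds make the doubly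
infinite products meaningful. -/
lemma laurentMul_act_unact {a b : ℤ} {f g : ℤ → TimeSeries} (hf : TwistBounded a f)
    (hg : TwistBounded b g) : laurentMul (act f) (unact g) = laurentMul f g := by
  apply twist_injective
  funext M
  rw [act_eq_expMul, unact_eq_expMul, twist_laurentMul (hf.expMul 1) (hg.expMul (-1)),
    twist_laurentMul hf hg]
  refine Finset.sum_congr rfl fun N _ => ?_
  rw [twist_expMul, twist_expMul, mul_mul_mul_comm, expSum_mul_expSum, mul_one]

lemma act_unact (f : ℤ → TimeSeries) : act (unact f) = f := by
  apply twist_injective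
  funext N
  rw [act_eq_expMul, unact_eq_expMul, twist_expMul, twist_expMul, mul_assoc, mul_comm (expSum _),
    expSum_mul_expSum, mul_one]

lemma unact_act (f : ℤ → TimeSeries) : unact (act f) = f := by
  apply twist_injective
  funext N
  rw [act_eq_expMul, unact_eq_expMul, twist_expMul, twist_expMul, mul_assoc,
    expSum_mul_expSum, mul_one]

lemma TwistBounded.of_act {c : ℤ} {f : ℤ → TimeSeries} (h : TwistBounded c (act f)) :
    TwistBounded c f := by
  rw [← unact_act f, unact_eq_expMul]
  exact h.expMul (-1)

/-! ### The action of operators on the exponential -/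

/-- Because `∂^m e^ζ = λ^m e^ζ`. -/
lemma act_mulPartial (m : ℤ) (P : PDO) (N : ℤ) : act (mulPartial m P) N = act P (N - m) := by
  suffices h : act (mulPartial m P) = fun N => act P (N - m) by rw [h]
  apply twist_injective
  have h1 : ∀ f : ℤ → TimeSeries, ∀ N, twist (fun N => f (N - m)) N = twist f (N - m) :=
    fun f N => by
      funext d
      rw [twist, twist]
      congr 1
      ring
  funext N
  rw [h1, act_eq_expMul, act_eq_expMul, twist_expMul, twist_expMul]
  congr 1
  exact h1 P N

lemma act_divXhat (t₀ : ℂ) (P : PDO) : act (divXhat t₀ P) = lamInt t₀ (act P) := act_unact _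

/-- The Euler operator `∑_k k t_k ∂/∂t_k`. -/
def euler (f : TimeSeries) : TimeSeries := fun d => weight d * f d

lemma euler_mul (f g : TimeSeries) : euler (f * g) = euler f * g + f * euler g := by
  funext d
  rw [series_add_apply, euler, series_mul_apply, series_mul_apply, series_mul_apply, Finset.mul_sum,
    ← Finset.sum_add_distrib]
  refine Finset.sum_congr rfl fun p hp => ?_
  rw [mem_antidiagonal] at hp
  rw [euler, euler, ← hp, weight_add]
  push_cast
  ring

/-- The power series `∑_k k t_k`. -/
def eulerForm : TimeSeries := fun d => if d.sum (fun _ a => a) = 1 then weight d else 0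

lemma eulerForm_single (k : ℕ+) : eulerForm (Finsupp.single k 1) = (k : ℕ) := by
  simp [eulerForm, weight_single]

lemma eulerForm_mul_apply (f : TimeSeries) (d : ℕ+ →₀ ℕ) :
    (eulerForm * f) d = ∑ k ∈ d.support, ((k : ℕ) : ℂ) * f (d - Finsupp.single k 1) := by
  rw [series_mul_apply]
  symm
  have hle : ∀ k ∈ d.support, Finsupp.single k 1 ≤ d := fun k hk => by
    rw [Finsupp.single_le_iff]
    exact Nat.one_le_iff_ne_zero.mpr (Finsupp.mem_support_iff.mp hk)
  refine Finset.sum_of_injOn (fun k => (Finsupp.single k 1, d - Finsupp.single k 1)) ?_ ?_ ?_ ?_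
  · intro a _ b _ hab
    exact (Finsupp.single_left_inj one_ne_zero).mp (Prod.ext_iff.mp hab).1
  · intro k hk
    rw [Finset.mem_coe, mem_antidiagonal]
    exact add_tsub_cancel_of_le (hle k hk)
  · intro p hp hn
    rw [mem_antidiagonal] at hp
    rw [eulerForm, if_neg, zero_mul]
    intro h
    obtain ⟨k, hk⟩ := (Finsupp.sum_eq_one_iff p.1).mp h
    refine hn ⟨k, ?_, Prod.ext hk.symm ?_⟩
    · rw [Finset.mem_coe, Finsupp.mem_support_iff, ← hp, hk]
      simp
    · rw [← hp, hk]
      exact add_tsub_cancel_left _ _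
  · intro k _
    rw [eulerForm_single]

lemma euler_expSum : euler (expSum 1) = eulerForm * expSum 1 := by
  funext d
  rw [eulerForm_mul_apply, euler, weight, Finsupp.sum]
  push_cast
  rw [Finset.sum_mul]
  refine Finset.sum_congr rfl fun k hk => ?_
  have hle : Finsupp.single k 1 ≤ d := by
    rw [Finsupp.single_le_iff]
    exact Nat.one_le_iff_ne_zero.mpr (Finsupp.mem_support_iff.mp hk)
  have h := congrFun (pderiv_expSum 1 k) (d - Finsupp.single k 1)
  rw [pderiv_apply, tsub_add_cancel_of_le hle, one_smul] at h
  rw [← h, mul_assoc]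
  congr 2
  rw [Finsupp.tsub_apply, Finsupp.single_eq_same]
  have : 1 ≤ d k := Nat.one_le_iff_ne_zero.mpr (Finsupp.mem_support_iff.mp hk)
  push_cast [this]
  ring

/-! ### Right multiplication by `x̂` as differentiation in `λ` -/

lemma dx_smul (c : ℂ) (f : TimeSeries) : dx (c • f) = c • dx f := by
  simp [dx]

lemma dx_xhat (t₀ : ℂ) (j : ℤ) : dx (xhat t₀ j) = if j = 0 then 1 else 0 := by
  unfold xhat
  split_ifs with h1 h2 h3 h3
  · omega
  · exact MvPowerSeries.pderiv_C
  · subst h3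
    rw [dx_smul]
    have : ((0 : ℤ).toNat.succPNat) = 1 := rfl
    rw [this, dx, MvPowerSeries.pderiv_X_self]
    simp
  · rw [dx_smul, dx, MvPowerSeries.pderiv_X_of_ne, smul_zero]
    intro h
    have := congrArg PNat.val h
    simp at this
    omega
  · omega
  · simp [dx]

lemma dx_iterate_xhat (t₀ : ℂ) (j : ℤ) (k : ℕ) : dx^[k + 2] (xhat t₀ j) = 0 := by
  have h0 : ∀ k, dx^[k] 0 = 0 := fun k => by
    induction k with
    | zero => rfl
    | succ k ih => rw [Function.iterate_succ_apply', ih]; simp [dx]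
  rw [Function.iterate_add_apply, Function.iterate_succ_apply, Function.iterate_one, dx_xhat]
  split_ifs <;> simp [dx, h0]

lemma mul_X_apply (f : TimeSeries) (k : ℕ+) (d : ℕ+ →₀ ℕ) :
    (f * (MvPowerSeries.X k : TimeSeries)) d = if k ∈ d.support then f (d - Finsupp.single k 1) else 0 := by
  have h := MvPowerSeries.coeff_mul_monomial d (Finsupp.single k 1) f (1 : ℂ)
  rw [mul_one] at h
  refine Eq.trans h ?_
  simp only [Finsupp.single_le_iff, Finsupp.mem_support_iff, Nat.one_le_iff_ne_zero]
  rfl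

lemma mul_xhat_apply (t₀ : ℂ) (P : PDO) (L N : ℤ) (d : ℕ+ →₀ ℕ) :
    (P N * xhat t₀ (L - N)) d = (if N = L + 1 then t₀ * P (L + 1) d else 0) +
      ∑ k ∈ d.support, if N = L + 1 - k then
        ((k : ℕ) : ℂ) * P (L + 1 - k) (d - Finsupp.single k 1) else 0 := by
  unfold xhat
  by_cases h1 : N = L + 1
  · subst h1
    rw [if_pos (by ring), if_pos rfl, mul_comm, ← MvPowerSeries.smul_eq_C_mul, series_smul_apply,
      Finset.sum_eq_zero, add_zero]
    intro k _
    have := k.pos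
    rw [if_neg (by omega)]
  · rw [if_neg (by omega), if_neg h1, zero_add]
    by_cases h2 : 0 ≤ L - N
    · rw [if_pos h2, mul_smul_comm, series_smul_apply, mul_X_apply]
      set j : ℕ+ := (L - N).toNat.succPNat with hj
      have hjv : ((j : ℕ) : ℤ) = L - N + 1 := by rw [hj, Nat.succPNat_coe]; omega
      have hk : ∀ k : ℕ+, N = L + 1 - (k : ℕ) ↔ j = k := fun k => by
        rw [← PNat.coe_inj]
        omega
      simp only [hk]
      rw [Finset.sum_ite_eq]
      split_ifs
      · rw [← hjv, show L + 1 - ((j : ℕ) : ℤ) = N by omega]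
        simp
      · rw [mul_zero]
    · rw [if_neg h2, mul_zero, series_zero_apply, Finset.sum_eq_zero]
      intro k _
      have := k.pos
      rw [if_neg (by omega)]

/-- As `x̂` is linear in `x`, with `∂x̂/∂x = 1`, only the Leibniz terms of order 0 and 1 survive. -/
lemma comp_xhat_apply (t₀ : ℂ) (P : PDO) (L : ℤ) (d : ℕ+ →₀ ℕ) :
    comp P (xhat t₀) L d = t₀ * P (L + 1) d + (L + 1) * P (L + 1) d +
      ∑ k ∈ d.support, ((k : ℕ) : ℂ) * P (L + 1 - k) (d - Finsupp.single k 1) := by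
  classical
  have hs : ∀ (q : ℤ × ℕ) (c : ℂ), (Function.support fun p => if p = q then c else 0).Finite :=
    fun q c => (Set.finite_singleton q).subset fun p hp => by
      by_contra h
      exact hp (if_neg h)
  have hsum : ∀ (q : ℤ × ℕ) (c : ℂ), ∑ᶠ p, (if p = q then c else 0) = c := fun q c => by
    rw [finsum_eq_single _ q fun p hp => if_neg hp, if_pos rfl]
  have key : ∀ p : ℤ × ℕ, MvPowerSeries.coeff d
      (Ring.choose p.1 p.2 • (P p.1 * dx^[p.2] (xhat t₀ (L - p.1 + p.2)))) =
      ((if p = (L + 1, 0) then t₀ * P (L + 1) d else 0) +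
        (if p = (L + 1, 1) then (L + 1) * P (L + 1) d else 0)) +
      ∑ k ∈ d.support, if p = (L + 1 - k, 0) then
        ((k : ℕ) : ℂ) * P (L + 1 - k) (d - Finsupp.single k 1) else 0 := by
    rintro ⟨N, _ | _ | k⟩
    · simp only [Ring.choose_zero_right, Function.iterate_zero, id, Nat.cast_zero, add_zero,
        one_smul, Prod.mk.injEq, and_true, zero_ne_one, and_false, if_false]
      exact mul_xhat_apply t₀ P L N d
    · simp only [zero_add, Function.iterate_one, dx_xhat, Ring.choose_one_right, Prod.mk.injEq,
        one_ne_zero, and_false, if_false, and_true, Finset.sum_const_zero, add_zero, Nat.cast_one]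
      by_cases h : N = L + 1
      · subst h
        rw [if_pos (by ring), if_pos rfl, mul_one, ← Int.cast_smul_eq_zsmul ℂ, coeff_apply,
          series_smul_apply]
        simp
      · rw [if_neg (by omega), if_neg h]
        simp
    · rw [dx_iterate_xhat]
      simp
  change ∑ᶠ p : ℤ × ℕ, MvPowerSeries.coeff d
      (Ring.choose p.1 p.2 • (P p.1 * dx^[p.2] (xhat t₀ (L - p.1 + p.2)))) = _
  rw [finsum_congr key, finsum_add_distrib, finsum_add_distrib (hs _ _) (hs _ _), hsum, hsum,
    finsum_sum_comm _ _ fun k _ => hs _ _]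
  · simp only [hsum]
  · exact ((hs _ _).union (hs _ _)).subset (Function.support_add _ _)
  · refine (Set.Finite.biUnion d.support.finite_toSet fun k _ => hs (L + 1 - k, 0)
      (((k : ℕ) : ℂ) * P (L + 1 - k) (d - Finsupp.single k 1))).subset fun p hp => ?_
    obtain ⟨k, hk, hne⟩ := Finset.exists_ne_zero_of_sum_ne_zero hp
    exact Set.mem_biUnion hk hne

lemma twist_mulXhat (t₀ : ℂ) (P : PDO) (M : ℤ) :
    twist (mulXhat t₀ P) M = (M + 1 + t₀) • twist P (M + 1) + euler (twist P (M + 1)) +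
      eulerForm * twist P (M + 1) := by
  funext d
  rw [twist, mulXhat, comp_xhat_apply, series_add_apply, series_add_apply, series_smul_apply, euler,
    eulerForm_mul_apply]
  have h1 : twist P (M + 1) d = P (M + weight d + 1) d := by
    rw [twist]; congr 1; ring
  have h2 : ∀ k ∈ d.support, ((k : ℕ) : ℂ) * P (M + weight d + 1 - (k : ℕ)) (d - Finsupp.single k 1) =
      ((k : ℕ) : ℂ) * twist P (M + 1) (d - Finsupp.single k 1) := fun k hk => by
    have hle : Finsupp.single k 1 ≤ d := by
      rw [Finsupp.single_le_iff]
      exact Nat.one_le_iff_ne_zero.mpr (Finsupp.mem_support_iff.mp hk)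
    have hw := weight_add (d - Finsupp.single k 1) (Finsupp.single k 1)
    rw [tsub_add_cancel_of_le hle, weight_single] at hw
    rw [twist, hw]
    congr 2
    push_cast
    ring
  rw [Finset.sum_congr rfl h2, h1]
  push_cast
  ring

/-- For rescaled series `∂_λ` is a shift combined with a scalar and the Euler operator. The term
`eulerForm` in `twist_mulXhat` is what the Euler operator produces on the exponential factor. -/
lemma act_mulXhat (t₀ : ℂ) (P : PDO) (N : ℤ) :
    act (mulXhat t₀ P) N = (N + 1 + t₀) • act P (N + 1) := by
  suffices h : act (mulXhat t₀ P) = fun N : ℤ => ((N : ℂ) + 1 + t₀) • act P (N + 1) by rw [h]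
  apply twist_injective
  funext M
  have h1 : twist (fun N : ℤ => ((N : ℂ) + 1 + t₀) • act P (N + 1)) M =
      (M + 1 + t₀) • twist (act P) (M + 1) + euler (twist (act P) (M + 1)) := by
    funext d
    rw [series_add_apply, series_smul_apply, euler, twist, series_smul_apply, twist,
      show M + 1 + (weight d : ℤ) = M + weight d + 1 by ring]
    push_cast
    ring
  rw [h1, act_eq_expMul, act_eq_expMul, twist_expMul, twist_expMul, twist_mulXhat, euler_mul,
    euler_expSum, add_mul, add_mul, smul_mul_assoc]
  ring

/-! ### The matrices of the flows -/

lemma LamPow_eq (m : ℤ) :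
    LamPow m = fun i k : ℤ => if k = i + m then (1 : ℂ) else 0 := by
  cases m with
  | ofNat r => exact jpow_Lam r
  | negSucc r =>
    have h : ∀ r : ℕ, jpow LamInv r = fun i k : ℤ => if k = i - (r : ℤ) then (1 : ℂ) else 0 := by
      intro r
      induction r with
      | zero =>
        funext i j
        simp [jpow, Matrix.one_apply, eq_comm]
      | succ r ih =>
        funext i k
        rw [jpow, ih]
        unfold jmul
        rw [finsum_eq_single _ (i - r) fun x hx => by simp [hx]]
        simp [LamInv, sub_sub]
    rw [LamPow, h]
    funext i k
    rw [Int.negSucc_eq]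
    push_cast
    rfl

/-- The matrix `Γ^n` and the operator `x̂^n` represent the same power of `∂_λ`. -/
lemma exists_GamPow_eq (t₀ : ℂ) (n : ℤ) : ∃ c : ℤ → ℂ,
    (GamPow t₀ n = fun i k : ℤ => if k = i - n then c i else 0) ∧
    ∀ P N, act (mulXhatPow t₀ n P) N = c (N + n) • act P (N + n) := by
  cases n with
  | ofNat r =>
    simp only [GamPow, mulXhatPow, Int.ofNat_eq_natCast]
    induction r with
    | zero =>
      refine ⟨fun _ => 1, ?_, fun P N => by simp⟩
      funext i j
      simp [jpow, Matrix.one_apply, eq_comm]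
    | succ r ih =>
      obtain ⟨c, hc, hP⟩ := ih
      -- After `r` derivatives `λ^{i+t₀}` has exponent `i - r + t₀`, the factor produced by the next
      -- one.
      refine ⟨fun i => c i * ((i - r : ℤ) + t₀), ?_, fun P N => ?_⟩
      · funext i k
        rw [jpow, hc]
        unfold jmul
        rw [finsum_eq_single _ (i - r) fun x hx => by simp [hx]]
        simp [Gam, sub_sub]
      · rw [Function.iterate_succ_apply', act_mulXhat, hP, smul_smul]
        rw [show N + 1 + (r : ℤ) = N + ((r + 1 : ℕ) : ℤ) by push_cast; ring]
        congr 1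
        push_cast
        ring
  | negSucc r =>
    simp only [GamPow, mulXhatPow]
    have h : ∀ r : ℕ, ∃ c : ℤ → ℂ,
        (jpow (GamInv t₀) r = fun i k : ℤ => if k = i + r then c i else 0) ∧
        ∀ P N, act ((divXhat t₀)^[r] P) N = c (N - r) • act P (N - r) := by
      intro r
      induction r with
      | zero =>
        refine ⟨fun _ => 1, ?_, fun P N => by simp⟩
        funext i j
        simp [jpow, Matrix.one_apply, eq_comm]
      | succ r ih =>
        obtain ⟨c, hc, hP⟩ := ih
        -- The next integration divides by the new exponent `i + r + 1 + t₀`.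
        refine ⟨fun i => c i * ((i + r + 1 : ℤ) + t₀)⁻¹, ?_, fun P N => ?_⟩
        · funext i k
          rw [jpow, hc]
          unfold jmul
          rw [finsum_eq_single _ (i + r) fun x hx => by simp [hx]]
          by_cases hk : k = i + r + 1
          · simp [GamInv, hk, add_assoc]
          · simp [GamInv, hk, ← add_assoc]
        · rw [Function.iterate_succ_apply', act_divXhat, lamInt, hP, smul_smul]
          rw [show N - 1 - (r : ℤ) = N - ((r + 1 : ℕ) : ℤ) by push_cast; ring]
          congr 1
          push_cast
          ring
    obtain ⟨c, hc, hP⟩ := h (r + 1)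
    refine ⟨c, ?_, fun P N => ?_⟩
    · rw [hc]
      funext i k
      simp only [show i - Int.negSucc r = i + ((r + 1 : ℕ) : ℤ) by omega]
    · rw [hP, show N + Int.negSucc r = N - ((r + 1 : ℕ) : ℤ) by omega]

/-- The matrix of the flow is the matrix of the action of `x̂^n ∂^m` on exponentials. -/
lemma exists_flowMatrix_eq (t₀ : ℂ) (m n : ℤ) : ∃ c : ℤ → ℂ,
    (flowMatrix t₀ m n = fun i k : ℤ => if k = i + (m - n) then c i else 0) ∧
    ∀ P N, act (mulPartial m (mulXhatPow t₀ n P)) N = c (N - (m - n)) • act P (N - (m - n)) := by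
  obtain ⟨c, hc, hP⟩ := exists_GamPow_eq t₀ n
  refine ⟨c, ?_, fun P N => ?_⟩
  · funext i k
    rw [flowMatrix, hc, LamPow_eq]
    unfold jmul
    rw [finsum_eq_single _ (i - n) fun x hx => by simp [hx]]
    by_cases hk : k = i + (m - n)
    · simp [show k = i - n + m by omega, show i - n + m = i + (m - n) by ring]
    · simp [hk, show k ≠ i - n + m by omega]
  · rw [act_mulPartial, hP, show N - m + n = N - (m - n) by ring]

/-! ### Coefficients of products of operators -/

lemma TwistBounded.mul_apply_eq_zero {c : ℤ} {A : ℤ → TimeSeries} (hA : TwistBounded c A)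
    {N : ℤ} {d : ℕ+ →₀ ℕ} (h : c + weight d < N) (g : TimeSeries) : (A N * g) d = 0 := by
  rw [series_mul_apply]
  refine Finset.sum_eq_zero fun p hp => ?_
  rw [mem_antidiagonal] at hp
  rw [apply_eq_twist A, hA, series_zero_apply, zero_mul]
  rw [← hp, weight_add] at h
  push_cast at h
  omega

lemma series_sum_apply {ι : Type*} (s : Finset ι) (f : ι → TimeSeries) (d : ℕ+ →₀ ℕ) :
    (∑ i ∈ s, f i) d = ∑ i ∈ s, f i d := map_sum (MvPowerSeries.coeff d) f s

lemma dx_zero : dx 0 = 0 := map_zero (MvPowerSeries.pderiv ℂ (1 : ℕ+))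

lemma dx_zsmul (c : ℤ) (f : TimeSeries) : dx (c • f) = c • dx f := map_zsmul _ c f

lemma dx_sum {ι : Type*} (s : Finset ι) (f : ι → TimeSeries) :
    dx (∑ i ∈ s, f i) = ∑ i ∈ s, dx (f i) := map_sum _ f s

lemma dx_mul (f g : TimeSeries) : dx (f * g) = dx f * g + f * dx g := by
  unfold dx
  rw [Derivation.leibniz, smul_eq_mul, smul_eq_mul]
  ring

lemma dx_iterate_zero (k : ℕ) : dx^[k] 0 = 0 := Function.iterate_fixed dx_zero k

/-- The coefficient of `∂^P` in `∂^N B`, for an operator `B` of nonpositive order. -/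
def powCompCoeff (B : PDO) (N P : ℤ) : TimeSeries :=
  ∑ k ∈ Finset.range (N - P + 1).toNat, Ring.choose N k • dx^[k] (B (P - N + k))

lemma powCompCoeff_eq_sum {B : PDO} (hB : ∀ N, 0 < N → B N = 0) {N P : ℤ} {K : ℕ}
    (hK : N - P < K) :
    powCompCoeff B N P = ∑ k ∈ Finset.range K, Ring.choose N k • dx^[k] (B (P - N + k)) := by
  refine Finset.sum_subset (fun k hk => ?_) fun k _ hk => ?_
  · rw [Finset.mem_range] at hk ⊢
    omega
  · rw [Finset.mem_range] at hk
    rw [hB _ (by omega), dx_iterate_zero, smul_zero]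

/-- Pascal's rule, expressing `∂^{N+1} B = ∂ (∂^N B)`. -/
lemma powCompCoeff_succ {B : PDO} (hB : ∀ N, 0 < N → B N = 0) (N P : ℤ) :
    powCompCoeff B (N + 1) P = dx (powCompCoeff B N P) + powCompCoeff B N (P - 1) := by
  set K := (N - P + 1).toNat
  rw [powCompCoeff_eq_sum hB (show N + 1 - P < (K + 1 : ℕ) by omega),
    powCompCoeff_eq_sum hB (show N - P < K by omega),
    powCompCoeff_eq_sum hB (show N - (P - 1) < (K + 1 : ℕ) by omega),
    Finset.sum_range_succ', Finset.sum_range_succ', dx_sum, ← add_assoc, ← Finset.sum_add_distrib]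
  congr 1
  · refine Finset.sum_congr rfl fun k _ => ?_
    rw [Ring.choose_succ_succ, add_smul, dx_zsmul, ← Function.iterate_succ_apply' dx]
    push_cast
    rw [show P - (N + 1) + (k + 1) = P - N + (k : ℤ) by ring,
      show P - 1 - N + (k + 1) = P - N + (k : ℤ) by ring]
  · simp only [Ring.choose_zero_right]
    rw [show P - (N + 1) = P - 1 - N by ring]

/-- Twisted boundedness of `A` and nonpositive order of `B` leave finitely many pairs for each
monomial, so the double sum may be split. -/
lemma comp_eq_fsum {c : ℤ} {A B : PDO} (hA : TwistBounded c A) (hB : ∀ N, 0 < N → B N = 0) (P : ℤ) :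
    comp A B P = fsum fun N : ℤ => A N * powCompCoeff B N P := by
  funext d
  have hz : ∀ p : ℤ × ℕ, ¬ (p.1 ≤ c + weight d ∧ P - p.1 + p.2 ≤ 0) →
      (Ring.choose p.1 p.2 • (A p.1 * dx^[p.2] (B (P - p.1 + p.2)))) d = 0 := fun p hp => by
    rw [not_and_or, not_le, not_le] at hp
    rcases hp with hp | hp
    · rw [← mul_smul_comm, hA.mul_apply_eq_zero hp]
    · rw [hB _ hp, dx_iterate_zero, mul_zero, smul_zero, series_zero_apply]
  have hfin : (Function.support fun p : ℤ × ℕ =>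
      (Ring.choose p.1 p.2 • (A p.1 * dx^[p.2] (B (P - p.1 + p.2)))) d).Finite := by
    refine (Finset.Icc P (c + weight d) ×ˢ
      Finset.range (c + weight d - P + 1).toNat).finite_toSet.subset fun p hp => ?_
    have h := not_imp_comm.mp (hz p) hp
    rw [Finset.coe_product, Set.mem_prod, Finset.coe_Icc, Finset.coe_range, Set.mem_Icc, Set.mem_Iio]
    omega
  change ∑ᶠ p : ℤ × ℕ, (Ring.choose p.1 p.2 • (A p.1 * dx^[p.2] (B (P - p.1 + p.2)))) d =
    ∑ᶠ N : ℤ, (A N * powCompCoeff B N P) d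
  rw [finsum_curry _ hfin]
  refine finsum_congr fun N => ?_
  rw [powCompCoeff, Finset.mul_sum, series_sum_apply]
  simp only [mul_smul_comm]
  refine finsum_eq_sum_of_support_subset _ fun k hk => ?_
  have h := not_imp_comm.mp (hz (N, k)) hk
  rw [Finset.coe_range, Set.mem_Iio]
  simp only at h
  omega

/-! ### The residue pairing -/

/-- The operator `∂_x - λ` on formal series in `λ`. -/
def dxSubShift (s : ℤ → TimeSeries) : ℤ → TimeSeries := fun N => dx (s N) - s (N - 1)

lemma TwistBounded.dxSubShift {c : ℤ} {s : ℤ → TimeSeries} (h : TwistBounded c s) :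
    TwistBounded (c + 1) (dxSubShift s) := fun N hN => by
  have h1 : twist (KP.dxSubShift s) N = dx (twist s (N - 1)) - twist s (N - 1) := by
    funext d
    have h2 := congrFun (pderiv_twist 1 s (N - 1)) d
    rw [series_sub_apply, dx, h2]
    simp only [twist, KP.dxSubShift, series_sub_apply, PNat.one_coe, Nat.cast_one, sub_add_cancel]
    rw [show N + (weight d : ℤ) - 1 = N - 1 + weight d by ring]
    rfl
  rw [h1, h _ (by omega), dx_zero, sub_zero]

lemma TwistBounded.dxSubShift_iterate {c : ℤ} {s : ℤ → TimeSeries} (h : TwistBounded c s) (k : ℕ) :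
    TwistBounded (c + k) (KP.dxSubShift^[k] s) := by
  induction k with
  | zero => simpa using h
  | succ k ih =>
    rw [Function.iterate_succ_apply']
    push_cast
    rw [← add_assoc]
    exact ih.dxSubShift

/-- `∂_x` of `e^{-ζ} s` equals `e^{-ζ} (∂_x - λ) s`. -/
lemma dx_unact (s : ℤ → TimeSeries) (N : ℤ) : dx (unact s N) = unact (dxSubShift s) N := by
  suffices h : (fun N => dx (unact s N)) = unact (dxSubShift s) from congrFun h N
  apply twist_injective
  funext N
  have h2 : ∀ f : ℤ → TimeSeries, twist (fun N => dx (f N)) N = dx (twist f (N - 1)) := fun f => by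
    have := pderiv_twist 1 f (N - 1)
    rw [PNat.one_coe, Nat.cast_one, sub_add_cancel] at this
    exact this.symm
  have h3 : twist (dxSubShift s) N = dx (twist s (N - 1)) - twist s (N - 1) := by
    rw [← h2]
    funext d
    rw [series_sub_apply, twist, twist, twist, dxSubShift, series_sub_apply,
      show N + (weight d : ℤ) - 1 = N - 1 + weight d by ring]
  have h4 : dx (expSum (-1)) = (-1 : ℂ) • expSum (-1) := pderiv_expSum (-1) 1
  rw [h2, unact_eq_expMul, unact_eq_expMul, twist_expMul, twist_expMul, h3, dx_mul, h4]
  simp only [neg_smul, one_smul]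
  ring

lemma dx_iterate_unact (s : ℤ → TimeSeries) (k : ℕ) :
    (fun N => dx^[k] (unact s N)) = unact (dxSubShift^[k] s) := by
  induction k with
  | zero => rfl
  | succ k ih =>
    funext N
    rw [Function.iterate_succ_apply', congrFun ih N, dx_unact, ← Function.iterate_succ_apply' dxSubShift]

/-- Solving `powCompCoeff_succ` for the coefficient at `P - 1` descends from the residue to all
lower coefficients; each step contributes `-(∂_x - λ)`. -/
lemma powCompCoeff_neg {B : PDO} (hB : ∀ N, 0 < N → B N = 0) {s : ℤ → TimeSeries}
    (hs : ∀ N, powCompCoeff B N (-1) = s (-1 - N)) (k : ℕ) (N : ℤ) :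
    powCompCoeff B N (-(k + 1 : ℕ)) = (-1 : ℂ) ^ k • dxSubShift^[k] s (-1 - N) := by
  induction k generalizing N with
  | zero => simpa using hs N
  | succ k ih =>
    have h := powCompCoeff_succ hB N (-(k + 1 : ℕ))
    rw [ih, ih, dx_smul] at h
    rw [show -((k + 1 + 1 : ℕ) : ℤ) = -((k + 1 : ℕ) : ℤ) - 1 by push_cast; ring,
      ← sub_eq_of_eq_add' h, Function.iterate_succ_apply', dxSubShift, pow_succ,
      show -1 - (N + 1) = -1 - N - 1 by ring]
    module

/-- The negative part of `A B` in terms of the residue pairing of `A e^ζ` with the derivatives of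
the adjoint exponential `B^* e^{-ζ}`. -/
lemma comp_neg {a b : ℤ} {A B : PDO} (hA : TwistBounded a A) (hB : ∀ N, 0 < N → B N = 0)
    {s : ℤ → TimeSeries} (hb : TwistBounded b s) (hs : ∀ N, powCompCoeff B N (-1) = s (-1 - N))
    (k : ℕ) :
    comp A B (-(k + 1 : ℕ)) =
      (-1 : ℂ) ^ k • laurentMul (act A) (fun N => dx^[k] (unact s N)) (-1) := by
  -- Once the exponentials cancel, the two sides agree term by term.
  rw [dx_iterate_unact, laurentMul_act_unact hA (hb.dxSubShift_iterate k), comp_eq_fsum hA hB]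
  funext d
  rw [series_smul_apply]
  change ∑ᶠ N : ℤ, (A N * powCompCoeff B N (-(k + 1 : ℕ))) d =
    (-1) ^ k * ∑ᶠ N : ℤ, (A N * dxSubShift^[k] s (-1 - N)) d
  rw [mul_finsum]
  refine finsum_congr fun N => ?_
  rw [powCompCoeff_neg hB hs, mul_smul_comm, series_smul_apply]

/-! ### Operators of nonpositive order -/

/-- The operator `∑_{j ≥ 0} a_j ∂^{-j}`. -/
def ofSeq (a : ℕ → TimeSeries) : PDO := fun N => if N ≤ 0 then a (-N).toNat else 0

lemma ofSeq_neg (a : ℕ → TimeSeries) (j : ℕ) : ofSeq a (-(j : ℤ)) = a j := by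
  simp [ofSeq]

lemma ofSeq_pos (a : ℕ → TimeSeries) {N : ℤ} (h : 0 < N) : ofSeq a N = 0 := if_neg h.not_ge

lemma twistBounded_ofSeq (a : ℕ → TimeSeries) : TwistBounded 0 (ofSeq a) := fun N hN => by
  funext d
  rw [twist, ofSeq_pos a (by omega)]

/-- The coefficients of the product of two operators of nonpositive order. -/
def seqMul (a b : ℕ → TimeSeries) (q : ℕ) : TimeSeries :=
  ∑ p ∈ antidiagonal q, a p.1 * ∑ r ∈ antidiagonal p.2,
    Ring.choose (-(p.1 : ℤ)) r.1 • dx^[r.1] (b r.2)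

lemma powCompCoeff_ofSeq (b : ℕ → TimeSeries) (i r : ℕ) :
    powCompCoeff (ofSeq b) (-(i : ℤ)) (-(i + r : ℕ)) =
      ∑ p ∈ antidiagonal r, Ring.choose (-(i : ℤ)) p.1 • dx^[p.1] (b p.2) := by
  rw [powCompCoeff_eq_sum (fun N hN => ofSeq_pos b hN)
      (show -(i : ℤ) - -((i + r : ℕ) : ℤ) < (r + 1 : ℕ) by push_cast; omega),
    Finset.Nat.sum_antidiagonal_eq_sum_range_succ_mk]
  refine Finset.sum_congr rfl fun k hk => ?_
  rw [Finset.mem_range] at hk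
  rw [show -((i + r : ℕ) : ℤ) - -(i : ℤ) + k = -((r - k : ℕ) : ℤ) by omega, ofSeq_neg]

lemma powCompCoeff_ofSeq_of_lt (b : ℕ → TimeSeries) {N P : ℤ} (h : N < P) :
    powCompCoeff (ofSeq b) N P = 0 := by
  rw [powCompCoeff, show (N - P + 1).toNat = 0 by omega, Finset.sum_range_zero]

lemma comp_ofSeq (a b : ℕ → TimeSeries) : comp (ofSeq a) (ofSeq b) = ofSeq (seqMul a b) := by
  funext P
  rw [comp_eq_fsum (twistBounded_ofSeq a) (fun N hN => ofSeq_pos b hN)]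
  funext d
  change ∑ᶠ N : ℤ, (ofSeq a N * powCompCoeff (ofSeq b) N P) d = _
  rcases le_or_gt P 0 with hP | hP
  · obtain ⟨q, rfl⟩ : ∃ q : ℕ, P = -(q : ℤ) := ⟨(-P).toNat, by omega⟩
    rw [ofSeq_neg, seqMul, series_sum_apply, finsum_eq_sum_of_support_subset
      (s := (antidiagonal q).image fun p => -(p.1 : ℤ))]
    · rw [Finset.sum_image]
      · refine Finset.sum_congr rfl fun p hp => ?_
        rw [mem_antidiagonal] at hp
        rw [← hp, powCompCoeff_ofSeq, ofSeq_neg]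
      · intro p hp p' hp' h
        rw [Finset.mem_coe, mem_antidiagonal] at hp hp'
        exact Prod.ext (by simpa using h) (by simp at h; omega)
    · intro N hN
      rw [Finset.coe_image]
      by_contra hc
      refine hN ?_
      simp only
      rcases lt_or_ge 0 N with h0 | h0
      · rw [ofSeq_pos a h0, zero_mul, series_zero_apply]
      · rw [powCompCoeff_ofSeq_of_lt, mul_zero, series_zero_apply]
        by_contra h1
        refine hc ⟨((-N).toNat, q - (-N).toNat), ?_, ?_⟩
        · rw [Finset.mem_coe, mem_antidiagonal]
          omega
        · simp only
          omega
  · rw [ofSeq_pos _ hP, series_zero_apply]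
    refine finsum_eq_zero_of_forall_eq_zero fun N => ?_
    rcases lt_or_ge 0 N with h0 | h0
    · rw [ofSeq_pos a h0, zero_mul, series_zero_apply]
    · rw [powCompCoeff_ofSeq_of_lt _ (by omega), mul_zero, series_zero_apply]

/-! ### Associativity of the product of operators of nonpositive order -/

lemma sum_antidiagonal_assoc {M : Type*} [AddCommMonoid M] (n : ℕ) (f : ℕ → ℕ → ℕ → M) :
    ∑ p ∈ antidiagonal n, ∑ q ∈ antidiagonal p.1, f q.1 q.2 p.2 =
      ∑ p ∈ antidiagonal n, ∑ q ∈ antidiagonal p.2, f p.1 q.1 q.2 := by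
  rw [Finset.sum_sigma', Finset.sum_sigma']
  refine Finset.sum_nbij' (fun x => ⟨(x.2.1, x.2.2 + x.1.2), (x.2.2, x.1.2)⟩)
    (fun x => ⟨(x.1.1 + x.2.1, x.2.2), (x.1.1, x.2.1)⟩) ?_ ?_ ?_ ?_ ?_
  all_goals
    rintro ⟨⟨a, b⟩, ⟨c, d⟩⟩ h
    simp only [Finset.mem_sigma, mem_antidiagonal] at h ⊢
  · exact ⟨by omega, trivial⟩
  · exact ⟨by omega, trivial⟩
  · obtain ⟨h1, h2⟩ := h
    subst h2
    rfl
  · obtain ⟨h1, h2⟩ := h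
    subst h2
    rfl

lemma sum_antidiagonal_swap {M : Type*} [AddCommMonoid M] (n : ℕ) (f : ℕ → ℕ → ℕ → M) :
    ∑ p ∈ antidiagonal n, ∑ q ∈ antidiagonal p.2, f p.1 q.1 q.2 =
      ∑ p ∈ antidiagonal n, ∑ q ∈ antidiagonal p.2, f q.1 p.1 q.2 := by
  rw [← sum_antidiagonal_assoc, ← sum_antidiagonal_assoc n fun a b c => f b a c]
  refine Finset.sum_congr rfl fun p _ => ?_
  exact (Finset.Nat.sum_antidiagonal_swap (n := p.1) (f := fun q => f q.1 q.2 p.2)).symm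

lemma dx_iterate_zsmul (k : ℕ) (c : ℤ) (f : TimeSeries) : dx^[k] (c • f) = c • dx^[k] f :=
  (Function.Commute.iterate_left (f := dx) (g := fun f => c • f) (dx_zsmul c) k) f

lemma dx_iterate_sum {ι : Type*} (k : ℕ) (s : Finset ι) (f : ι → TimeSeries) :
    dx^[k] (∑ i ∈ s, f i) = ∑ i ∈ s, dx^[k] (f i) := by
  induction k with
  | zero => rfl
  | succ k ih =>
    simp only [Function.iterate_succ_apply', ih, dx_sum]

lemma dx_iterate_mul (n : ℕ) (f g : TimeSeries) :
    dx^[n] (f * g) = ∑ p ∈ antidiagonal n, n.choose p.1 • (dx^[p.1] f * dx^[p.2] g) := by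
  induction n with
  | zero => simp
  | succ n ih =>
    rw [Finset.sum_antidiagonal_choose_succ_nsmul (fun i j => dx^[i] f * dx^[j] g),
      Function.iterate_succ_apply', ih, dx_sum, ← Finset.sum_add_distrib]
    refine Finset.sum_congr rfl fun p hp => ?_
    rw [mem_antidiagonal] at hp
    have hch : n.choose p.2 = n.choose p.1 := by
      rw [← hp]; exact (Nat.choose_symm_add).symm
    rw [hch, Function.iterate_succ_apply', Function.iterate_succ_apply', ← natCast_zsmul, dx_zsmul,
      dx_mul, smul_add, add_comm]
    simp only [natCast_zsmul]

/-- The coefficients of `∂^N b`, for `b = ∑_r b_r ∂^{-r}`: the coefficient of `∂^{N-r}`. -/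
def powMul (N : ℤ) (b : ℕ → TimeSeries) (r : ℕ) : TimeSeries :=
  ∑ p ∈ antidiagonal r, Ring.choose N p.1 • dx^[p.1] (b p.2)

/-- Vandermonde's identity, expressing `∂^M ∂^N = ∂^{M+N}` for integer exponents. -/
lemma powMul_powMul (M N : ℤ) (c : ℕ → TimeSeries) : powMul M (powMul N c) = powMul (M + N) c := by
  funext r
  have h1 : powMul M (powMul N c) r = ∑ p ∈ antidiagonal r, ∑ q ∈ antidiagonal p.2,
      (Ring.choose M p.1 * Ring.choose N q.1) • dx^[p.1 + q.1] (c q.2) := by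
    refine Finset.sum_congr rfl fun p _ => ?_
    rw [powMul, dx_iterate_sum, Finset.smul_sum]
    refine Finset.sum_congr rfl fun q _ => ?_
    rw [dx_iterate_zsmul, smul_smul, Function.iterate_add_apply]
  rw [h1, ← sum_antidiagonal_assoc r
    fun k l s => (Ring.choose M k * Ring.choose N l) • dx^[k + l] (c s)]
  refine Finset.sum_congr rfl fun p _ => ?_
  rw [Ring.add_choose_eq _ (Commute.all M N), Finset.sum_smul]
  refine Finset.sum_congr rfl fun q hq => ?_
  rw [mem_antidiagonal.mp hq]

/-- The Leibniz rule for `∂^N f`, obtained by regrouping a product of binomial coefficients. -/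
lemma powMul_mul (N : ℤ) (f : TimeSeries) (y : ℕ → TimeSeries) (r : ℕ) :
    powMul N (fun s => f * y s) r =
      ∑ p ∈ antidiagonal r, Ring.choose N p.1 • (dx^[p.1] f * powMul (N - p.1) y p.2) := by
  have h1 : powMul N (fun s => f * y s) r = ∑ p ∈ antidiagonal r, ∑ q ∈ antidiagonal p.1,
      (Ring.choose N q.1 * Ring.choose (N - q.1) q.2) • (dx^[q.1] f * dx^[q.2] (y p.2)) := by
    refine Finset.sum_congr rfl fun p _ => ?_
    rw [dx_iterate_mul, Finset.smul_sum]
    refine Finset.sum_congr rfl fun q hq => ?_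
    rw [mem_antidiagonal] at hq
    have h := Ring.choose_smul_choose N (show q.1 ≤ p.1 by omega)
    rw [show p.1 - q.1 = q.2 by omega, nsmul_eq_mul] at h
    rw [← h, mul_smul, natCast_zsmul, smul_comm]
  rw [h1, sum_antidiagonal_assoc r fun k l s =>
    (Ring.choose N k * Ring.choose (N - k) l) • (dx^[k] f * dx^[l] (y s))]
  refine Finset.sum_congr rfl fun p _ => ?_
  rw [powMul, Finset.mul_sum, Finset.smul_sum]
  refine Finset.sum_congr rfl fun q _ => ?_
  rw [mul_smul, mul_smul_comm]

lemma seqMul_eq (a b : ℕ → TimeSeries) (q : ℕ) :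
    seqMul a b q = ∑ p ∈ antidiagonal q, a p.1 * powMul (-(p.1 : ℤ)) b p.2 := rfl

lemma powMul_seqMul (N : ℤ) (b c : ℕ → TimeSeries) (r : ℕ) :
    powMul N (seqMul b c) r = ∑ p ∈ antidiagonal r, ∑ q ∈ antidiagonal p.2,
      Ring.choose N p.1 • (dx^[p.1] (b q.1) * powMul (N - p.1 - q.1) c q.2) := by
  have h1 : powMul N (seqMul b c) r = ∑ p ∈ antidiagonal r, ∑ q ∈ antidiagonal p.2,
      Ring.choose N p.1 • dx^[p.1] (b q.1 * powMul (-(q.1 : ℤ)) c q.2) := by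
    refine Finset.sum_congr rfl fun p _ => ?_
    rw [seqMul_eq, dx_iterate_sum, Finset.smul_sum]
  rw [h1, sum_antidiagonal_swap r fun k j s =>
    Ring.choose N k • dx^[k] (b j * powMul (-(j : ℤ)) c s),
    sum_antidiagonal_swap r fun k j s =>
      Ring.choose N k • (dx^[k] (b j) * powMul (N - k - j) c s)]
  refine Finset.sum_congr rfl fun p _ => ?_
  have h2 := powMul_mul N (b p.1) (powMul (-(p.1 : ℤ)) c) p.2
  refine h2.trans (Finset.sum_congr rfl fun q _ => ?_)
  rw [powMul_powMul, ← sub_eq_add_neg]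

/-- Both sides expand to sums of `a_i ∂^k(b_j)` times a power of `∂` applied to `c`; the rules for
`powMul` reduce the claim to regrouping antidiagonals. -/
lemma seqMul_assoc (a b c : ℕ → TimeSeries) : seqMul (seqMul a b) c = seqMul a (seqMul b c) := by
  funext q
  have h1 : seqMul (seqMul a b) c q = ∑ p ∈ antidiagonal q, ∑ u ∈ antidiagonal p.1,
      ∑ w ∈ antidiagonal u.2, a u.1 * Ring.choose (-(u.1 : ℤ)) w.1 • (dx^[w.1] (b w.2) *
        powMul (-(u.1 : ℤ) - w.1 - w.2) c p.2) := by
    refine Finset.sum_congr rfl fun p _ => ?_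
    change seqMul a b p.1 * powMul (-(p.1 : ℤ)) c p.2 = _
    rw [seqMul, Finset.sum_mul]
    refine Finset.sum_congr rfl fun u hu => ?_
    rw [Finset.mul_sum, Finset.sum_mul]
    refine Finset.sum_congr rfl fun w hw => ?_
    rw [mem_antidiagonal] at hu hw
    rw [show -(p.1 : ℤ) = -(u.1 : ℤ) - w.1 - w.2 by omega]
    rw [mul_assoc, smul_mul_assoc]
  have h2 := sum_antidiagonal_assoc q fun i s r => ∑ w ∈ antidiagonal s,
    a i * Ring.choose (-(i : ℤ)) w.1 • (dx^[w.1] (b w.2) * powMul (-(i : ℤ) - w.1 - w.2) c r)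
  rw [h1, h2, seqMul_eq]
  refine Finset.sum_congr rfl fun p _ => ?_
  have h3 := sum_antidiagonal_assoc p.2 fun k j r => a p.1 * Ring.choose (-(p.1 : ℤ)) k •
    (dx^[k] (b j) * powMul (-(p.1 : ℤ) - k - j) c r)
  rw [h3, powMul_seqMul, Finset.mul_sum]
  simp only [Finset.mul_sum]

/-- The coefficients of the identity operator. -/
def seqOne : ℕ → TimeSeries := fun q => if q = 0 then 1 else 0

lemma powMul_seqOne (N : ℤ) (r : ℕ) : powMul N seqOne r = seqOne r := by
  have h : ∀ k, dx^[k + 1] (1 : TimeSeries) = 0 := fun k => by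
    rw [Function.iterate_succ_apply, show dx 1 = 0 from MvPowerSeries.pderiv_one, dx_iterate_zero]
  rw [powMul, Finset.sum_eq_single (0, r)]
  · simp
  · rintro ⟨k, s⟩ hp hne
    rw [mem_antidiagonal] at hp
    simp only [seqOne] at hp ⊢
    rcases k with _ | k
    · exact absurd (by simp at hp; simp [hp]) hne
    · split_ifs
      · rw [h, smul_zero]
      · rw [dx_iterate_zero, smul_zero]
  · intro hn
    simp at hn

lemma powMul_zero (b : ℕ → TimeSeries) (r : ℕ) : powMul 0 b r = b r := by
  rw [powMul, Finset.sum_eq_single (0, r)]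
  · simp
  · rintro ⟨k, s⟩ hp hne
    rw [mem_antidiagonal] at hp
    rcases k with _ | k
    · exact absurd (by simp at hp; simp [hp]) hne
    · rw [Ring.choose_zero_succ, zero_smul]
  · intro hn
    simp at hn

lemma seqMul_seqOne (a : ℕ → TimeSeries) : seqMul a seqOne = a := by
  funext q
  rw [seqMul_eq, Finset.sum_eq_single (q, 0)]
  · rw [powMul_seqOne]
    simp [seqOne]
  · rintro ⟨i, r⟩ hp hne
    rw [mem_antidiagonal] at hp
    rw [powMul_seqOne, seqOne, if_neg, mul_zero]
    rintro h
    simp only at h hp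
    exact hne (by rw [h] at hp ⊢; simpa using hp)
  · intro hn
    simp at hn

/-- An operator of order zero acts by left multiplication. -/
lemma seqMul_single_zero (f : TimeSeries) (b : ℕ → TimeSeries) :
    seqMul (fun q => if q = 0 then f else 0) b = fun q => f * b q := by
  funext q
  rw [seqMul_eq, Finset.sum_eq_single (0, q)]
  · simp [powMul_zero]
  · rintro ⟨i, r⟩ hp hne
    rw [mem_antidiagonal] at hp
    simp only
    rw [if_neg, zero_mul]
    rintro h
    simp only at h hp
    exact hne (by rw [h] at hp ⊢; simpa using hp)
  · intro hn
    simp at hn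

lemma seqOne_seqMul (b : ℕ → TimeSeries) : seqMul seqOne b = b :=
  (seqMul_single_zero 1 b).trans (by simp)

lemma seqMul_add_left (a a' b : ℕ → TimeSeries) (q : ℕ) :
    seqMul (fun i => a i + a' i) b q = seqMul a b q + seqMul a' b q := by
  simp only [seqMul_eq, add_mul, Finset.sum_add_distrib]

lemma Dressing.invCoeff_seqMul_coeff (K : Dressing) : seqMul K.invCoeff K.coeff = seqOne := by
  funext q
  rcases q with _ | q
  · simp [seqMul, Dressing.invCoeff, Dressing.coeff, seqOne]
  · rw [seqMul, Finset.Nat.sum_antidiagonal_eq_sum_range_succ_mk, Finset.sum_range_succ]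
    simp only [Finset.Nat.sum_antidiagonal_eq_sum_range_succ_mk, Nat.sub_self,
      Finset.sum_range_one, Ring.choose_zero_right, one_smul, Function.iterate_zero, id]
    rw [Dressing.invCoeff, Dressing.coeff, mul_one, ← sub_eq_add_neg, seqOne, if_neg (by omega),
      sub_eq_zero, ← Fin.sum_univ_eq_sum_range (fun i => K.invCoeff i *
        ∑ k ∈ Finset.range (q + 1 - i).succ, Ring.choose (-(i : ℤ)) k •
          dx^[k] (K.coeff (q + 1 - i - k)))]
    refine Finset.sum_congr rfl fun i _ => ?_
    have hi := i.isLt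
    rw [Finset.mul_sum, show (q + 1 - (i : ℕ)).succ = q + 2 - i by omega]
    simp only [mul_smul_comm]

lemma Dressing.op_eq (K : Dressing) : K.op = ofSeq K.coeff := rfl

lemma Dressing.opInv_eq (K : Dressing) : K.opInv = ofSeq K.invCoeff := rfl

/-- The operator `B` with adjoint symbol `∑_{j ≥ 0} s_{-j} λ^{-j}`, that is
`B = ∑_j ∂^{-j} s_{-j}`. -/
def adjSeq (s : ℤ → TimeSeries) (r : ℕ) : TimeSeries :=
  s (-r) - ∑ k : Fin r, Ring.choose ((r : ℤ) - 1) (k + 1) • dx^[k + 1] (adjSeq s (r - (k + 1)))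
termination_by r
decreasing_by omega

/-- For `N = r - 1` the leading Leibniz term is the coefficient number `r` of the operator, and the
others involve earlier ones. The recursion for `adjSeq` solves this triangular system. -/
lemma powCompCoeff_adjSeq {s : ℤ → TimeSeries} (hs : ∀ N, 0 < N → s N = 0) (N : ℤ) :
    powCompCoeff (ofSeq (adjSeq s)) N (-1) = s (-1 - N) := by
  rcases lt_or_ge N (-1) with hN | hN
  · rw [powCompCoeff_ofSeq_of_lt _ hN, hs _ (by omega)]
  · obtain ⟨r, rfl⟩ : ∃ r : ℕ, N = r - 1 := ⟨(N + 1).toNat, by omega⟩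
    rw [powCompCoeff_eq_sum (fun N hN => ofSeq_pos _ hN)
      (show (r : ℤ) - 1 - -1 < (r + 1 : ℕ) by push_cast; omega), Finset.sum_range_succ',
      show -1 - ((r : ℤ) - 1) + (0 : ℕ) = -(r : ℤ) by push_cast; ring, ofSeq_neg,
      show -1 - ((r : ℤ) - 1) = -r by ring]
    simp only [Ring.choose_zero_right, one_smul, Function.iterate_zero, id]
    conv_lhs => rw [adjSeq]
    rw [Fin.sum_univ_eq_sum_range (fun k => Ring.choose ((r : ℤ) - 1) (k + 1) •
      dx^[k + 1] (adjSeq s (r - (k + 1)))) r, add_sub, add_comm, add_sub_assoc, add_eq_left, sub_eq_zero]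
    refine Finset.sum_congr rfl fun k hk => ?_
    rw [Finset.mem_range] at hk
    rw [show -(r : ℤ) + ((k + 1 : ℕ) : ℤ) = -((r - (k + 1) : ℕ) : ℤ) by omega, ofSeq_neg]

/-! ### Bilinear identities for generating series -/

lemma exists_evalAt_dx_hamSeries (a : Finset ℤ →₀ ℂ) (k : ℕ) (d : ℕ+ →₀ ℕ) :
    ∃ b : Finset ℤ →₀ ℂ, ∀ u, (dx^[k] (hamSeries (evalAt a) u)) d = evalAt b u := by
  induction k with
  | zero =>
    obtain ⟨b, hb⟩ := evalAt_hamMonomial d a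
    exact ⟨(dfact d)⁻¹ • b, fun u => by rw [evalAt_smul, ← hb]; rfl⟩
  | succ k ih =>
    obtain ⟨b, hb⟩ := ih
    obtain ⟨c, hc⟩ := evalAt_H 1 b
    refine ⟨c, fun u => ?_⟩
    rw [Function.iterate_succ_apply, dx, pderiv_hamSeries, hb, hc]

/-- Each Taylor coefficient of the product is a finite sum of pairs of finite functionals, to which
the componentwise bilinear identity applies. -/
lemma finsum_hamSeries_mul_eq_zero {f g : ℤ → Fock}
    (hfin : ∀ D E, (Function.support fun i => f i D * g i E).Finite)
    (h0 : ∀ D E, ∑ᶠ i, f i D * g i E = 0) (a b : Finset ℤ →₀ ℂ) (k : ℕ) (d : ℕ+ →₀ ℕ) :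
    ∑ᶠ i, (hamSeries (evalAt a) (f i) * dx^[k] (hamSeries (evalAt b) (g i))) d = 0 := by
  choose α hα using exists_evalAt_dx_hamSeries a 0
  choose β hβ using exists_evalAt_dx_hamSeries b k
  have h : ∀ i, (hamSeries (evalAt a) (f i) * dx^[k] (hamSeries (evalAt b) (g i))) d =
      ∑ p ∈ antidiagonal d, evalAt (α p.1) (f i) * evalAt (β p.2) (g i) := fun i => by
    rw [series_mul_apply]
    refine Finset.sum_congr rfl fun p _ => ?_
    rw [← hα, ← hβ]
    rfl
  rw [finsum_congr h, finsum_sum_comm]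
  · refine Finset.sum_eq_zero fun p _ => ?_
    rw [(evalAt_pair hfin _ _).2]
    simp [h0]
  · exact fun p _ => (evalAt_pair hfin _ _).1

/-- With the dual field indexed by `-N - 1`, the bilinear sum is exactly the coefficient of
`λ^{-1}`. -/
lemma laurentMul_hamSeries_eq_zero {f : ℤ → Fock} {v : Fock}
    (hfin : ∀ D E, (Function.support fun i => f i D * psiStar i v E).Finite)
    (h0 : ∀ D E, ∑ᶠ i, f i D * psiStar i v E = 0) (a b : Finset ℤ →₀ ℂ) (k : ℕ) :
    laurentMul (fun N => hamSeries (evalAt a) (f N))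
      (fun N => dx^[k] (hamSeries (evalAt b) (psiStar (-N - 1) v))) (-1) = 0 := by
  funext d
  refine Eq.trans ?_ (finsum_hamSeries_mul_eq_zero hfin h0 a b k d)
  refine finsum_congr fun i => ?_
  have hi : -(-1 - i) - 1 = i := by ring
  simp only [hi]
  rfl

/-! ### Multiplication of formal series in `λ` by a power series -/

lemma fsum_mul_left {ι : Type*} {f : ι → TimeSeries}
    (hf : ∀ d, (Function.support fun i => f i d).Finite) (h : TimeSeries) :
    fsum (fun i => h * f i) = h * fsum f := by
  funext d
  change ∑ᶠ i, (h * f i) d = _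
  simp only [series_mul_apply]
  rw [finsum_sum_comm]
  · refine Finset.sum_congr rfl fun p _ => ?_
    rw [← mul_finsum]
    rfl
  · exact fun p _ => (hf p.2).subset fun i hi => right_ne_zero_of_mul hi

lemma expMul_mul_left (ε : ℂ) (h : TimeSeries) (f : ℤ → TimeSeries) (N : ℤ) :
    expMul ε (fun N => h * f N) N = h * expMul ε f N := by
  have hf : ∀ d, (Function.support fun M => (f M * gradedExp ε (N - M)) d).Finite := fun d => by
    refine ((antidiagonal d).image fun p => N - (weight p.2 : ℤ)).finite_toSet.subset fun M hM => ?_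
    rw [Function.mem_support, series_mul_apply] at hM
    obtain ⟨p, hp, hp0⟩ := Finset.exists_ne_zero_of_sum_ne_zero hM
    rw [Finset.coe_image]
    refine ⟨p, hp, ?_⟩
    have h1 := right_ne_zero_of_mul hp0
    rw [gradedExp, ne_eq, ite_eq_right_iff, not_forall] at h1
    obtain ⟨h1, _⟩ := h1
    simp only
    omega
  unfold expMul
  simp only [mul_assoc]
  exact fsum_mul_left hf h

lemma act_mul_left (h : TimeSeries) (f : ℤ → TimeSeries) :
    act (fun N => h * f N) = fun N => h * act f N := by
  rw [act_eq_expMul, act_eq_expMul]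
  exact funext (expMul_mul_left 1 h f)

lemma unact_mul_left (h : TimeSeries) (f : ℤ → TimeSeries) :
    unact (fun N => h * f N) = fun N => h * unact f N := by
  rw [unact_eq_expMul, unact_eq_expMul]
  exact funext (expMul_mul_left (-1) h f)

lemma laurentMul_support_finite {a b : ℤ} {f g : ℤ → TimeSeries} (hf : TwistBounded a f)
    (hg : TwistBounded b g) (M : ℤ) (d : ℕ+ →₀ ℕ) :
    (Function.support fun i => (f i * g (M - i)) d).Finite := by
  refine (Finset.Icc (M - b - weight d) (a + weight d)).finite_toSet.subset fun i hi => ?_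
  rw [Finset.coe_Icc, Set.mem_Icc]
  by_contra hc
  rw [not_and_or, not_le, not_le] at hc
  refine hi ?_
  simp only
  rcases hc with hc | hc
  · rw [mul_comm, hg.mul_apply_eq_zero (by omega)]
  · rw [hf.mul_apply_eq_zero hc]

lemma laurentMul_mul_left {a b : ℤ} {f g : ℤ → TimeSeries} (hf : TwistBounded a f)
    (hg : TwistBounded b g) (h : TimeSeries) (M : ℤ) :
    laurentMul (fun N => h * f N) g M = h * laurentMul f g M := by
  unfold laurentMul
  simp only [mul_assoc]
  exact fsum_mul_left (laurentMul_support_finite hf hg M) h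

lemma laurentMul_add_left {a b : ℤ} {f f' g : ℤ → TimeSeries} (hf : TwistBounded a f)
    (hf' : TwistBounded a f') (hg : TwistBounded b g) (M : ℤ) :
    laurentMul (fun N => f N + f' N) g M = laurentMul f g M + laurentMul f' g M := by
  funext d
  rw [series_add_apply]
  refine Eq.trans (finsum_congr fun i => ?_) (finsum_add_distrib
    (laurentMul_support_finite hf hg M d) (laurentMul_support_finite hf' hg M d))
  simp only [add_mul]
  rfl

lemma TwistBounded.mono {a b : ℤ} {f : ℤ → TimeSeries} (h : TwistBounded a f) (hab : a ≤ b) :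
    TwistBounded b f := fun N hN => h N (by omega)

lemma TwistBounded.mul_left {a : ℤ} {f : ℤ → TimeSeries} (hf : TwistBounded a f) (h : TimeSeries) :
    TwistBounded a fun N => h * f N := fun N hN => by
  funext d
  rw [twist, mul_comm, hf.mul_apply_eq_zero (by omega), series_zero_apply]

lemma TwistBounded.dx {b : ℤ} {g : ℤ → TimeSeries} (hg : TwistBounded b g) :
    TwistBounded (b + 1) fun N => dx (g N) := fun N hN => by
  have h := pderiv_twist 1 g (N - 1)
  rw [PNat.one_coe, Nat.cast_one, sub_add_cancel, hg _ (by omega), map_zero] at h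
  exact h.symm

lemma TwistBounded.dx_iterate {b : ℤ} {g : ℤ → TimeSeries} (hg : TwistBounded b g) (k : ℕ) :
    TwistBounded (b + k) fun N => KP.dx^[k] (g N) := by
  induction k with
  | zero => simpa using hg
  | succ k ih =>
    simp only [Function.iterate_succ_apply']
    push_cast
    rw [← add_assoc]
    exact ih.dx

/-- By Leibniz, vanishing for all `x`-derivatives survives multiplication by a series free of `λ`.
This is how `1/τ` enters the adjoint Baker–Akhiezer function. -/
lemma laurentMul_dx_iterate_mul {a b : ℤ} {f g : ℤ → TimeSeries} (hf : TwistBounded a f)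
    (hg : TwistBounded b g) {M : ℤ} (h0 : ∀ k, laurentMul f (fun N => dx^[k] (g N)) M = 0)
    (h : TimeSeries) (k : ℕ) : laurentMul f (fun N => dx^[k] (h * g N)) M = 0 := by
  funext d
  have h1 : ∀ i, (f i * dx^[k] (h * g (M - i))) d = ∑ p ∈ antidiagonal k,
      ∑ q ∈ antidiagonal d, (k.choose p.1 • dx^[p.1] h) q.1 *
        (f i * dx^[p.2] (g (M - i))) q.2 := fun i => by
    rw [dx_iterate_mul, Finset.mul_sum, series_sum_apply]
    refine Finset.sum_congr rfl fun p _ => ?_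
    rw [← series_mul_apply, mul_smul_comm, smul_mul_assoc, mul_left_comm]
  have hs : ∀ l q, (Function.support fun i => (f i * dx^[l] (g (M - i))) q).Finite := fun l q =>
    laurentMul_support_finite hf (hg.dx_iterate l) M q
  refine (finsum_congr h1).trans ?_
  rw [finsum_sum_comm]
  · refine Finset.sum_eq_zero fun p _ => ?_
    rw [finsum_sum_comm]
    · refine Finset.sum_eq_zero fun q _ => ?_
      rw [← mul_finsum]
      exact mul_eq_zero_of_right _ (congrFun (h0 p.2) q.2)
    · exact fun q _ => (hs p.2 q.2).subset fun i hi => right_ne_zero_of_mul hi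
  · refine fun p _ => (Set.Finite.biUnion (antidiagonal d).finite_toSet
      fun q _ => hs p.2 q.2).subset fun i hi => ?_
    obtain ⟨q, hq, hq0⟩ := Finset.exists_ne_zero_of_sum_ne_zero hi
    exact Set.mem_biUnion hq (right_ne_zero_of_mul hq0)

/-! ### The dressing of a tau function -/

lemma ofSeq_miwaShift_tau (u : Fock) :
    ofSeq (fun j => miwaShift j (tau u)) = fun N => hamSeries (fun w => psi N w {0}) u := by
  funext N
  rcases lt_or_ge 0 N with h | h
  · rw [ofSeq_pos _ h]
    funext d
    rw [hamSeries, psi_singleton_pos h, mul_zero, series_zero_apply]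
  · obtain ⟨j, rfl⟩ : ∃ j : ℕ, N = -(j : ℤ) := ⟨(-N).toNat, by omega⟩
    rw [ofSeq_neg, miwaShift_tau]

lemma miwaShift_zero_tau (u : Fock) : miwaShift 0 (tau u) = tau u := by
  rw [miwaShift_tau]
  simp only [Nat.cast_zero, neg_zero, psi_singleton_zero]
  rfl

/-- The fermionic form of the Baker–Akhiezer function; stated for any vector, so that it also covers
`Q_A v`. -/
lemma act_ofSeq_miwaShift (h : TimeSeries) (u : Fock) :
    act (ofSeq fun j => h * miwaShift j (tau u)) =
      fun N => h * hamSeries (evalAt chargeOne) (psi N u) := by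
  have h1 : (ofSeq fun j => h * miwaShift j (tau u)) =
      fun N => h * ofSeq (fun j => miwaShift j (tau u)) N := by
    funext N
    simp only [ofSeq]
    split_ifs
    · rfl
    · rw [mul_zero]
  rw [h1, act_mul_left, ofSeq_miwaShift_tau, ← hamSeries_psi]

lemma tau_mul_inv {v : Fock} (hv₀ : vacPair v ≠ 0) : tau v * (tau v)⁻¹ = 1 := by
  refine MvPowerSeries.mul_inv_cancel _ ?_
  change tau v 0 ≠ 0
  rwa [tau_eq_hamSeries, hamSeries_apply_zero]

lemma dressing_coeff {v : Fock} (hv₀ : vacPair v ≠ 0) :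
    (dressing (tau v)).coeff = fun j => (tau v)⁻¹ * miwaShift j (tau v) := by
  funext j
  rcases j with _ | j
  · rw [miwaShift_zero_tau, mul_comm, tau_mul_inv hv₀]
    rfl
  · rw [mul_comm]
    rfl

/-- The coefficients of the adjoint Baker–Akhiezer function of `tau v`, without its exponential
factor. -/
def adjointCoeff (v : Fock) : ℤ → TimeSeries :=
  fun N => (tau v)⁻¹ * hamSeries (fun w => psiStar (-N - 1) w {-1}) v

lemma adjointCoeff_pos (v : Fock) {N : ℤ} (hN : 0 < N) : adjointCoeff v N = 0 := by
  have h : hamSeries (fun w => psiStar (-N - 1) w {-1}) v = 0 := by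
    funext d
    rw [hamSeries, psiStar_singleton_pos hN, mul_zero, series_zero_apply]
  rw [adjointCoeff, h, mul_zero]

lemma adjointCoeff_zero {v : Fock} (hv₀ : vacPair v ≠ 0) : adjointCoeff v 0 = 1 := by
  rw [adjointCoeff]
  simp only [psiStar_singleton_zero]
  rw [mul_comm]
  exact tau_mul_inv hv₀

lemma twistBounded_of_pos {s : ℤ → TimeSeries} (hs : ∀ N, 0 < N → s N = 0) : TwistBounded 0 s :=
  fun N hN => by
    funext d
    rw [twist, hs _ (by omega)]

lemma unact_adjointCoeff (v : Fock) : unact (adjointCoeff v) =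
    fun N => (tau v)⁻¹ * hamSeries (evalAt chargeNegOne) (psiStar (-N - 1) v) := by
  unfold adjointCoeff
  rw [unact_mul_left, ← hamSeries_psiStar]

lemma twistBounded_psi (u : Fock) :
    TwistBounded 0 fun N => hamSeries (evalAt chargeOne) (psi N u) := by
  rw [hamSeries_psi, act_eq_expMul, ← ofSeq_miwaShift_tau]
  exact (twistBounded_ofSeq _).expMul 1

lemma twistBounded_psiStar (u : Fock) :
    TwistBounded 0 fun N => hamSeries (evalAt chargeNegOne) (psiStar (-N - 1) u) := by
  rw [hamSeries_psiStar, unact_eq_expMul]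
  refine (twistBounded_of_pos fun N hN => ?_).expMul (-1)
  funext d
  rw [hamSeries, psiStar_singleton_pos hN, mul_zero, series_zero_apply]

/-- The inverse of the dressing operator is the adjoint of the operator of the adjoint
Baker–Akhiezer function. -/
lemma IsGroupOrbit.invCoeff_eq {v : Fock} (hv : IsGroupOrbit v) (hv₀ : vacPair v ≠ 0) :
    (dressing (tau v)).invCoeff = adjSeq (adjointCoeff v) := by
  set K := dressing (tau v)
  set R := adjSeq (adjointCoeff v)
  have hpos : ∀ N, 0 < N → adjointCoeff v N = 0 := fun N => adjointCoeff_pos v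
  -- The candidate is shown to be a right inverse: its negative coefficients are residues that
  -- vanish by the bilinear identity.
  have key : seqMul K.coeff R = seqOne := by
    funext q
    rcases q with _ | q
    · have h0 : R 0 = 1 := by
        change adjSeq (adjointCoeff v) 0 = 1
        rw [adjSeq]
        simpa using adjointCoeff_zero hv₀
      simp [seqMul, h0, Dressing.coeff, seqOne]
    · have h1 : seqMul K.coeff R (q + 1) = comp (ofSeq K.coeff) (ofSeq R) (-(q + 1 : ℕ)) := by
        rw [comp_ofSeq, ofSeq_neg]
      rw [h1, comp_neg (twistBounded_ofSeq _) (fun N hN => ofSeq_pos _ hN)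
        (twistBounded_of_pos hpos) (powCompCoeff_adjSeq hpos), dressing_coeff hv₀,
        act_ofSeq_miwaShift, unact_adjointCoeff, laurentMul_mul_left (twistBounded_psi v)
          (((twistBounded_psiStar v).mul_left _).dx_iterate q),
        laurentMul_dx_iterate_mul (twistBounded_psi v) (twistBounded_psiStar v)
          (laurentMul_hamSeries_eq_zero (psi_mul_psiStar_support_finite v v) hv.bilin_eq_zero _ _),
        mul_zero, smul_zero]
      rfl
  -- A left inverse and a right inverse coincide, by associativity.
  rw [← seqOne_seqMul R, ← Dressing.invCoeff_seqMul_coeff K, seqMul_assoc, key, seqMul_seqOne]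

/-- The bilinear identity for the flow: the infinitesimal form of the Hirota identity, in which the
flow is transferred to the dressed exponential. -/
lemma IsGroupOrbit.laurentMul_flow_eq_zero {v : Fock} (hv : IsGroupOrbit v) (c : ℤ → ℂ) (s : ℤ)
    (a b : Finset ℤ →₀ ℂ) (k : ℕ) :
    laurentMul (fun N => hamSeries (evalAt a)
        (psi N (Q (fun i j => if j = i + s then c i else 0) v) + c (N - s) • psi (N - s) v))
      (fun N => dx^[k] (hamSeries (evalAt b) (psiStar (-N - 1) v))) (-1) = 0 := by
  set A : Matrix ℤ ℤ ℂ := fun i j => if j = i + s then c i else 0 with hA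
  have hJ : IsJacobi A := isJacobi_of_diagonal c s
  have hD : ∀ D E, (Function.support fun p : ℤ × ℤ =>
      A p.1 p.2 * psi p.1 v D * psiStar p.2 v E).Finite := jacobi_psi_psiStar_support_finite hJ v v
  -- The only nonzero diagonal of the matrix is parametrized by its column `N`.
  have hinj : Function.Injective fun N : ℤ => (N - s, N) := fun M N h => congrArg Prod.snd h
  have h2 : ∀ D E, (Function.support fun N => (c (N - s) • psi (N - s) v) D * psiStar N v E).Finite :=
    fun D E => ((hD D E).preimage hinj.injOn).subset fun N hN => by
      simpa [A] using hN
  have h1 := psi_mul_psiStar_support_finite (Q A v) v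
  refine laurentMul_hamSeries_eq_zero (fun D E => ?_) (fun D E => ?_) a b k
  · refine ((h1 D E).union (h2 D E)).subset fun N hN => ?_
    by_contra hc
    rw [Set.mem_union, not_or, Function.notMem_support, Function.notMem_support] at hc
    refine hN ?_
    simp only
    rw [Pi.add_apply, add_mul, hc.1, hc.2, add_zero]
  · simp only [Pi.add_apply, add_mul]
    rw [finsum_add_distrib (h1 D E) (h2 D E)]
    change bilin (Q A v) v D E + _ = 0
    rw [hv.bilin_Q hJ, neg_add_eq_zero]
    rw [← finsum_mem_univ, finsum_mem_inter_support_eq _ Set.univ (Set.range fun N : ℤ => (N - s, N)),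
      finsum_mem_range hinj]
    · exact finsum_congr fun N => by simp [A]
    · rw [Set.univ_inter, eq_comm, Set.inter_eq_right]
      intro p hp
      have hp1 := left_ne_zero_of_mul (left_ne_zero_of_mul hp)
      simp only [A, ne_eq, ite_eq_right_iff, not_forall] at hp1
      obtain ⟨hp1, _⟩ := hp1
      exact ⟨p.2, Prod.ext (by simp only; omega) rfl⟩

/-- The action of the flow on the dressing of a tau function. -/
lemma IsGroupOrbit.V_dressing_tau {v : Fock} (hv : IsGroupOrbit v) (hv₀ : vacPair v ≠ 0) (t₀ : ℂ)
    (m n : ℤ) (j : ℕ+) :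
    V t₀ m n (dressing (tau v)) j =
      (tau v)⁻¹ * miwaShift j (tauFlow t₀ m n v) -
        (tau v)⁻¹ * tauFlow t₀ m n v * ((tau v)⁻¹ * miwaShift j (tau v)) := by
  set K := dressing (tau v) with hK
  obtain ⟨c, hc, hact⟩ := exists_flowMatrix_eq t₀ m n
  set s := m - n with hs
  set A := flowMatrix t₀ m n with hA
  -- The operator `p` has the shifted flow as its symbol; it need not be a dressing, as its leading
  -- coefficient is `V̂τ/τ`.
  set p : ℕ → TimeSeries := fun j => (tau v)⁻¹ * miwaShift j (tauFlow t₀ m n v) with hp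
  set P := mulPartial m (mulXhatPow t₀ n K.op) with hP
  set W := seqMul p K.invCoeff with hW
  have hpos : ∀ N, 0 < N → adjointCoeff v N = 0 := fun N => adjointCoeff_pos v
  have hpact : act (ofSeq p) = fun N => (tau v)⁻¹ * hamSeries (evalAt chargeOne) (psi N (Q A v)) :=
    act_ofSeq_miwaShift _ _
  have hPact : act P = fun N =>
      (tau v)⁻¹ * (c (N - s) • hamSeries (evalAt chargeOne) (psi (N - s) v)) := by
    funext N
    rw [hact, Dressing.op_eq, dressing_coeff hv₀, act_ofSeq_miwaShift, mul_smul_comm]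
  have hb1 := twistBounded_psi (Q A v)
  have hb2 : TwistBounded s fun N => c (N - s) • hamSeries (evalAt chargeOne) (psi (N - s) v) :=
    fun N hN => by
      funext d
      have h := congrFun (twistBounded_psi v (N - s) (by omega)) d
      rw [twist, show N - s + (weight d : ℤ) = N + weight d - s by ring] at h
      rw [twist, series_smul_apply, h, series_zero_apply, mul_zero]
  have hbP : TwistBounded s P := TwistBounded.of_act (by rw [hPact]; exact hb2.mul_left _)
  -- The residue identity for `p + K x̂^n ∂^m` gives `(K x̂^n ∂^m K⁻¹)_- = -(p K⁻¹)_-`.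
  have hconj : ∀ k : ℕ, conjOp t₀ m n K (-(k + 1 : ℕ)) = -W (k + 1) := fun k => by
    have h1 : W (k + 1) = comp (ofSeq p) K.opInv (-(k + 1 : ℕ)) := by
      rw [Dressing.opInv_eq, comp_ofSeq, ofSeq_neg]
    have hbs := ((twistBounded_psiStar v).mul_left (tau v)⁻¹).dx_iterate k
    have hb1' := (hb1.mono (le_max_left 0 s)).mul_left (tau v)⁻¹
    have hb2' := (hb2.mono (le_max_right 0 s)).mul_left (tau v)⁻¹
    rw [eq_neg_iff_add_eq_zero, h1, conjOp, Dressing.opInv_eq, hv.invCoeff_eq hv₀,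
      comp_neg hbP (fun N hN => ofSeq_pos _ hN) (twistBounded_of_pos hpos) (powCompCoeff_adjSeq hpos),
      comp_neg (twistBounded_ofSeq p) (fun N hN => ofSeq_pos _ hN) (twistBounded_of_pos hpos)
        (powCompCoeff_adjSeq hpos), ← smul_add, hpact, hPact, unact_adjointCoeff, add_comm,
      ← laurentMul_add_left hb1' hb2' hbs]
    simp only [← mul_add, ← hamSeries_add_smul]
    have hbX : TwistBounded (max 0 s) fun N => hamSeries (evalAt chargeOne)
        (psi N (Q A v) + c (N - s) • psi (N - s) v) := fun N hN => by
      funext d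
      have h1 := congrFun (hb1.mono (le_max_left 0 s) N hN) d
      have h2 := congrFun (hb2.mono (le_max_right 0 s) N hN) d
      rw [twist] at h1 h2 ⊢
      rw [hamSeries_add_smul, series_add_apply, h1, h2, series_zero_apply, add_zero]
    rw [laurentMul_mul_left hbX hbs, laurentMul_dx_iterate_mul hbX (twistBounded_psiStar v),
      mul_zero, smul_zero]
    intro l
    rw [hc]
    exact hv.laurentMul_flow_eq_zero c s chargeOne chargeNegOne l
  set w : ℕ → TimeSeries := fun q => if q = 0 then 0 else -W q with hw
  have hminus : minusPart (conjOp t₀ m n K) = ofSeq w := by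
    funext N
    rw [minusPart]
    split_ifs with hN
    · obtain ⟨k, rfl⟩ : ∃ k : ℕ, N = -((k + 1 : ℕ) : ℤ) := ⟨(-N - 1).toNat, by omega⟩
      rw [hconj, ofSeq_neg, hw]
      simp
    · rcases eq_or_ne N 0 with rfl | hN0
      · simp [ofSeq, hw]
      · rw [ofSeq_pos _ (by omega)]
  -- The sequence `w` is `-W` without its term of order zero, so adding back `W` leaves only left
  -- multiplication by `W 0`.
  have hsum : seqMul w K.coeff j + seqMul W K.coeff j = W 0 * K.coeff j := by
    rw [← seqMul_add_left, ← congrFun (seqMul_single_zero (W 0) K.coeff) j]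
    congr 1
    funext q
    simp only [hw]
    split_ifs with hq
    · rw [hq, zero_add]
    · rw [neg_add_cancel]
  have hWK : seqMul W K.coeff = p := by
    rw [hW, seqMul_assoc, Dressing.invCoeff_seqMul_coeff, seqMul_seqOne]
  have hW0 : W 0 = (tau v)⁻¹ * tauFlow t₀ m n v := by
    have h0 : p 0 = (tau v)⁻¹ * tauFlow t₀ m n v := by
      rw [hp]
      simp only
      rw [tauFlow, miwaShift_zero_tau]
    rw [hW, ← h0]
    simp [seqMul, Dressing.invCoeff]
  rw [V, hminus, Dressing.op_eq, comp_ofSeq, ofSeq_neg, ← hW0, eq_sub_of_add_eq hsum, hWK,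
    dressing_coeff hv₀, hp]
  ring

/-! ### Differentiable curves of power series -/

/-- Coefficientwise derivatives of curves of power series. -/
def HasSeriesDerivAt (F : ℂ → TimeSeries) (F' : TimeSeries) (z : ℂ) : Prop :=
  ∀ d, HasDerivAt (fun w => F w d) (F' d) z

lemma HasSeriesDerivAt.mul {F G : ℂ → TimeSeries} {F' G' : TimeSeries} {z : ℂ}
    (hF : HasSeriesDerivAt F F' z) (hG : HasSeriesDerivAt G G' z) :
    HasSeriesDerivAt (fun w => F w * G w) (F' * G z + F z * G') z := fun d => by
  simp only [series_add_apply, series_mul_apply]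
  rw [← Finset.sum_add_distrib]
  exact HasDerivAt.fun_sum fun p _ => (hF p.1).mul (hG p.2)

lemma series_inv_apply (f : TimeSeries) (d : ℕ+ →₀ ℕ) :
    f⁻¹ d = if d = 0 then (f 0)⁻¹ else
      -(f 0)⁻¹ * ∑ p ∈ antidiagonal d, if p.2 < d then f p.1 * f⁻¹ p.2 else 0 := by
  classical
  exact MvPowerSeries.coeff_inv d f

lemma series_mul_inv {f : TimeSeries} (h : f 0 ≠ 0) : f * f⁻¹ = 1 :=
  MvPowerSeries.mul_inv_cancel f h

/-- Each coefficient of the inverse is a rational expression in finitely many coefficients, with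
only the constant term in the denominator. -/
lemma HasSeriesDerivAt.exists_inv {F : ℂ → TimeSeries} {F' : TimeSeries} {z : ℂ}
    (hF : HasSeriesDerivAt F F' z) (h0 : F z 0 ≠ 0) :
    ∃ G', HasSeriesDerivAt (fun w => (F w)⁻¹) G' z := by
  suffices h : ∀ d, DifferentiableAt ℂ (fun w => (F w)⁻¹ d) z from
    ⟨fun d => deriv (fun w => (F w)⁻¹ d) z, fun d => (h d).hasDerivAt⟩
  intro d
  induction d using WellFoundedLT.induction with
  | ind d ih =>
    rw [funext fun w => series_inv_apply (F w) d]
    have hinv : DifferentiableAt ℂ (fun w => (F w 0)⁻¹) z := (hF 0).differentiableAt.inv h0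
    split_ifs with hd
    · exact hinv
    · refine hinv.neg.mul (DifferentiableAt.fun_sum fun p _ => ?_)
      by_cases hp : p.2 < d
      · simp only [if_pos hp]
        exact (hF p.1).differentiableAt.mul (ih p.2 hp)
      · simp only [if_neg hp]
        exact differentiableAt_const 0

lemma HasSeriesDerivAt.inv {F : ℂ → TimeSeries} {F' : TimeSeries} {z : ℂ}
    (hF : HasSeriesDerivAt F F' z) (h0 : F z 0 ≠ 0) :
    HasSeriesDerivAt (fun w => (F w)⁻¹) (-(F z)⁻¹ * F' * (F z)⁻¹) z := by
  obtain ⟨G', hG⟩ := hF.exists_inv h0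
  have h1 : F' * (F z)⁻¹ + F z * G' = 0 := by
    funext d
    -- The relation `F F⁻¹ = 1` holds only where the constant term is nonzero, which suffices near
    -- `z`.
    refine (hF.mul hG d).unique ((hasDerivAt_const z ((1 : TimeSeries) d)).congr_of_eventuallyEq ?_)
    filter_upwards [(hF 0).continuousAt.eventually_ne h0] with w hw
    rw [series_mul_inv hw]
  have h2 : G' = -(F z)⁻¹ * F' * (F z)⁻¹ := by
    linear_combination (F z)⁻¹ * h1 - G' * series_mul_inv h0
  rw [← h2]
  exact hG

lemma miwaShift_apply (j : ℕ) (f : TimeSeries) (e : ℕ+ →₀ ℕ) :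
    miwaShift j f e = ∑ d ∈ weightFinset j,
      (d.prod fun k a => (-((k : ℕ) : ℂ)⁻¹) ^ a * ((e k + a).choose a : ℂ)) * f (e + d) :=
  finsum_weight_eq j fun d => (d.prod fun k a => (-((k : ℕ) : ℂ)⁻¹) ^ a *
    ((e k + a).choose a : ℂ)) * f (e + d)

lemma HasSeriesDerivAt.miwaShift {F : ℂ → TimeSeries} {F' : TimeSeries} {z : ℂ}
    (hF : HasSeriesDerivAt F F' z) (j : ℕ) :
    HasSeriesDerivAt (fun w => miwaShift j (F w)) (miwaShift j F') z := fun e => by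
  simp only [miwaShift_apply]
  exact HasDerivAt.fun_sum fun d _ => (hF (e + d)).const_mul _

end

end KP

/-- Let `g|0⟩` be a vector of the group orbit of the vacuum with `⟨0|g|0⟩ ≠ 0`, and let `T(z)` be any
curve of power series through its tau function at `z = z₀`, with velocity at `z₀` equal to the
fermionic flow of the tau function (for example `T(z) = τ + (z - z₀) V̂_{mn} τ`, or the tau function
of a flow line `g(z)`). Then the dressing of `T(z)` has velocity `V_{mn} K` at `z₀`. -/
theorem theorem7 (t₀ : ℂ) (ht₀ : ∀ k : ℤ, t₀ ≠ (k : ℂ)) (m n : ℤ)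
    (v : KP.Fock) (hv : KP.IsGroupOrbit v) (hv₀ : KP.vacPair v ≠ 0)
    (T : ℂ → KP.TimeSeries) (z₀ : ℂ) (hT₀ : T z₀ = KP.tau v)
    (hT : ∀ d, HasDerivAt (fun z => MvPowerSeries.coeff d (T z))
      (MvPowerSeries.coeff d (KP.tauFlow t₀ m n v)) z₀) :
    ∀ (j : ℕ+) (d : ℕ+ →₀ ℕ),
      HasDerivAt (fun z => MvPowerSeries.coeff d (KP.dressing (T z) j))
        (MvPowerSeries.coeff d (KP.V t₀ m n (KP.dressing (KP.tau v)) j)) z₀ := by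
  intro j
  have hF : KP.HasSeriesDerivAt T (KP.tauFlow t₀ m n v) z₀ := hT
  have h0 : T z₀ 0 ≠ 0 := by
    rwa [hT₀, KP.tau_eq_hamSeries, KP.hamSeries_apply_zero]
  have h := (hF.miwaShift j).mul (hF.inv h0)
  have hV : KP.V t₀ m n (KP.dressing (KP.tau v)) j =
      KP.miwaShift j (KP.tauFlow t₀ m n v) * (T z₀)⁻¹ +
        KP.miwaShift j (T z₀) * (-(T z₀)⁻¹ * KP.tauFlow t₀ m n v * (T z₀)⁻¹) := by
    rw [hv.V_dressing_tau hv₀, hT₀]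
    ring
  rw [hV]
  exact h
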